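/- Let $F$ be a non-archimedean local field with ring of integers $\mathfrak o_F$ and maximal ideal $\mathfrak p_F$, let $D$ be a finite-dimensional division algebra with centre $F$, and let $m\ge 1$. Let $G=\mathrm{GL}_m(D)$ and let $G_{\mathrm{der}}=\ker(\mathrm{Nrd}:G\to F^\times)$ be the kernel of the reduced norm (an inner form of $\mathrm{SL}_n(F)$, where $n=m\sqrt{[D:F]}$). Let $(\pi,V)$ be an irreducible smooth complex representation of $G_{\mathrm{der}}$. *Moy--Prasad depth.* Let $v$ be the valuation of $D$ with $v(F^\times)=\mathbb Z$ (and $v(0)=\infty$). For a point $x=(x_1,\dots,x_m)$ of the standard apartment $\mathbb R^m$ of the (extended) Bruhat--Tits building $\mathcal B(G)$ and $r\ge 0$, the Moy--Prasad group $P_{x,r}\subset G$ is generated by the diagonal matrices $\mathrm{diag}(t_1,\dots,t_m)$ with $v(t_i)=0$ and $v(t_i-1)\ge r$ for all $i$, and by the matrices $1+cE_{ij}$ with $i\ne j$ and $v(c)+x_i-x_j\ge r$. A general point of $\mathcal B(G)$ is of the form $gx$ with $g\in G$ and $x$ in the standard apartment, and $P_{gx,r}=gP_{x,r}g^{-1}$.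 Put $P_{y,r+}=\bigcup_{s>r}P_{y,s}$ and $P'_{y,r+}=P_{y,r+}\cap G_{\mathrm{der}}$. The Moy--Prasad depth $d_{\mathrm{MP}}(\pi)$ is the minimum of all real $r\ge 0$ such that $V^{P'_{y,r+}}\neq 0$ for some $y\in\mathcal B(G)$. *Normalized level.* For a hereditary $\mathfrak o_F$-order $\mathfrak A$ in $\mathrm M_m(D)$ with Jacobson radical $\mathfrak P$, let $e_F(\mathfrak A)$ be the integer with $\mathfrak p_F\mathfrak A=\mathfrak P^{e_F(\mathfrak A)}$, and put $U^j(\mathfrak A)=1+\mathfrak P^j$ for $j\ge 1$ and $U^j(\mathfrak A)'=U^j(\mathfrak A)\cap G_{\mathrm{der}}$. The normalized level of $\pi$ is $$d(\pi)=\min\{\,j/e_F(\mathfrak A)\,\},$$ where $(j,\mathfrak A)$ ranges over all pairs of an integer $j\ge 0$ and a hereditary $\mathfrak o_F$-order $\mathfrak A$ in $\mathrm M_m(D)$ such that $V^{U^{j+1}(\mathfrak A)'}\ne 0$, i.e. $\pi$ contains the trivial character of $U^{j+1}(\mathfrak A)'$. Then both minima exist, and $d_{\mathrm{MP}}(\pi)=d(\pi)$.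 -/

import Mathlib

open ValuativeRel TensorProduct

noncomputable section

namespace InnerFormSL

/-- The group `GL_m(D)` of invertible `m × m` matrices over the division ring `D`. -/
abbrev GLD (D : Type*) [DivisionRing D] (m : ℕ) : Type _ := (Matrix (Fin m) (Fin m) D)ˣ

section Valuation

variable (F : Type*) [Field F] [ValuativeRel F] [TopologicalSpace F]
  [IsNonarchimedeanLocalField F]
variable {D : Type*} [DivisionRing D] [Algebra F D]

/-- The additive valuation of the local field `F`, normalized to have image `ℤ` on `Fˣ`
(meaningful for nonzero arguments only). -/
def ordF (a : F) : ℤ :=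
  -WithZero.log (IsNonarchimedeanLocalField.valueGroupWithZeroIsoInt F (valuation F a))

/-- The unique extension of `ordF` to a valuation of the finite dimensional division algebra `D`:
`v(a) = ord (N_{D/F} a) / [D : F]` (meaningful for nonzero arguments only).
On `F` it is `ordF`, so that it maps `Fˣ` onto `ℤ`. -/
def valD (a : D) : ℝ := (ordF F (Algebra.norm F a) : ℝ) / (Module.finrank F D : ℝ)

/-- The fractional ideal `{a ∈ D | v(a) ≥ s}` of `D`, where `v(0) = ∞`. -/
def ballD (s : ℝ) : Set D := {a | a = 0 ∨ s ≤ valD F a}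

end Valuation

section DerivedGroup

variable (F : Type*) [Field F] (D : Type*) [DivisionRing D] [Algebra F D] (m : ℕ)

/-- The reduced norm of `M_m(D)` on `GL_m(D)`, with values in an algebraic closure of `F`, computed
by means of a splitting `φ` of `M_m(D)` over that algebraic closure: `g ↦ det φ(1 ⊗ g)`.
(By the Skolem-Noether theorem it does not depend on `φ`.) -/
def reducedNorm {n : ℕ}
    (φ : AlgebraicClosure F ⊗[F] Matrix (Fin m) (Fin m) D ≃ₐ[AlgebraicClosure F]
      Matrix (Fin n) (Fin n) (AlgebraicClosure F)) :
    GLD D m →* AlgebraicClosure F where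
  toFun g := (φ (1 ⊗ₜ[F] (g : Matrix (Fin m) (Fin m) D))).det
  map_one' := by
    rw [Units.val_one, ← Algebra.TensorProduct.one_def, map_one, Matrix.det_one]
  map_mul' g h := by
    rw [← Matrix.det_mul, ← map_mul, Algebra.TensorProduct.tmul_mul_tmul, one_mul, Units.val_mul]

/-- `GL_m(D)_der`: the kernel of the reduced norm of `GL_m(D)`. -/
def derivedGL : Subgroup (GLD D m) :=
  ⨅ (n : ℕ) (φ : AlgebraicClosure F ⊗[F] Matrix (Fin m) (Fin m) D ≃ₐ[AlgebraicClosure F]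
      Matrix (Fin n) (Fin n) (AlgebraicClosure F)), (reducedNorm F D m φ).ker

end DerivedGroup

section Representations

/-- A representation of a topological group is smooth if the stabilizer of every vector is open. -/
def IsSmooth {H : Type*} [Group H] [TopologicalSpace H] {V : Type*} [AddCommGroup V] [Module ℂ V]
    (π : Representation ℂ H V) : Prop :=
  ∀ v : V, IsOpen {h : H | π h v = v}

/-- For a representation `π` of a subgroup `H` of `G` and a subset `K` of `G`: there is a nonzero
vector fixed by `K ∩ H`. (When `K` is a subgroup: `π` contains the trivial representation
of `K ∩ H`.) -/
def HasFixedVector {G : Type*} [Group G] {H : Subgroup G} {V : Type*} [AddCommGroup V] [Module ℂ V]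
    (π : Representation ℂ H V) (K : Set G) : Prop :=
  ∃ v : V, v ≠ 0 ∧ ∀ h : H, (h : G) ∈ K → π h v = v

end Representations

section MoyPrasad

variable (F : Type*) [Field F] [ValuativeRel F] [TopologicalSpace F]
  [IsNonarchimedeanLocalField F]
variable (D : Type*) [DivisionRing D] [Algebra F D] {m : ℕ}

/-- The subgroup `U_{a,s}` (`a = e_i - e_j`, `i ≠ j`) of the root subgroup `U_a ≅ D` of `GL_m(D)`,
relative to the diagonal maximal `F`-split torus: matrices `1 + c E_{ij}` with `v(c) ≥ s`. -/
def rootFiltration (i j : Fin m) (s : ℝ) : Set (GLD D m) :=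
  {g | ∃ c ∈ ballD F (D := D) s,
    (g : Matrix (Fin m) (Fin m) D) = 1 + Matrix.single i j c}

/-- The Moy-Prasad filtration of the minimal Levi subgroup `(Dˣ)^m` of diagonal matrices: for
`r = 0` all entries are units of the maximal order of `D`, and for `r > 0` moreover all entries
`t` satisfy `v(t - 1) ≥ r`. -/
def leviFiltration (r : ℝ) : Set (GLD D m) :=
  {g | ∃ t : Fin m → D, (g : Matrix (Fin m) (Fin m) D) = Matrix.diagonal t ∧
    ∀ i, t i ≠ 0 ∧ valD F (t i) = 0 ∧ t i - 1 ∈ ballD F (D := D) r}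

/-- The Moy-Prasad group `P_{x,r}` (`r ≥ 0`) for a point `x` of the standard apartment `ℝ^m`
of the (extended) Bruhat-Tits building of `GL_m(D)`: the subgroup generated by the `r`-th
filtration subgroup of the minimal Levi subgroup and by the affine root subgroups `U_ψ`,
`ψ = a + k`, with `ψ(x) = a(x) + k ≥ r`. Here `a(x) = x_i - x_j` if `a = e_i - e_j`. -/
def moyPrasadStd (x : Fin m → ℝ) (r : ℝ) : Subgroup (GLD D m) :=
  Subgroup.closure
    (leviFiltration F D r ∪
      ⋃ (i : Fin m) (j : Fin m) (_ : i ≠ j), rootFiltration F D i j (r - (x i - x j)))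

/-- The Moy-Prasad group `P_{y,r}` for the point `y = g • x` of the Bruhat-Tits building, where
`g ∈ GL_m(D)` and `x` lies in the standard apartment. Every point of the building is of this
form, and `P_{g • x, r} = g P_{x,r} g⁻¹`. -/
def moyPrasad (g : GLD D m) (x : Fin m → ℝ) (r : ℝ) : Subgroup (GLD D m) :=
  (moyPrasadStd F D x r).map (MulAut.conj g).toMonoidHom

/-- `P_{y,r+}`, the union of the decreasing family of groups `P_{y,s}` with `s > r`. -/
def moyPrasadPlus (g : GLD D m) (x : Fin m → ℝ) (r : ℝ) : Set (GLD D m) :=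
  ⋃ (s : ℝ) (_ : r < s), (moyPrasad F D g x s : Set (GLD D m))

end MoyPrasad

section HereditaryOrders

variable (F : Type*) [Field F] [ValuativeRel F]
variable {D : Type*} [DivisionRing D] [Algebra F D] {m : ℕ}

/-- `A` is a hereditary `𝔬_F`-order in `M_m(D)`: a subring which is a full `𝔬_F`-lattice
and all of whose left ideals are projective. -/
structure IsHereditaryOrder (A : Subalgebra 𝒪[F] (Matrix (Fin m) (Fin m) D)) : Prop where
  fg : (Subalgebra.toSubmodule A).FG
  span_eq_top : Submodule.span F (A : Set (Matrix (Fin m) (Fin m) D)) = ⊤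
  projective : ∀ I : Ideal A, Module.Projective A I

/-- `e = e_F(A)` is the integer with `𝔭_F A = 𝔓^e`, where `𝔓` is the Jacobson radical of `A`. -/
def IsRamificationIndex (A : Subalgebra 𝒪[F] (Matrix (Fin m) (Fin m) D)) (e : ℕ) : Prop :=
  Ideal.map (algebraMap 𝒪[F] A) 𝓂[F] = Ring.jacobson A ^ e

/-- `U^0(A) = Aˣ` and `U^j(A) = 1 + 𝔓^j` for `j ≥ 1`, as subsets of `GL_m(D)`. -/
def unitFiltration (A : Subalgebra 𝒪[F] (Matrix (Fin m) (Fin m) D)) : ℕ → Set (GLD D m)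
  | 0 => {g | (g : Matrix (Fin m) (Fin m) D) ∈ A ∧
      ((g⁻¹ : GLD D m) : Matrix (Fin m) (Fin m) D) ∈ A}
  | j + 1 => {g | ∃ a : A, a ∈ Ring.jacobson A ^ (j + 1) ∧
      (g : Matrix (Fin m) (Fin m) D) = 1 + (a : Matrix (Fin m) (Fin m) D)}

end HereditaryOrders

section Depth

variable (F : Type*) [Field F] [ValuativeRel F] [TopologicalSpace F]
  [IsNonarchimedeanLocalField F]
variable {D : Type*} [DivisionRing D] [Algebra F D] {m : ℕ}
variable {V : Type*} [AddCommGroup V] [Module ℂ V]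

/-- The set of all `r ≥ 0` such that, for some point `y` of the Bruhat-Tits building, `π` has
nonzero vectors fixed by `P'_{y,r+} = P_{y,r+} ∩ GL_m(D)_der`. -/
def moyPrasadSet (π : Representation ℂ (derivedGL F D m) V) : Set ℝ :=
  {r | 0 ≤ r ∧ ∃ (g : GLD D m) (x : Fin m → ℝ), HasFixedVector π (moyPrasadPlus F D g x r)}

/-- The Moy-Prasad depth of `π`. -/
def moyPrasadDepth (π : Representation ℂ (derivedGL F D m) V) : ℝ := sInf (moyPrasadSet F π)

/-- The set of all `j / e_F(A)`, where `j ≥ 0` is an integer and `A` is a hereditary `𝔬_F`-order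
in `M_m(D)` such that `π` contains the trivial character of `U^{j+1}(A) ∩ GL_m(D)_der`. -/
def levelSet (π : Representation ℂ (derivedGL F D m) V) : Set ℝ :=
  {s | ∃ (A : Subalgebra 𝒪[F] (Matrix (Fin m) (Fin m) D)) (e j : ℕ),
    IsHereditaryOrder F A ∧ IsRamificationIndex F A e ∧
    HasFixedVector π (unitFiltration F A (j + 1)) ∧ s = (j : ℝ) / (e : ℝ)}

/-- The normalized level of `π`. -/
def normalizedLevel (π : Representation ℂ (derivedGL F D m) V) : ℝ := sInf (levelSet F π)

end Depth

end InnerFormSL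

end

/-! Both invariants only ask which filtration subgroups fix a nonzero vector, so it suffices to
compare the two families of subgroups by inclusion. The representation itself enters only through
smoothness and `V ≠ 0`, which make `moyPrasadSet` nonempty (`moyPrasadSet_nonempty`).

From orders to points. Let `A` be hereditary with radical `J` and `e = e_F(A)`. The bounded nonzero
`A`-submodules of the column space `D^m` form a single chain, on which `J` acts as the shift by one
and right multiplication by a nonzero `d : D` as the shift by `e * v(d)` (`exists_eq_chain`,
`map_rightMul_chain`). The chain is thus a norm on `D^m`; some basis splits it (`exists_splitting`),
which gives a point `y` of the building. A matrix that shifts the chain by `k` lies in `J^k`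
(`exists_mem_jacobson_pow_of_smul_mem_chain`), whence `P_{y,(j/e)+} ⊆ U^{j+1}(A)`. So `levelSet ⊆
moyPrasadSet`.

From points to orders. Given `y = g • x` and `r`, one needs `A` and `p` with `U^{p+1}(A) ⊆ P_{y,r+}`
and `p / e(A) ≤ r` (`exists_hereditaryOrder_of_point`). The order attached to `x` itself need not
do: when the coordinates of `x` are unevenly spaced, the powers of its radical do not follow the
Moy-Prasad filtration. It is replaced by the order of an evenly spaced point, found by a rotation
number argument (`exists_equidistributed_point`). Sending `t` to the largest element of `⋃ i, X i +
ℤ` below `t + R` is a monotone map commuting with integer translations. It has a periodic orbit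
modulo `ℤ`, of some length `q ≤ m`, advancing in total by `p ≤ q * R`; counting orbit points below
`X i` gives the new coordinates.

The orders so obtained have `e(A) = q * d` with `q ≤ m`, where `(1/d)ℤ` is the value group of `D`.
Hence every element of `moyPrasadSet` dominates an element of `levelSet` with denominator `N = m! *
d`, and the least such level is the minimum of both sets. -/

noncomputable section

set_option linter.unusedSectionVars false

namespace InnerFormSL

open WithZero

/-! ### Orders and balls in the local field -/

section LocalField

variable (F : Type*) [Field F] [ValuativeRel F] [TopologicalSpace F]
  [IsNonarchimedeanLocalField F]

/-- The valuation of `F` with values in `ℤᵐ⁰`. -/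
def valF : Valuation F ℤᵐ⁰ :=
  (valuation F).map
    { toFun := IsNonarchimedeanLocalField.valueGroupWithZeroIsoInt F
      map_zero' := map_zero _
      map_one' := map_one _
      map_mul' := map_mul _ }
    (IsNonarchimedeanLocalField.valueGroupWithZeroIsoInt F).strictMono.monotone

theorem valF_apply (a : F) :
    valF F a = IsNonarchimedeanLocalField.valueGroupWithZeroIsoInt F (valuation F a) := rfl

variable {F}

theorem ordF_eq (a : F) : ordF F a = -log (valF F a) := rfl

theorem valF_eq_exp {a : F} (ha : a ≠ 0) : valF F a = exp (-ordF F a) := by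
  rw [ordF_eq, neg_neg, exp_log ((Valuation.ne_zero_iff _).2 ha)]

theorem valF_le_exp_iff {a : F} {k : ℤ} : valF F a ≤ exp (-k) ↔ a = 0 ∨ k ≤ ordF F a := by
  by_cases ha : a = 0
  · simp [ha]
  · rw [valF_eq_exp ha, exp_le_exp]; simp [ha]

theorem ordF_mul {a b : F} (ha : a ≠ 0) (hb : b ≠ 0) :
    ordF F (a * b) = ordF F a + ordF F b := by
  rw [ordF_eq, map_mul, log_mul ((Valuation.ne_zero_iff _).2 ha) ((Valuation.ne_zero_iff _).2 hb),
    ordF_eq, ordF_eq]; ring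

@[simp] theorem ordF_one : ordF F 1 = 0 := by simp [ordF_eq]

theorem ordF_pow (a : F) (n : ℕ) : ordF F (a ^ n) = n * ordF F a := by
  rw [ordF_eq, map_pow, log_pow, ordF_eq]; simp

theorem ordF_inv (a : F) : ordF F a⁻¹ = -ordF F a := by
  rw [ordF_eq, map_inv₀, log_inv, ordF_eq]

theorem ordF_zpow (a : F) (n : ℤ) : ordF F (a ^ n) = n * ordF F a := by
  rw [ordF_eq, map_zpow₀, log_zpow, ordF_eq]; simp

variable (F) in
theorem exists_ordF_eq (k : ℤ) : ∃ a : F, a ≠ 0 ∧ ordF F a = k := by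
  obtain ⟨a, ha⟩ := ValuativeRel.valuation_surjective
    ((IsNonarchimedeanLocalField.valueGroupWithZeroIsoInt F).symm (exp (-k)))
  have h : valF F a = exp (-k) := by rw [valF_apply, ha]; simp
  refine ⟨a, fun h0 => ?_, by rw [ordF_eq, h]; simp⟩
  exact exp_ne_zero (h.symm.trans (by simp [h0]))

theorem mem_integer_iff {a : F} : a ∈ 𝒪[F] ↔ a = 0 ∨ 0 ≤ ordF F a := by
  rw [← valF_le_exp_iff, Valuation.mem_integer_iff, valF_apply]
  simp only [neg_zero, exp_zero]
  rw [← map_one (IsNonarchimedeanLocalField.valueGroupWithZeroIsoInt F)]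
  exact ((IsNonarchimedeanLocalField.valueGroupWithZeroIsoInt F).strictMono.le_iff_le).symm

/-- The fractional ideal `{a ∈ F | ord a ≥ k}`. -/
def ballF (k : ℤ) : AddSubgroup F where
  carrier := {a | valF F a ≤ exp (-k)}
  zero_mem' := by simp
  add_mem' {a b} ha hb := ((valF F).map_add a b).trans (max_le ha hb)
  neg_mem' {a} ha := by simpa [Valuation.map_neg] using ha

theorem mem_ballF {a : F} {k : ℤ} : a ∈ ballF k ↔ a = 0 ∨ k ≤ ordF F a := valF_le_exp_iff

theorem mul_mem_ballF {a b : F} {k l : ℤ} (ha : a ∈ ballF k) (hb : b ∈ ballF l) :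
    a * b ∈ ballF (k + l) := by
  rw [mem_ballF] at *
  by_cases h : a = 0
  · simp [h]
  by_cases h' : b = 0
  · simp [h']
  right
  rw [ordF_mul h h']
  simp only [h, h', false_or] at ha hb
  omega

theorem ballF_mono {k l : ℤ} (h : k ≤ l) : ballF l ≤ ballF (F := F) k := fun a ha => by
  rw [mem_ballF] at *
  exact ha.imp id fun h' => h.trans h'

theorem mem_ballF_zero {a : F} : a ∈ ballF 0 ↔ a ∈ 𝒪[F] := by
  rw [mem_ballF, mem_integer_iff]

theorem natCast_mem_ballF (n : ℕ) : (n : F) ∈ ballF (F := F) 0 :=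
  mem_ballF_zero.2 (natCast_mem _ n)

theorem isOpen_ballF (k : ℤ) : IsOpen (ballF (F := F) k : Set F) := by
  rw [isOpen_iff_mem_nhds]
  intro x hx
  rw [IsValuativeTopology.mem_nhds_iff]
  refine ⟨Units.mk0 ((IsNonarchimedeanLocalField.valueGroupWithZeroIsoInt F).symm (exp (-k)))
    (by simp), ?_⟩
  rintro _ ⟨z, hz, rfl⟩
  refine AddSubgroup.add_mem _ hx ?_
  change valF F z ≤ _
  rw [valF_apply]
  have := (IsNonarchimedeanLocalField.valueGroupWithZeroIsoInt F).strictMono.monotone (le_of_lt hz)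
  simpa using this

theorem isCompact_ballF_zero : IsCompact (ballF (F := F) 0 : Set F) := by
  have := IsNonarchimedeanLocalField.isCompact_closedBall F 1
  convert this using 1
  ext x
  exact mem_ballF_zero

theorem exists_ballF_subset {s : Set F} (hs : s ∈ nhds (0 : F)) :
    ∃ k : ℤ, (ballF (F := F) k : Set F) ⊆ s := by
  rw [IsValuativeTopology.mem_nhds_iff] at hs
  obtain ⟨γ, hγ⟩ := hs
  set e := IsNonarchimedeanLocalField.valueGroupWithZeroIsoInt F
  have h0 : e γ ≠ 0 := by simp
  refine ⟨-log (e γ) + 1, fun a ha => hγ ⟨a, ?_, by simp⟩⟩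
  change valF F a ≤ _ at ha
  rw [valF_apply] at ha
  have : e (valuation F a) < e γ := by
    refine lt_of_le_of_lt ha ?_
    rw [← lt_log_iff_exp_lt h0]; omega
  exact e.strictMono.lt_iff_lt.1 this

end LocalField

/-! ### Compactness bounds for the norm of the division algebra -/

section NormBound

theorem norm_ne_zero {F : Type*} [Field F] {D : Type*} [DivisionRing D] [Algebra F D]
    {a : D} (ha : a ≠ 0) : Algebra.norm F a ≠ 0 := by
  intro h
  have := map_mul (Algebra.norm F) a a⁻¹
  rw [mul_inv_cancel₀ ha, map_one, h, zero_mul] at this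
  exact one_ne_zero this

variable {F : Type*} [Field F] [ValuativeRel F] [TopologicalSpace F]
  [IsNonarchimedeanLocalField F]
variable {D : Type*} [DivisionRing D] [Algebra F D] {ι : Type*} [Fintype ι]

theorem continuous_norm_sum_smul (b : Module.Basis ι F D) :
    Continuous fun c : ι → F => Algebra.norm F (∑ i, c i • b i) := by
  classical
  simp_rw [Algebra.norm_eq_matrix_det b, map_sum, map_smul]
  refine Continuous.matrix_det ?_
  fun_prop

/-- The unit sphere of coordinate vectors is compact, and the norm is continuous and nowhere zero on
it because `D` is a division algebra. -/
theorem exists_bound_norm_sphere [FiniteDimensional F D] (b : Module.Basis ι F D) :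
    ∃ C : ℕ, ∀ c : ι → F, (∀ i, c i ∈ ballF (F := F) 0) → (∃ i, c i ∉ ballF (F := F) 1) →
      ordF F (Algebra.norm F (∑ i, c i • b i)) ≤ C := by
  set K : Set (ι → F) := Set.pi Set.univ (fun _ => (ballF (F := F) 0 : Set F)) ∩
    ⋃ i, (fun c : ι → F => c i) ⁻¹' ((ballF (F := F) 1 : Set F)ᶜ) with hK
  have hclosed : IsClosed (⋃ i, (fun c : ι → F => c i) ⁻¹' ((ballF (F := F) 1 : Set F)ᶜ)) :=
    isClosed_iUnion_of_finite fun i =>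
      (isOpen_ballF 1).isClosed_compl.preimage (continuous_apply i)
  have hcomp : IsCompact K :=
    (isCompact_univ_pi fun _ => isCompact_ballF_zero).inter_right hclosed
  obtain ⟨C, hC⟩ := hcomp.elim_directed_cover
    (fun C : ℕ => (fun c : ι → F => Algebra.norm F (∑ i, c i • b i)) ⁻¹'
      ((ballF (F := F) (C + 1) : Set F)ᶜ))
    (fun C => by
      refine IsOpen.preimage (continuous_norm_sum_smul b) ?_
      exact (AddSubgroup.isClosed_of_isOpen _ (isOpen_ballF _)).isOpen_compl)
    (fun c hc => by
      obtain ⟨-, hc⟩ := hc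
      obtain ⟨i, hi⟩ := Set.mem_iUnion.1 hc
      have hne : ∑ i, c i • b i ≠ 0 := by
        intro h0
        apply hi
        have := Fintype.linearIndependent_iff.1 b.linearIndependent c h0 i
        simp [this]
      have := norm_ne_zero (F := F) hne
      refine Set.mem_iUnion.2 ⟨(ordF F (Algebra.norm F (∑ i, c i • b i))).toNat, ?_⟩
      simp only [Set.mem_preimage, Set.mem_compl_iff, SetLike.mem_coe, mem_ballF, this, false_or]
      omega)
    (directed_of_isDirected_le fun C C' h c hc h' => hc (ballF_mono (by omega) h'))
  refine ⟨C, fun c h1 h2 => ?_⟩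
  have := hC ⟨fun i _ => h1 i, Set.mem_iUnion.2 h2⟩
  simp only [Set.mem_preimage, Set.mem_compl_iff, SetLike.mem_coe, mem_ballF, not_or] at this
  omega

theorem exists_bound_norm_ball (b : Module.Basis ι F D) :
    ∃ C : ℕ, ∀ c : ι → F, (∀ i, c i ∈ ballF (F := F) 0) →
      Algebra.norm F (∑ i, c i • b i) ∈ ballF (F := F) (-C) := by
  have hcomp : IsCompact (Set.pi Set.univ (fun _ : ι => (ballF (F := F) 0 : Set F))) :=
    isCompact_univ_pi fun _ => isCompact_ballF_zero
  obtain ⟨C, hC⟩ := hcomp.elim_directed_cover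
    (fun C : ℕ => (fun c : ι → F => Algebra.norm F (∑ i, c i • b i)) ⁻¹'
      (ballF (F := F) (-C) : Set F))
    (fun C => IsOpen.preimage (continuous_norm_sum_smul b) (isOpen_ballF _))
    (fun c _ => by
      refine Set.mem_iUnion.2 ⟨(-ordF F (Algebra.norm F (∑ i, c i • b i))).toNat, ?_⟩
      simp only [Set.mem_preimage, SetLike.mem_coe, mem_ballF]
      omega)
    (directed_of_isDirected_le fun C C' h c hc => ballF_mono (by omega) hc)
  exact ⟨C, fun c hc => hC fun i _ => hc i⟩

end NormBound

end InnerFormSL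

namespace InnerFormSL

/-! ### The valuation of the division algebra -/

section DivisionAlgebra

variable (F : Type*) [Field F] [ValuativeRel F] [TopologicalSpace F]
  [IsNonarchimedeanLocalField F]
variable {D : Type*} [DivisionRing D] [Algebra F D] [FiniteDimensional F D]

theorem norm_smul_eq (t : F) (a : D) :
    Algebra.norm F (t • a) = t ^ Module.finrank F D * Algebra.norm F a := by
  rw [Algebra.smul_def, map_mul, Algebra.norm_algebraMap]

theorem ordF_norm_smul {t : F} (ht : t ≠ 0) {a : D} (ha : a ≠ 0) :
    ordF F (Algebra.norm F (t • a)) =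
      Module.finrank F D * ordF F t + ordF F (Algebra.norm F a) := by
  rw [norm_smul_eq, ordF_mul (pow_ne_zero _ ht) (norm_ne_zero ha), ordF_pow]

/-- The norm is homogeneous of degree `[D : F]`, so scaling reduces the first estimate to the unit
ball and the second, after division by a coordinate of least order, to the unit sphere. Up to a
constant, the norm and the coordinates measure the same size. -/
theorem exists_norm_bounds {ι : Type*} [Fintype ι] (b : Module.Basis ι F D) : ∃ C : ℕ,
    (∀ (k : ℤ) (a : D), a ≠ 0 → (∀ i, b.repr a i ∈ ballF k) →
      Module.finrank F D * k - C ≤ ordF F (Algebra.norm F a)) ∧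
    (∀ (k : ℤ) (a : D), a ≠ 0 → Module.finrank F D * k ≤ ordF F (Algebra.norm F a) →
      ∀ i, b.repr a i ∈ ballF (k - C)) := by
  have hn : 0 < (Module.finrank F D : ℤ) := by exact_mod_cast Module.finrank_pos
  obtain ⟨C₁, h₁⟩ := exists_bound_norm_ball b
  obtain ⟨C₂, h₂⟩ := exists_bound_norm_sphere b
  refine ⟨C₁ + C₂, fun k a ha hk => ?_, fun k a ha hk i => ?_⟩
  · obtain ⟨t, ht, htk⟩ := exists_ordF_eq F (-k)
    have := h₁ (fun i => b.repr (t • a) i) (fun i => by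
      have := mul_mem_ballF (mem_ballF.2 (.inr htk.ge) : t ∈ ballF (-k)) (hk i)
      simpa using this)
    rw [b.sum_repr, mem_ballF] at this
    rcases this with h | h
    · exact absurd h (norm_ne_zero (smul_ne_zero ht ha))
    · rw [ordF_norm_smul F ht ha, htk] at h
      push_cast
      linarith
  · classical
    set S : Finset ι := Finset.univ.filter fun i => b.repr a i ≠ 0
    have hS : S.Nonempty := by
      by_contra hS
      rw [Finset.not_nonempty_iff_eq_empty, Finset.filter_eq_empty_iff] at hS
      apply ha
      rw [← b.repr.map_eq_zero_iff]
      ext j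
      simpa using hS (Finset.mem_univ j)
    obtain ⟨i₀, hi₀, hmin⟩ := S.exists_min_image (fun i => ordF F (b.repr a i)) hS
    have hne : b.repr a i₀ ≠ 0 := (Finset.mem_filter.1 hi₀).2
    have hball : ∀ i, b.repr a i ∈ ballF (ordF F (b.repr a i₀)) := fun i => by
      rw [mem_ballF]
      by_cases h : b.repr a i = 0
      · exact .inl h
      · exact .inr (hmin i (by simp [S, h]))
    set t := (b.repr a i₀)⁻¹
    have ht : t ≠ 0 := inv_ne_zero hne
    have := h₂ (fun i => b.repr (t • a) i) (fun i => by
        have := mul_mem_ballF (mem_ballF.2 (.inr (ordF_inv (b.repr a i₀)).ge) :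
          t ∈ ballF (-ordF F (b.repr a i₀))) (hball i)
        simpa using this) ⟨i₀, by
          have : b.repr (t • a) i₀ = 1 := by simp [t, hne]
          rw [this, mem_ballF]
          simp⟩
    rw [b.sum_repr, ordF_norm_smul F ht ha, ordF_inv] at this
    refine ballF_mono ?_ (hball i)
    have hC : (C₂ : ℤ) ≤ Module.finrank F D * C₂ := by nlinarith
    have : Module.finrank F D * (k - C₂) ≤ Module.finrank F D * ordF F (b.repr a i₀) := by
      nlinarith
    have := le_of_mul_le_mul_left this hn
    push_cast
    omega

theorem ordF_norm_pow (a : D) (k : ℕ) :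
    ordF F (Algebra.norm F (a ^ k)) = k * ordF F (Algebra.norm F a) := by
  rw [map_pow, ordF_pow]

/-- The ultrametric inequality by the power trick. All powers of `a` have coordinates bounded below
uniformly, and binomial coefficients are integral, so the same holds for `(1 + a) ^ k`. Hence `k *
ord N(1 + a)` is bounded below independently of `k`, which excludes a negative order. -/
theorem ordF_norm_one_add_nonneg {a : D} (ha : 0 ≤ ordF F (Algebra.norm F a)) (h0 : a ≠ 0)
    (h1 : 1 + a ≠ 0) : 0 ≤ ordF F (Algebra.norm F (1 + a)) := by
  set b := Module.finBasis F D
  obtain ⟨C, h₁, h₂⟩ := exists_norm_bounds F b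
  set n := Module.finrank F D
  have key : ∀ k : ℕ, -(n * C + C : ℤ) ≤ k * ordF F (Algebra.norm F (1 + a)) := fun k => by
    rw [← ordF_norm_pow]
    have := h₁ (-C) ((1 + a) ^ k) (pow_ne_zero _ h1) fun i => by
      rw [add_comm, (Commute.one_right a).add_pow, map_sum, Finsupp.finsetSum_apply]
      refine AddSubgroup.sum_mem _ fun j _ => ?_
      have h3 := h₂ 0 (a ^ j) (pow_ne_zero _ h0) (by rw [ordF_norm_pow]; simp; positivity) i
      have h4 := mul_mem_ballF (natCast_mem_ballF (k.choose j)) h3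
      rw [one_pow, mul_one, ← (Nat.cast_commute _ _).eq, ← nsmul_eq_mul, map_nsmul]
      simpa using h4
    linarith
  by_contra hneg
  push Not at hneg
  have := key (n * C + C + 1)
  push_cast at this
  have hpos : (0 : ℤ) ≤ n * C + C + 1 := by positivity
  have := mul_nonneg hpos (by omega : 0 ≤ -1 - ordF F (Algebra.norm F (1 + a)))
  linarith

theorem valD_mul {a b : D} (ha : a ≠ 0) (hb : b ≠ 0) :
    valD F (a * b) = valD F a + valD F b := by
  simp only [valD]
  rw [map_mul, ordF_mul (norm_ne_zero ha) (norm_ne_zero hb)]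
  push_cast
  ring

@[simp] theorem valD_one : valD F (1 : D) = 0 := by simp [valD]

theorem valD_inv {a : D} (ha : a ≠ 0) : valD F a⁻¹ = -valD F a := by
  have := valD_mul F ha (inv_ne_zero ha)
  rw [mul_inv_cancel₀ ha, valD_one] at this
  linarith

theorem valD_pow {a : D} (ha : a ≠ 0) (k : ℕ) : valD F (a ^ k) = k * valD F a := by
  induction k with
  | zero => simp
  | succ k ih => rw [pow_succ, valD_mul F (pow_ne_zero _ ha) ha, ih]; push_cast; ring

theorem valD_zpow {a : D} (ha : a ≠ 0) (k : ℤ) : valD F (a ^ k) = k * valD F a := by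
  cases k with
  | ofNat k => simpa using valD_pow F ha k
  | negSucc k =>
    rw [zpow_negSucc, valD_inv F (pow_ne_zero _ ha), valD_pow F ha]; push_cast; ring

theorem valD_algebraMap (a : F) : valD F (algebraMap F D a) = ordF F a := by
  have hn : (Module.finrank F D : ℝ) ≠ 0 := by exact_mod_cast Module.finrank_pos.ne'
  rw [valD, Algebra.norm_algebraMap, ordF_pow]
  push_cast
  field_simp

theorem finrank_pos_real : 0 < (Module.finrank F D : ℝ) := by
  exact_mod_cast Module.finrank_pos

theorem valD_one_add_nonneg {a : D} (ha : 0 ≤ valD F a) (h0 : a ≠ 0) (h1 : 1 + a ≠ 0) :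
    0 ≤ valD F (1 + a) := by
  have hn := finrank_pos_real F (D := D)
  rw [valD, le_div_iff₀ hn, zero_mul] at *
  exact_mod_cast ordF_norm_one_add_nonneg F (by exact_mod_cast ha) h0 h1

theorem valD_neg (a : D) : valD F (-a) = valD F a := by
  by_cases ha : a = 0
  · simp [ha]
  have h1 : valD F (-1 : D) = 0 := by
    have := valD_mul F (neg_ne_zero.2 one_ne_zero : (-1 : D) ≠ 0) (neg_ne_zero.2 one_ne_zero)
    rw [neg_mul_neg, one_mul, valD_one] at this
    linarith
  rw [neg_eq_neg_one_mul, valD_mul F (neg_ne_zero.2 one_ne_zero) ha, h1, zero_add]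

theorem le_valD_add {a b : D} {s : ℝ} (ha : a ≠ 0) (hb : b ≠ 0) (hab : a + b ≠ 0)
    (hsa : s ≤ valD F a) (hsb : s ≤ valD F b) : s ≤ valD F (a + b) := by
  wlog h : valD F a ≤ valD F b generalizing a b
  · rw [add_comm]
    exact this hb ha (by rwa [add_comm]) hsb hsa (le_of_not_ge h)
  have e : a + b = a * (1 + a⁻¹ * b) := by rw [mul_add, mul_inv_cancel_left₀ ha, mul_one]
  have h0 : a⁻¹ * b ≠ 0 := mul_ne_zero (inv_ne_zero ha) hb
  have h1 : 1 + a⁻¹ * b ≠ 0 := fun h1 => hab (by rw [e, h1, mul_zero])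
  rw [e, valD_mul F ha h1]
  have := valD_one_add_nonneg F (a := a⁻¹ * b)
    (by rw [valD_mul F (inv_ne_zero ha) hb, valD_inv F ha]; linarith) h0 h1
  linarith

/-- `ballD` as an additive subgroup. -/
def ball (s : ℝ) : AddSubgroup D where
  carrier := ballD F s
  zero_mem' := .inl rfl
  neg_mem' {a} ha := by
    rcases ha with rfl | ha
    · left; simp
    · right; rwa [valD_neg]
  add_mem' {a b} ha hb := by
    by_cases h0 : a = 0
    · simpa [h0] using hb
    by_cases h1 : b = 0
    · simpa [h1] using ha
    by_cases h2 : a + b = 0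
    · exact .inl h2
    exact .inr (le_valD_add F h0 h1 h2 (ha.resolve_left h0) (hb.resolve_left h1))

variable {F}

theorem mem_ball {a : D} {s : ℝ} : a ∈ ball F s ↔ a = 0 ∨ s ≤ valD F a := Iff.rfl

theorem mem_ball_of_ne {a : D} (ha : a ≠ 0) {s : ℝ} : a ∈ ball F s ↔ s ≤ valD F a := by
  simp [mem_ball, ha]

theorem ball_mono {s t : ℝ} (h : s ≤ t) : ball F t ≤ ball F (D := D) s := fun _ ha =>
  ha.imp id fun h' => h.trans h'

theorem mul_mem_ball {a b : D} {s t : ℝ} (ha : a ∈ ball F s) (hb : b ∈ ball F t) :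
    a * b ∈ ball F (s + t) := by
  by_cases h : a = 0
  · simp [h]
  by_cases h' : b = 0
  · simp [h']
  rw [mem_ball_of_ne h] at ha
  rw [mem_ball_of_ne h'] at hb
  rw [mem_ball_of_ne (mul_ne_zero h h'), valD_mul F h h']
  linarith

theorem one_mem_ball : (1 : D) ∈ ball F 0 := .inr (by simp)

theorem smul_mem_ball {t : F} {k : ℤ} (ht : t ∈ ballF k) {a : D} {s : ℝ} (ha : a ∈ ball F s) :
    t • a ∈ ball F (k + s) := by
  rw [Algebra.smul_def]
  refine mul_mem_ball ?_ ha
  rcases mem_ballF.1 ht with rfl | h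
  · simp
  · right
    rw [valD_algebraMap]
    exact_mod_cast h

theorem valD_smul {t : F} (ht : t ≠ 0) {a : D} (ha : a ≠ 0) :
    valD F (t • a) = ordF F t + valD F a := by
  rw [Algebra.smul_def, valD_mul F (by simpa using ht) ha, valD_algebraMap]

variable (F) in
theorem exists_repr_mem_ballF {ι : Type*} [Fintype ι] (b : Module.Basis ι F D) :
    ∃ C : ℕ, ∀ (k : ℤ) (a : D), a ∈ ball F k → ∀ i, b.repr a i ∈ ballF (k - C) := by
  obtain ⟨C, -, h⟩ := exists_norm_bounds F b
  refine ⟨C, fun k a ha i => ?_⟩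
  rcases mem_ball.1 ha with rfl | hk
  · simp
  by_cases h0 : a = 0
  · simp [h0]
  refine h k a h0 ?_ i
  rw [valD, le_div_iff₀ (finrank_pos_real F)] at hk
  have : (k * Module.finrank F D : ℝ) = ((Module.finrank F D * k : ℤ) : ℝ) := by
    push_cast; ring
  rw [this] at hk
  exact_mod_cast hk

variable (F D) in
/-- The value group of `valD` is `(1/d)ℤ` for some `d ≥ 1`. -/
theorem exists_valueGroup : ∃ d : ℕ, 0 < d ∧ (∀ a : D, a ≠ 0 → ∃ k : ℤ, valD F a = k / d) ∧
    ∃ ϖ : D, ϖ ≠ 0 ∧ valD F ϖ = 1 / d := by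
  -- The orders of norms of nonzero elements form a subgroup `gℤ` of `ℤ` containing `[D : F]`; the
  -- denominator sought is `[D : F] / |g|`.
  let S : AddSubgroup ℤ :=
    { carrier := {k | ∃ a : D, a ≠ 0 ∧ ordF F (Algebra.norm F a) = k}
      zero_mem' := ⟨1, one_ne_zero, by simp⟩
      add_mem' := by
        rintro _ _ ⟨a, ha, rfl⟩ ⟨b, hb, rfl⟩
        exact ⟨a * b, mul_ne_zero ha hb, by
          rw [map_mul, ordF_mul (norm_ne_zero ha) (norm_ne_zero hb)]⟩
      neg_mem' := by
        rintro _ ⟨a, ha, rfl⟩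
        refine ⟨a⁻¹, inv_ne_zero ha, ?_⟩
        have := ordF_mul (norm_ne_zero (F := F) ha) (norm_ne_zero (F := F) (inv_ne_zero ha))
        rw [← map_mul, mul_inv_cancel₀ ha, map_one, ordF_one] at this
        omega }
  obtain ⟨g, hg⟩ := Int.subgroup_cyclic S
  have hn := finrank_pos_real F (D := D)
  have hnS : (Module.finrank F D : ℤ) ∈ S := by
    obtain ⟨t, ht, h⟩ := exists_ordF_eq F 1
    exact ⟨algebraMap F D t, by simpa using ht, by
      rw [Algebra.norm_algebraMap, ordF_pow, h, mul_one]⟩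
  have hmem : ∀ k : ℤ, k ∈ S ↔ g ∣ k := fun k => by
    rw [hg, AddSubgroup.mem_closure_singleton]
    simp [dvd_def, mul_comm, eq_comm]
  obtain ⟨d, hd⟩ := (hmem _).1 hnS
  have hd0 : d ≠ 0 := by
    rintro rfl
    simp only [mul_zero, Nat.cast_eq_zero] at hd
    exact Module.finrank_pos.ne' hd
  have hdabs : (Module.finrank F D : ℤ) = |g| * |d| := by
    rw [← abs_mul, ← hd]; simp
  have hgne : |g| ≠ 0 := by
    intro h
    rw [h, zero_mul] at hdabs
    exact Module.finrank_pos.ne' (by exact_mod_cast hdabs)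
  have hdr : (Module.finrank F D : ℝ) = (|g| : ℤ) * (d.natAbs : ℝ) := by
    rw [Nat.cast_natAbs]; exact_mod_cast hdabs
  have hgr : ((|g| : ℤ) : ℝ) ≠ 0 := by exact_mod_cast hgne
  have hdr0 : (d.natAbs : ℝ) ≠ 0 := by exact_mod_cast Int.natAbs_ne_zero.2 hd0
  refine ⟨d.natAbs, Int.natAbs_pos.2 hd0, fun a ha => ?_, ?_⟩
  · obtain ⟨k, hk⟩ := (abs_dvd g _).2 ((hmem _).1 ⟨a, ha, rfl⟩)
    refine ⟨k, ?_⟩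
    rw [valD, hk, hdr]
    push_cast at hgr ⊢
    field_simp
  · obtain ⟨a, ha, h⟩ := (hmem |g|).2 (by simp)
    refine ⟨a, ha, ?_⟩
    rw [valD, h, hdr]
    field_simp

end DivisionAlgebra

end InnerFormSL

namespace InnerFormSL

/-! ### Moy-Prasad groups of positive depth as `1 +` lattice -/

section MoyPrasadGroups

variable (F : Type*) [Field F] [ValuativeRel F] [TopologicalSpace F]
  [IsNonarchimedeanLocalField F]
variable {D : Type*} [DivisionRing D] [Algebra F D] [FiniteDimensional F D] {m : ℕ}

/-- The Moy-Prasad lattice `{b | v(b i j) + x i - x j ≥ s}` in `M_m(D)`. -/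
def matBall (x : Fin m → ℝ) (s : ℝ) : AddSubgroup (Matrix (Fin m) (Fin m) D) where
  carrier := {b | ∀ i j, b i j ∈ ball F (s - (x i - x j))}
  zero_mem' _ _ := AddSubgroup.zero_mem _
  add_mem' ha hb i j := AddSubgroup.add_mem _ (ha i j) (hb i j)
  neg_mem' ha i j := AddSubgroup.neg_mem _ (ha i j)

variable {F} {x : Fin m → ℝ}

theorem matBall_mono {s t : ℝ} (h : s ≤ t) :
    matBall F x t ≤ matBall F (D := D) x s := fun _ hb i j =>
  ball_mono (by linarith) (hb i j)

theorem mul_mem_matBall {s t : ℝ} {a b : Matrix (Fin m) (Fin m) D} (ha : a ∈ matBall F x s)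
    (hb : b ∈ matBall F x t) : a * b ∈ matBall F x (s + t) := fun i j => by
  rw [Matrix.mul_apply]
  refine AddSubgroup.sum_mem _ fun k _ => ?_
  have := mul_mem_ball (ha i k) (hb k j)
  convert this using 2
  ring

theorem single_mem_matBall {s : ℝ} {i j : Fin m} {c : D} (hc : c ∈ ball F (s - (x i - x j))) :
    Matrix.single i j c ∈ matBall F x s := fun i' j' => by
  rw [Matrix.single_apply]
  split_ifs with h
  · rw [← h.1, ← h.2]; exact hc
  · exact AddSubgroup.zero_mem _

theorem one_mem_matBall : (1 : Matrix (Fin m) (Fin m) D) ∈ matBall F x 0 := fun i j => by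
  rw [Matrix.one_apply]
  split_ifs with h
  · rw [h]; simpa using one_mem_ball
  · exact AddSubgroup.zero_mem _

theorem sub_one_inv_mem_ball {t : D} {s : ℝ} (ht : t ≠ 0) (hv : valD F t = 0)
    (h : t - 1 ∈ ball F s) : t⁻¹ - 1 ∈ ball F s := by
  have e : t⁻¹ - 1 = -((t - 1) * t⁻¹) := by rw [sub_mul, mul_inv_cancel₀ ht, one_mul]; abel
  rw [e]
  refine AddSubgroup.neg_mem _ ?_
  have := mul_mem_ball h (.inr (by rw [valD_inv F ht, hv, neg_zero]) : t⁻¹ ∈ ball F 0)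
  simpa using this

/-- Since `s ≥ 0`, the set `1 + matBall F x s` is closed under products, and it contains the
generators and their inverses. Viewing the group as the monoid generated by both avoids inverting
general elements. -/
theorem sub_one_mem_matBall_of_mem_moyPrasadStd {s : ℝ} (hs : 0 ≤ s) {g : GLD D m}
    (hg : g ∈ moyPrasadStd F D x s) : (g : Matrix (Fin m) (Fin m) D) - 1 ∈ matBall F x s := by
  have hgen : ∀ g ∈ (leviFiltration F D s ∪
      ⋃ (i : Fin m) (j : Fin m) (_ : i ≠ j), rootFiltration F D i j (s - (x i - x j))),
      (g : Matrix (Fin m) (Fin m) D) - 1 ∈ matBall F x s ∧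
        ((g⁻¹ : GLD D m) : Matrix (Fin m) (Fin m) D) - 1 ∈ matBall F x s := by
    rintro g (⟨t, hgt, ht⟩ | hg)
    · have hinv : ((g⁻¹ : GLD D m) : Matrix (Fin m) (Fin m) D) =
          Matrix.diagonal fun i => (t i)⁻¹ := by
        rw [Units.inv_eq_of_mul_eq_one_right]
        rw [hgt, Matrix.diagonal_mul_diagonal]
        simp [mul_inv_cancel₀ (ht _).1]
      have key : ∀ t : Fin m → D, (∀ i, t i - 1 ∈ ball F s) →
          Matrix.diagonal t - 1 ∈ matBall F x s := fun t ht i j => by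
        rw [← Matrix.diagonal_one, Matrix.diagonal_sub, Matrix.diagonal_apply]
        split_ifs with h
        · rw [h, sub_self, sub_zero]; exact ht j
        · exact AddSubgroup.zero_mem _
      rw [hinv, hgt]
      exact ⟨key t fun i => (ht i).2.2, key _ fun i =>
        sub_one_inv_mem_ball (ht i).1 (ht i).2.1 (ht i).2.2⟩
    · simp only [Set.mem_iUnion] at hg
      obtain ⟨i, j, hij, c, hc, hgc⟩ := hg
      have hinv : ((g⁻¹ : GLD D m) : Matrix (Fin m) (Fin m) D) = 1 + Matrix.single i j (-c) := by
        rw [Units.inv_eq_of_mul_eq_one_right]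
        rw [hgc, add_mul, mul_add, mul_add, Matrix.single_mul_single_of_ne _ _ _ _ hij.symm,
          one_mul, one_mul, mul_one, add_zero, add_assoc, ← Matrix.single_add]
        simp
      rw [hinv, hgc, add_sub_cancel_left, add_sub_cancel_left]
      exact ⟨single_mem_matBall hc, single_mem_matBall (AddSubgroup.neg_mem _ hc)⟩
  rw [moyPrasadStd, ← Subgroup.mem_toSubmonoid, Subgroup.closure_toSubmonoid] at hg
  induction hg using Submonoid.closure_induction with
  | mem g hg =>
    rcases hg with hg | hg
    · exact (hgen g hg).1
    · simpa using (hgen _ hg).2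
  | one => simp
  | mul g h _ _ hg hh =>
    have e : ((g * h : GLD D m) : Matrix (Fin m) (Fin m) D) - 1 =
        (g - 1 : Matrix (Fin m) (Fin m) D) * (h - 1) + (g - 1) + (h - 1) := by
      rw [Units.val_mul]; noncomm_ring
    rw [e]
    exact AddSubgroup.add_mem _ (AddSubgroup.add_mem _
      (matBall_mono (by linarith) (mul_mem_matBall hg hh)) hg) hh

theorem exists_mem_moyPrasadStd_eq_column {s : ℝ} (k : Fin m) (f : Fin m → D)
    (hf : ∀ i, f i ∈ ball F (s - (x i - x k))) (T : Finset (Fin m)) (hT : k ∉ T) :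
    ∃ p ∈ moyPrasadStd F D x s,
      (p : Matrix (Fin m) (Fin m) D) = 1 + ∑ i ∈ T, Matrix.single i k (f i) := by
  induction T using Finset.induction_on with
  | empty => exact ⟨1, one_mem _, by simp⟩
  | insert i T hi ih =>
    rw [Finset.mem_insert, not_or] at hT
    obtain ⟨p, hp, hpe⟩ := ih hT.2
    have hik : k ≠ i := hT.1
    have h1 : (1 + Matrix.single i k (f i)) * (1 + Matrix.single i k (-f i)) = 1 := by
      rw [add_mul, mul_add, mul_add, Matrix.single_mul_single_of_ne _ _ _ _ hik,
          one_mul, one_mul, mul_one, add_zero, add_assoc, ← Matrix.single_add]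
      simp
    have h2 : (1 + Matrix.single i k (-f i)) * (1 + Matrix.single i k (f i)) = 1 := by
      rw [add_mul, mul_add, mul_add, Matrix.single_mul_single_of_ne _ _ _ _ hik,
          one_mul, one_mul, mul_one, add_zero, add_assoc, ← Matrix.single_add]
      simp
    let e : GLD D m := ⟨_, _, h1, h2⟩
    have he : e ∈ moyPrasadStd F D x s := Subgroup.subset_closure <| .inr <| by
      simp only [Set.mem_iUnion]
      exact ⟨i, k, hik.symm, f i, hf i, rfl⟩
    refine ⟨e * p, mul_mem he hp, ?_⟩
    rw [Units.val_mul, hpe, Finset.sum_insert hi]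
    change (1 + Matrix.single i k (f i)) * _ = _
    rw [add_mul, one_mul, mul_add, mul_one, Finset.mul_sum, Finset.sum_eq_zero (s := T)
      (f := fun j => Matrix.single i k (f i) * Matrix.single j k (f j))]
    · abel
    · intro j hj
      have hkj : k ≠ j := by rintro rfl; exact hT.2 hj
      exact Matrix.single_mul_single_of_ne _ _ _ _ hkj _

theorem valD_one_add_eq_zero {c : D} {s : ℝ} (hs : 0 < s) (hc : c ∈ ball F s) :
    1 + c ≠ 0 ∧ valD F (1 + c) = 0 := by
  have h0 : 1 + c ≠ 0 := by
    intro h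
    have : c = -1 := (neg_eq_of_add_eq_zero_right h).symm
    rw [this, mem_ball_of_ne (by simp), valD_neg, valD_one] at hc
    linarith
  refine ⟨h0, le_antisymm ?_ ?_⟩
  · by_contra hlt
    push Not at hlt
    have : (1 : D) ∈ ball F (min s (valD F (1 + c))) := by
      have := AddSubgroup.sub_mem _
        (ball_mono (min_le_right s _) ((mem_ball_of_ne h0).2 le_rfl : 1 + c ∈ ball F _))
        (ball_mono (min_le_left s (valD F (1 + c))) hc)
      simpa using this
    rw [mem_ball_of_ne one_ne_zero, valD_one] at this
    exact absurd this (not_le.2 (lt_min hs hlt))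
  · exact (mem_ball_of_ne h0).1 (AddSubgroup.add_mem _ one_mem_ball (ball_mono hs.le hc))

/-- One column at a time: `u = 1 + a k k` is a unit of the maximal order because `s > 0`, and the
matrix is the product of the unipotent with entries `a i k * u⁻¹` in column `k` and the diagonal
matrix with `u` at place `k`. -/
theorem exists_mem_moyPrasadStd_eq_one_add_mul_single {s : ℝ} (hs : 0 < s)
    {a : Matrix (Fin m) (Fin m) D} (ha : a ∈ matBall F x s) (k : Fin m) :
    ∃ p ∈ moyPrasadStd F D x s,
      (p : Matrix (Fin m) (Fin m) D) = 1 + a * Matrix.single k k 1 := by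
  have hkk : a k k ∈ ball F s := by simpa using ha k k
  obtain ⟨hu, hv⟩ := valD_one_add_eq_zero hs hkk
  set u := 1 + a k k with hu_def
  have huinv : u⁻¹ ∈ ball F (0 : ℝ) := .inr (by rw [valD_inv F hu, hv, neg_zero])
  obtain ⟨p, hp, hpe⟩ := exists_mem_moyPrasadStd_eq_column (F := F) (x := x) (s := s) k
    (fun i => a i k * u⁻¹) (fun i => by simpa using mul_mem_ball (ha i k) huinv)
    (Finset.univ.erase k) (by simp)
  let t : Fin m → D := Function.update 1 k u
  have ht : ∀ i, t i ≠ 0 ∧ valD F (t i) = 0 ∧ t i - 1 ∈ ball F (D := D) s := fun i => by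
    by_cases h : i = k
    · subst h
      simp only [t, Function.update_self]
      exact ⟨hu, hv, by rw [hu_def, add_sub_cancel_left]; exact hkk⟩
    · simp [t, h]
  let q : GLD D m := ⟨Matrix.diagonal t, Matrix.diagonal fun i => (t i)⁻¹,
    by simp [Matrix.diagonal_mul_diagonal, mul_inv_cancel₀ (ht _).1],
    by simp [Matrix.diagonal_mul_diagonal, inv_mul_cancel₀ (ht _).1]⟩
  have hq : q ∈ moyPrasadStd F D x s := Subgroup.subset_closure (.inl ⟨t, rfl, ht⟩)
  refine ⟨p * q, mul_mem hp hq, ?_⟩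
  rw [Units.val_mul, hpe]
  change _ * Matrix.diagonal t = _
  ext i j
  rw [Matrix.mul_diagonal, Matrix.add_apply, Matrix.add_apply, Matrix.sum_apply]
  by_cases hj : j = k
  · subst hj
    rw [Matrix.mul_single_apply_same, mul_one]
    simp only [t, Function.update_self]
    by_cases hi : i = j
    · subst hi
      rw [Finset.sum_eq_zero fun l hl => Matrix.single_apply_of_row_ne (Finset.ne_of_mem_erase hl) ..]
      simp [hu_def]
    · rw [Finset.sum_eq_single i (fun l _ hl => Matrix.single_apply_of_row_ne hl ..)
        (by simp [hi])]
      simp [Matrix.one_apply_ne hi, hu]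
  · rw [Matrix.mul_single_apply_of_ne _ _ _ _ _ hj, Finset.sum_eq_zero
      fun l _ => Matrix.single_apply_of_col_ne _ _ (Ne.symm hj) _]
    simp [t, hj]

/-- Gaussian elimination: `1 + a` lies in the Moy-Prasad group when `a` lies in the corresponding
lattice. -/
theorem exists_mem_moyPrasadStd_eq_one_add {s : ℝ} (hs : 0 < s) {a : Matrix (Fin m) (Fin m) D}
    (ha : a ∈ matBall F x s) :
    ∃ g ∈ moyPrasadStd F D x s, (g : Matrix (Fin m) (Fin m) D) = 1 + a := by
  suffices H : ∀ (T : Finset (Fin m)) (a : Matrix (Fin m) (Fin m) D),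
      (∀ j ∉ T, ∀ i, a i j = 0) → a ∈ matBall F x s →
      ∃ g ∈ moyPrasadStd F D x s, (g : Matrix (Fin m) (Fin m) D) = 1 + a from
    H Finset.univ a (by simp) ha
  intro T
  induction T using Finset.induction_on with
  | empty =>
    intro a h0 _
    have : a = 0 := by ext i j; exact h0 j (by simp) i
    exact ⟨1, one_mem _, by simp [this]⟩
  | insert k T hk ih =>
    intro a h0 ha
    obtain ⟨p, hp, hpe⟩ := exists_mem_moyPrasadStd_eq_one_add_mul_single hs ha k
    -- Here `1 + a = p * (1 + p⁻¹ * r)`; left multiplication by `p⁻¹ ∈ matBall F x 0` preserves the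
    -- lattice and keeps the zero columns of `r` zero.
    set r : Matrix (Fin m) (Fin m) D := a - a * Matrix.single k k 1 with hr
    have hcol : ∀ j ∉ T, ∀ i, r i j = 0 := fun j hj i => by
      rw [hr, Matrix.sub_apply]
      by_cases hjk : j = k
      · subst hjk
        simp
      · rw [Matrix.mul_single_apply_of_ne _ _ _ _ _ hjk, sub_zero]
        exact h0 j (by simp [hj, hjk]) i
    have hball : r ∈ matBall F x s :=
      AddSubgroup.sub_mem _ ha (by
        have := mul_mem_matBall ha (single_mem_matBall (x := x) (i := k) (j := k) (s := 0)
          (by simpa using one_mem_ball (F := F) (D := D)))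
        simpa using this)
    have hpinv : ((p⁻¹ : GLD D m) : Matrix (Fin m) (Fin m) D) ∈ matBall F x 0 := by
      have := AddSubgroup.add_mem _ (matBall_mono hs.le
        (sub_one_mem_matBall_of_mem_moyPrasadStd hs.le (inv_mem hp))) one_mem_matBall
      simpa using this
    obtain ⟨g, hg, hge⟩ := ih (((p⁻¹ : GLD D m) : Matrix (Fin m) (Fin m) D) * r)
      (fun j hj i => by
        rw [Matrix.mul_apply]
        exact Finset.sum_eq_zero fun l _ => by rw [hcol j hj l, mul_zero])
      (by simpa using mul_mem_matBall hpinv hball)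
    refine ⟨p * g, mul_mem hp hg, ?_⟩
    rw [Units.val_mul, hge, mul_add, Units.mul_inv_cancel_left, mul_one, hpe, hr]
    abel

theorem mem_moyPrasadStd_of_sub_one_mem_matBall {s : ℝ} (hs : 0 < s) {g : GLD D m}
    (hg : (g : Matrix (Fin m) (Fin m) D) - 1 ∈ matBall F x s) : g ∈ moyPrasadStd F D x s := by
  obtain ⟨g', hg', h⟩ := exists_mem_moyPrasadStd_eq_one_add hs hg
  rw [add_sub_cancel, Units.val_inj] at h
  exact h ▸ hg'

end MoyPrasadGroups

end InnerFormSL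

namespace InnerFormSL

/-! ### A rotation number argument producing evenly spaced points -/

section RotationNumber

/-- Rounding `t + R` down to an element of `⋃ i, X i + ℤ`. -/
def roundDown {ι : Type*} [Fintype ι] [Nonempty ι] (X : ι → ℝ) (R t : ℝ) : ℝ :=
  Finset.univ.sup' Finset.univ_nonempty fun i => X i + ⌊t + R - X i⌋

variable {ι : Type*} [Fintype ι] [Nonempty ι] (X : ι → ℝ) (R : ℝ)

theorem roundDown_le (t : ℝ) : roundDown X R t ≤ t + R :=
  Finset.sup'_le _ _ fun i _ => by linarith [Int.floor_le (t + R - X i)]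

theorem le_roundDown {t : ℝ} {i : ι} {k : ℤ} (h : X i + k ≤ t + R) :
    X i + k ≤ roundDown X R t := by
  refine le_trans ?_ (Finset.le_sup' (fun i => X i + (⌊t + R - X i⌋ : ℝ)) (Finset.mem_univ i))
  have : k ≤ ⌊t + R - X i⌋ := Int.le_floor.2 (by linarith)
  have : (k : ℝ) ≤ ⌊t + R - X i⌋ := by exact_mod_cast this
  linarith

theorem exists_roundDown_eq (t : ℝ) : ∃ (i : ι) (k : ℤ), roundDown X R t = X i + k := by
  obtain ⟨i, -, h⟩ := Finset.exists_mem_eq_sup' Finset.univ_nonempty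
    fun i => X i + (⌊t + R - X i⌋ : ℝ)
  exact ⟨i, _, h⟩

theorem roundDown_le_roundDown_add {t u : ℝ} {k : ℤ} (h : t ≤ u + k) :
    roundDown X R t ≤ roundDown X R u + k := by
  obtain ⟨i, l, hl⟩ := exists_roundDown_eq X R t
  have h1 : X i + ((l - k : ℤ) : ℝ) ≤ u + R := by
    have := roundDown_le X R t
    push_cast
    linarith
  have := le_roundDown X R h1
  rw [hl]
  push_cast at this
  linarith

theorem iterate_roundDown_le (t : ℝ) (n : ℕ) : (roundDown X R)^[n] t ≤ t + n * R := by
  induction n with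
  | zero => simp
  | succ n ih =>
    rw [Function.iterate_succ_apply']
    have := roundDown_le X R ((roundDown X R)^[n] t)
    push_cast
    linarith

variable {R}

theorem le_iterate_roundDown (hR : 0 ≤ R) {t : ℝ} (ht : ∃ (i : ι) (k : ℤ), t = X i + k) (n : ℕ) :
    t ≤ (roundDown X R)^[n] t := by
  have hJ : ∀ n, ∃ (i : ι) (k : ℤ), (roundDown X R)^[n] t = X i + k := fun n => by
    cases n with
    | zero => exact ht
    | succ n => rw [Function.iterate_succ_apply']; exact exists_roundDown_eq X R _
  induction n with
  | zero => exact le_rfl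
  | succ n ih =>
    rw [Function.iterate_succ_apply']
    obtain ⟨i, k, hk⟩ := hJ n
    refine ih.trans ?_
    have := le_roundDown X R (t := (roundDown X R)^[n] t) (i := i) (k := k) (by linarith)
    rwa [← hk] at this

/-- Every threshold function of a point of the apartment is dominated by that of a point
with coordinates in `(1/q)ℤ` that meets all classes modulo `ℤ`. -/
theorem exists_equidistributed_point (hR : 0 ≤ R) :
    ∃ (q p : ℕ) (y : ι → ℤ), 0 < q ∧ q ≤ Fintype.card ι ∧
      (∀ c : ℤ, ∃ (i : ι) (k : ℤ), y i + k * q = c) ∧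
      (∀ (i j : ι) (v : ℤ), p < q * v + y i - y j → R < v + X i - X j) ∧ (p : ℝ) ≤ q * R := by
  classical
  set f := roundDown X R
  obtain ⟨i₀⟩ := ‹Nonempty ι›
  have : Nonempty ι := ⟨i₀⟩
  let s : ℕ → ℝ := fun n => f^[n] (X i₀)
  have hJ : ∀ n, ∃ (i : ι) (k : ℤ), s n = X i + k := fun n => by
    cases n with
    | zero => exact ⟨i₀, 0, by simp [s]⟩
    | succ n =>
      simp only [s]; rw [Function.iterate_succ_apply']; exact exists_roundDown_eq X R _
  -- the first return modulo `ℤ`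
  have hpig : ∃ N, 0 < N ∧ N ≤ Fintype.card ι ∧ ∃ (n : ℕ) (k : ℤ), s (n + N) = s n + k := by
    choose i k hik using hJ
    obtain ⟨a, b, hab, h⟩ := Fintype.exists_ne_map_eq_of_card_lt
      (fun n : Fin (Fintype.card ι + 1) => i n) (by simp)
    wlog hlt : a < b generalizing a b
    · exact this b a hab.symm h.symm (lt_of_le_of_ne (le_of_not_gt hlt) hab.symm)
    have hlt' : (a : ℕ) < b := hlt
    refine ⟨b - a, by omega, by omega, a, k b - k a, ?_⟩
    rw [Nat.add_sub_cancel' hlt'.le, hik b, hik a]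
    rw [h]
    push_cast
    ring
  -- The return time is minimised over all places in the orbit, so that the `N` points of the period
  -- are distinct modulo `ℤ`.
  let Q : ℕ → Prop := fun N => 0 < N ∧ ∃ (n : ℕ) (k : ℤ), s (n + N) = s n + k
  have hQ : ∃ N, Q N := ⟨hpig.choose, hpig.choose_spec.1, hpig.choose_spec.2.2⟩
  set N := Nat.find hQ with hNdef
  obtain ⟨hNpos, n₀, P, hP⟩ : Q N := Nat.find_spec hQ
  have hNmin : ∀ M, Q M → N ≤ M := fun M hM => Nat.find_min' hQ hM
  have hNcard : N ≤ Fintype.card ι :=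
    (hNmin _ ⟨hpig.choose_spec.1, hpig.choose_spec.2.2⟩).trans hpig.choose_spec.2.1
  let u : ℕ → ℝ := fun n => s (n₀ + n)
  have hu_succ : ∀ n, u (n + 1) = f (u n) := fun n => by
    simp only [u, s]; rw [← add_assoc, Function.iterate_succ_apply']
  have huN : u N = u 0 + P := hP
  have hu_iter : ∀ n, u n = f^[n] (u 0) := fun n => by
    simp only [u, s]; rw [← Function.iterate_add_apply, add_zero, add_comm]
  have hP0 : 0 ≤ P := by
    have := le_iterate_roundDown X hR (hJ (n₀ + 0)) N
    change u 0 ≤ f^[N] (u 0) at this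
    rw [← hu_iter, huN] at this
    have : (0 : ℝ) ≤ P := by linarith
    exact_mod_cast this
  have hPR : (P : ℝ) ≤ N * R := by
    have := iterate_roundDown_le X R (u 0) N
    change f^[N] (u 0) ≤ _ at this
    rw [← hu_iter, huN] at this
    linarith
  -- A normalised count of the integer translates of the `N` periodic points lying below `t`.
  let β : ℝ → ℤ := fun t => ∑ n ∈ Finset.range N, ⌈t - u n⌉
  have hβ_mono : ∀ {t t'}, t ≤ t' → β t ≤ β t' := fun h =>
    Finset.sum_le_sum fun n _ => Int.ceil_mono (by linarith)
  have hβ_add : ∀ (t : ℝ) (k : ℤ), β (t + k) = β t + k * N := fun t k => by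
    simp only [β]
    rw [Finset.sum_congr rfl fun n _ => by
      rw [show t + k - u n = t - u n + k by ring, Int.ceil_add_intCast]]
    rw [Finset.sum_add_distrib]
    simp [mul_comm]
  -- Since `f` is monotone, commutes with integer translations and moves `u n` to `u (n + 1)`, the
  -- count for `f t` against the shifted orbit is at most `β t`. Shifting the index back costs `P`,
  -- because `u N = u 0 + P`.
  have hβ_f : ∀ t, β (f t) ≤ β t + P := fun t => by
    have h1 : ∑ n ∈ Finset.range N, ⌈f t - u (n + 1)⌉ ≤ β t := Finset.sum_le_sum fun n _ => by
      rw [Int.ceil_le, hu_succ]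
      have := roundDown_le_roundDown_add X R (t := t) (u := u n) (k := ⌈t - u n⌉)
        (by linarith [Int.le_ceil (t - u n)])
      change f t ≤ f (u n) + _ at this
      linarith
    have h2 := Finset.sum_range_succ' (fun n => ⌈f t - u n⌉) N
    rw [Finset.sum_range_succ, huN, show f t - (u 0 + P) = f t - u 0 - P by ring,
      Int.ceil_sub_intCast] at h2
    simp only [β] at *
    omega
  -- `β` increases immediately to the right of each translate of an orbit point, so this equality
  -- forces `u a = u b + k`, which the minimality of `N` forbids for `a ≠ b`.
  have hβ_inj : ∀ a < N, ∀ b < N, ∀ k : ℤ, β (u a) = β (u b) + k * N → a = b := by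
    intro a ha b hb k h
    rw [← hβ_add] at h
    have key : ∀ c < N, ∀ l : ℤ, ∀ t, u c + l < t → β (u c + l) < β t := fun c hc l t ht => by
      refine Finset.sum_lt_sum (fun n _ => Int.ceil_mono (by linarith))
        ⟨c, Finset.mem_range.2 hc, ?_⟩
      rw [add_sub_cancel_left, Int.ceil_intCast, Int.lt_ceil]
      linarith
    have heq : u a = u b + k := by
      rcases lt_trichotomy (u a) (u b + k) with hlt | heq | hlt
      · have := key a ha 0 _ (by simpa using hlt)
        simp only [Int.cast_zero, add_zero] at this
        omega
      · exact heq
      · have := key b hb k _ hlt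
        omega
    rcases lt_trichotomy a b with hlt | heq' | hlt
    · have := hNmin (b - a) ⟨by omega, n₀ + a, -k, by
        have e : n₀ + a + (b - a) = n₀ + b := by omega
        rw [e]
        change u b = u a + _
        rw [heq]; push_cast; ring⟩
      omega
    · exact heq'
    · have := hNmin (a - b) ⟨by omega, n₀ + b, k, by
        have e : n₀ + b + (a - b) = n₀ + a := by omega
        rw [e]
        exact heq⟩
      omega
  refine ⟨N, P.toNat, fun i => β (X i), hNpos, hNcard, fun c => ?_, fun i j v h => ?_, ?_⟩
  · have : NeZero N := ⟨hNpos.ne'⟩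
    -- `N` distinct residues modulo `N` exhaust `ZMod N`, and every orbit point is some `X i` plus
    -- an integer, so the values `β (X i)` meet all classes.
    have hinj : Function.Injective fun a : Fin N => ((β (u a) : ℤ) : ZMod N) := fun a b h => by
      have := (ZMod.intCast_eq_intCast_iff_dvd_sub _ _ _).1 h.symm
      obtain ⟨k, hk⟩ := this
      exact Fin.ext (hβ_inj a a.2 b b.2 k (by rw [mul_comm] at hk; omega))
    have hsurj := ((Fintype.bijective_iff_injective_and_card
      (fun a : Fin N => ((β (u a) : ℤ) : ZMod N))).2 ⟨hinj, by simp [ZMod.card]⟩).2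
    obtain ⟨a, ha⟩ := hsurj (c : ZMod N)
    obtain ⟨k, hk⟩ := (ZMod.intCast_eq_intCast_iff_dvd_sub _ _ _).1 ha
    obtain ⟨i, l, hil⟩ := hJ (n₀ + a)
    refine ⟨i, l + k, ?_⟩
    have : β (u a) = β (X i) + l * N := by
      rw [← hβ_add]; exact congrArg β hil
    rw [add_mul, ← add_assoc, ← this, mul_comm k]
    omega
  -- In contrapositive form: `X i + v ≤ X j + R` gives `X i + v ≤ f (X j)`, and applying `β` gives
  -- `N * v + β (X i) ≤ β (X j) + P`.
  · by_contra hle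
    push Not at hle
    have h1 := le_roundDown X R (t := X j) (i := i) (k := v) (by linarith)
    have h2 := hβ_mono h1
    rw [hβ_add] at h2
    have h3 := hβ_f (X j)
    change _ ≤ β (f (X j)) at h2
    rw [mul_comm] at h2
    simp only at h
    omega
  · rw [← Int.cast_natCast, Int.toNat_of_nonneg hP0]
    exact hPR

end RotationNumber

end InnerFormSL

namespace InnerFormSL

open Matrix.Module

/-! ### Bounded lattices in the matrix algebra -/

section Lattices

variable {F : Type*} [Field F] [ValuativeRel F] [TopologicalSpace F]
  [IsNonarchimedeanLocalField F]
variable {D : Type*} [DivisionRing D] [Algebra F D] [FiniteDimensional F D] {m : ℕ}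

theorem integer_smul_def {M : Type*} [AddCommGroup M] [Module F M] (t : 𝒪[F]) (b : M) :
    t • b = (t : F) • b := rfl

theorem exists_forall_mem_ball {ι : Type*} [Finite ι] (a : ι → D) :
    ∃ k : ℤ, ∀ i, a i ∈ ball F k := by
  obtain ⟨M, hM⟩ := (Set.finite_range fun i => -valD F (a i)).bddAbove
  refine ⟨-⌈M⌉, fun i => .inr ?_⟩
  have h1 := hM ⟨i, rfl⟩
  have h2 := Int.le_ceil M
  simp only at h1
  push_cast
  linarith

theorem exists_forall_entry_mem_ball (b : Matrix (Fin m) (Fin m) D) :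
    ∃ k : ℤ, ∀ i j, b i j ∈ ball F k := by
  obtain ⟨k, hk⟩ := exists_forall_mem_ball (F := F) fun p : Fin m × Fin m => b p.1 p.2
  exact ⟨k, fun i j => hk (i, j)⟩

theorem exists_forall_abs_sub_le (x : Fin m → ℝ) : ∃ M : ℕ, ∀ i j, |x i - x j| ≤ M := by
  obtain ⟨M, hM⟩ := (Set.finite_range fun p : Fin m × Fin m => |x p.1 - x p.2|).bddAbove
  exact ⟨⌈M⌉₊, fun i j => (hM ⟨(i, j), rfl⟩).trans (Nat.le_ceil M)⟩

/-- Bounded `𝒪`-submodules of `M_m(D)` are finitely generated. -/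
theorem fg_of_forall_mem_ball (N : Submodule 𝒪[F] (Matrix (Fin m) (Fin m) D)) (k : ℤ)
    (hN : ∀ b ∈ N, ∀ i j, b i j ∈ ball F k) : N.FG := by
  set β := Module.finBasis F D
  obtain ⟨C, hC⟩ := exists_repr_mem_ballF F β
  obtain ⟨t, ht, htk⟩ := exists_ordF_eq F (k - C)
  let f : Fin m × Fin m × Fin (Module.finrank F D) → Matrix (Fin m) (Fin m) D :=
    fun p => Matrix.single p.1 p.2.1 (t • β p.2.2)
  have hfg : (Submodule.span 𝒪[F] (Set.range f)).FG :=
    Submodule.fg_span (Set.finite_range f)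
  refine Submodule.FG.of_le hfg fun b hb => ?_
  rw [Matrix.matrix_eq_sum_single b]
  refine Submodule.sum_mem _ fun i _ => Submodule.sum_mem _ fun j _ => ?_
  rw [← β.sum_repr (b i j), ← Matrix.singleAddMonoidHom_apply, map_sum]
  refine Submodule.sum_mem _ fun l _ => ?_
  have h1 := mul_mem_ballF (mem_ballF.2 (.inr (ordF_inv t).ge)) (hC k _ (hN b hb i j) l)
  rw [htk, neg_add_cancel, mem_ballF_zero] at h1
  have h2 : Matrix.single i j ((β.repr (b i j)) l • β l) =
      (⟨t⁻¹ * β.repr (b i j) l, h1⟩ : 𝒪[F]) • f (i, j, l) := by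
    rw [integer_smul_def]
    simp only [f]
    rw [Matrix.smul_single, smul_smul]
    congr 2
    field_simp
  rw [Matrix.singleAddMonoidHom_apply, h2]
  exact Submodule.smul_mem _ _ (Submodule.subset_span ⟨_, rfl⟩)

theorem exists_smul_forall_mem_ball (b : Matrix (Fin m) (Fin m) D) (k : ℤ) :
    ∃ t : F, t ≠ 0 ∧ ∀ i j, (t • b) i j ∈ ball F k := by
  obtain ⟨l, hl⟩ := exists_forall_entry_mem_ball (F := F) b
  obtain ⟨t, ht, htk⟩ := exists_ordF_eq F (k - l)
  refine ⟨t, ht, fun i j => ?_⟩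
  have := smul_mem_ball (mem_ballF.2 (.inr htk.ge) : t ∈ ballF (k - l)) (hl i j)
  push_cast at this
  rwa [sub_add_cancel] at this

end Lattices

section ProjectiveExtension

/-- The surjection of `I` onto its projective image splits, so `I` is a retract of the product of
kernel and image. This allows left ideals to be treated column by column. -/
theorem projective_of_map_of_inf_ker {R M N : Type*} [Ring R] [AddCommGroup M] [Module R M]
    [AddCommGroup N] [Module R N] (f : M →ₗ[R] N) (I : Submodule R M)
    (h1 : Module.Projective R (I.map f)) (h2 : Module.Projective R (I ⊓ f.ker : Submodule R M)) :
    Module.Projective R I := by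
  let p : I →ₗ[R] I.map f := f.submoduleMap I
  obtain ⟨σ, hσ⟩ := p.exists_rightInverse_of_surjective
    (LinearMap.range_eq_top.2 (f.submoduleMap_surjective I))
  let j : (I ⊓ f.ker : Submodule R M) →ₗ[R] I := Submodule.inclusion inf_le_left
  have hpσ : ∀ z, p (σ z) = z := fun z => LinearMap.congr_fun hσ z
  let i : I →ₗ[R] (I ⊓ f.ker : Submodule R M) × I.map f :=
    LinearMap.prod (LinearMap.codRestrict _ (I.subtype ∘ₗ (LinearMap.id - σ ∘ₗ p)) fun z =>
      ⟨Submodule.coe_mem _, by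
        have := congrArg Subtype.val (hpσ (p z))
        simp only [p, LinearMap.submoduleMap_coe_apply] at this
        simp [p, this]⟩) p
  refine Module.Projective.of_split i (LinearMap.coprod j σ) ?_
  ext z
  exact sub_add_cancel (z : M) _

end ProjectiveExtension

/-! ### Hereditary orders of points of the standard apartment -/

section StandardOrder

variable (F : Type*) [Field F] [ValuativeRel F] [TopologicalSpace F]
  [IsNonarchimedeanLocalField F]
variable {D : Type*} [DivisionRing D] [Algebra F D] [FiniteDimensional F D] {m : ℕ}

/-- The order `{b | v(b i j) + x i - x j ≥ 0}` of a point `x` of the standard apartment. -/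
def stdOrder (x : Fin m → ℝ) : Subalgebra 𝒪[F] (Matrix (Fin m) (Fin m) D) where
  carrier := {b | b ∈ matBall F x 0}
  mul_mem' ha hb := by simpa using mul_mem_matBall (F := F) (x := x) ha hb
  add_mem' ha hb := AddSubgroup.add_mem (matBall F x 0) ha hb
  algebraMap_mem' t := by
    rw [Algebra.algebraMap_eq_smul_one]
    change t • (1 : Matrix (Fin m) (Fin m) D) ∈ matBall F x 0
    intro i j
    rw [Matrix.smul_apply, integer_smul_def]
    have := smul_mem_ball (mem_ballF_zero.2 t.2) (one_mem_matBall (F := F) (D := D) (x := x) i j)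
    simpa using this

variable {F} {x : Fin m → ℝ}

theorem mem_stdOrder {b : Matrix (Fin m) (Fin m) D} :
    b ∈ stdOrder F x ↔ b ∈ matBall F x 0 := Iff.rfl

theorem exists_stdOrder_bounded (x : Fin m → ℝ) : ∃ k : ℤ, ∀ b ∈ stdOrder F (D := D) x, ∀ i j,
    b i j ∈ ball F k := by
  obtain ⟨M, hM⟩ := exists_forall_abs_sub_le x
  refine ⟨-M, fun b hb i j => ball_mono ?_ (mem_stdOrder.1 hb i j)⟩
  have := (abs_le.1 (hM i j)).2
  push_cast
  linarith

theorem stdOrder_fg : (Subalgebra.toSubmodule (stdOrder F (D := D) x)).FG := by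
  obtain ⟨k, hk⟩ := exists_stdOrder_bounded (F := F) (D := D) x
  exact fg_of_forall_mem_ball _ k hk

theorem span_stdOrder :
    Submodule.span F (stdOrder F (D := D) x : Set (Matrix (Fin m) (Fin m) D)) = ⊤ := by
  rw [eq_top_iff]
  intro b _
  obtain ⟨M, hM⟩ := exists_forall_abs_sub_le x
  obtain ⟨t, ht, h⟩ := exists_smul_forall_mem_ball (F := F) b M
  have hmem : t • b ∈ stdOrder F x := mem_stdOrder.2 fun i j => ball_mono (by
    have := (abs_le.1 (hM i j)).1
    push_cast
    linarith) (h i j)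
  have := Submodule.smul_mem (Submodule.span F _) t⁻¹ (Submodule.subset_span (R := F) hmem)
  rwa [smul_smul, inv_mul_cancel₀ ht, one_smul] at this

/-- The `j`-th column of an element of an order. -/
def columnMap {R : Type*} [CommRing R] [Algebra R D]
    (A : Subalgebra R (Matrix (Fin m) (Fin m) D)) (j : Fin m) : A →ₗ[A] (Fin m → D) where
  toFun a i := (a : Matrix (Fin m) (Fin m) D) i j
  map_add' _ _ := rfl
  map_smul' a b := by
    ext i
    change ((a : Matrix (Fin m) (Fin m) D) * b) i j = ∑ l, _ • _
    rw [Matrix.mul_apply]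
    rfl

theorem exists_min_of_bddBelow {ι : Type*} [Finite ι] (P : ι → ℤ → Prop) (x : ι → ℝ) (d : ℕ)
    (hd : 0 < d) (B : ℤ) (hB : ∀ i k, P i k → B ≤ k) (hP : ∃ i k, P i k) :
    ∃ i k, P i k ∧ ∀ i' k', P i' k' → (k : ℝ) / d + x i ≤ (k' : ℝ) / d + x i' := by
  classical
  have hd' : (0 : ℝ) < d := by exact_mod_cast hd
  have h1 : ∀ i : {i // ∃ k, P i k}, ∃ k, P i k ∧ ∀ k', P i k' → k ≤ k' := fun i =>
    Int.exists_least_of_bdd ⟨B, fun k hk => hB i k hk⟩ i.2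
  choose κ hκ hmin using h1
  have hne : Nonempty {i // ∃ k, P i k} := ⟨⟨hP.choose, hP.choose_spec⟩⟩
  obtain ⟨i, hi⟩ := Finite.exists_min fun i : {i // ∃ k, P i k} => (κ i : ℝ) / d + x i
  refine ⟨i, κ i, hκ i, fun i' k' h => ?_⟩
  refine (hi ⟨i', k', h⟩).trans ?_
  have : (κ ⟨i', k', h⟩ : ℝ) ≤ k' := by exact_mod_cast hmin ⟨i', k', h⟩ k' h
  simp only
  gcongr

/-- Bounded submodules of the column space are projective over a standard order. -/
theorem projective_of_bounded (N : Submodule (stdOrder F (D := D) x) (Fin m → D)) (K : ℤ)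
    (hN : ∀ w ∈ N, ∀ i, w i ∈ ball F K) : Module.Projective (stdOrder F (D := D) x) N := by
  by_cases hbot : ∀ w ∈ N, w = 0
  · have : Subsingleton N := ⟨fun a b => Subtype.ext ((hbot a a.2).trans (hbot b b.2).symm)⟩
    infer_instance
  push Not at hbot
  obtain ⟨d, hd, hdv, -⟩ := exists_valueGroup F D
  have hd' : (0 : ℝ) < d := by exact_mod_cast hd
  have hcomp : ∀ w ∈ N, ∀ i, Pi.single i (w i) ∈ N := fun w hw i => by
    have h1 : Matrix.single i i (1 : D) ∈ stdOrder F x :=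
      mem_stdOrder.2 (single_mem_matBall (by simpa using one_mem_ball))
    have := N.smul_mem ⟨_, h1⟩ hw
    change Matrix.single i i (1 : D) • w ∈ N at this
    simpa using this
  obtain ⟨i₀, k₀, ⟨d₀, hd₀, hk₀, hmem₀⟩, hmin⟩ := exists_min_of_bddBelow
    (fun (i : Fin m) (k : ℤ) => ∃ c : D, c ≠ 0 ∧ valD F c = k / d ∧ Pi.single i c ∈ N) x d hd
    (K * d) (fun i k ⟨c, hc, hk, hcN⟩ => by
      have := hN _ hcN i
      rw [Pi.single_eq_same, mem_ball_of_ne hc, hk, le_div_iff₀ hd'] at this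
      exact_mod_cast this) (by
      obtain ⟨w, hw, hw0⟩ := hbot
      obtain ⟨i, hi⟩ := Function.ne_iff.1 hw0
      obtain ⟨k, hk⟩ := hdv (w i) hi
      exact ⟨i, k, w i, hi, hk, hcomp w hw i⟩)
  -- `N` is cyclic, generated by the vector `d₀` at place `i₀` that minimises `v(c) + x i`.
  -- Minimality puts the matrix with column `w * d₀⁻¹` in the order, and this matrix gives a section
  -- of `a ↦ a • Pi.single i₀ d₀`.
  have hσ : ∀ w : N, Matrix.of (fun j l => if l = i₀ then (w : Fin m → D) j * d₀⁻¹ else 0) ∈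
      stdOrder F x := fun w => mem_stdOrder.2 fun j l => by
    rw [Matrix.of_apply]
    split_ifs with hl
    · subst hl
      by_cases hwj : (w : Fin m → D) j = 0
      · simp [hwj]
      obtain ⟨k, hk⟩ := hdv _ hwj
      have := hmin j k ⟨_, hwj, hk, hcomp w w.2 j⟩
      rw [mem_ball_of_ne (mul_ne_zero hwj (inv_ne_zero hd₀)),
        valD_mul F hwj (inv_ne_zero hd₀), valD_inv F hd₀, hk, hk₀]
      linarith
    · exact AddSubgroup.zero_mem _
  let σ : N →ₗ[stdOrder F (D := D) x] stdOrder F (D := D) x :=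
    { toFun w := ⟨_, hσ w⟩
      map_add' w w' := Subtype.ext <| by
        ext j l
        change (if l = i₀ then ((w : Fin m → D) j + (w' : Fin m → D) j) * d₀⁻¹ else 0) =
          (if l = i₀ then (w : Fin m → D) j * d₀⁻¹ else 0) +
          (if l = i₀ then (w' : Fin m → D) j * d₀⁻¹ else 0)
        split_ifs
        · rw [add_mul]
        · rw [add_zero]
      map_smul' a w := Subtype.ext <| by
        ext j l
        change (if l = i₀ then (∑ r, (a : Matrix (Fin m) (Fin m) D) j r • (w : Fin m → D) r) * d₀⁻¹
          else 0) = ∑ r, _ * (if l = i₀ then (w : Fin m → D) r * d₀⁻¹ else 0)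
        split_ifs
        · rw [Finset.sum_mul]
          exact Finset.sum_congr rfl fun r _ => mul_assoc _ _ _
        · simp }
  let φ : stdOrder F (D := D) x →ₗ[stdOrder F (D := D) x] N :=
    LinearMap.toSpanSingleton _ _ ⟨_, hmem₀⟩
  refine Module.Projective.of_split σ φ ?_
  ext w j
  change (∑ r, (if r = i₀ then (w : Fin m → D) j * d₀⁻¹ else 0) •
    (Pi.single i₀ d₀ : Fin m → D) r) = (w : Fin m → D) j
  rw [Finset.sum_eq_single i₀ (by intro r _ hr; simp [hr]) (by simp)]
  simp [hd₀]

theorem isHereditaryOrder_stdOrder : IsHereditaryOrder F (stdOrder F (D := D) x) where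
  fg := stdOrder_fg
  span_eq_top := span_stdOrder
  projective := by
    obtain ⟨K, hK⟩ := exists_stdOrder_bounded (F := F) (D := D) x
    -- Induction on the number of columns that may be nonzero: the last one has bounded, hence
    -- projective, image, and the kernel is an ideal with one column fewer.
    suffices H : ∀ (s : ℕ) (I : Ideal (stdOrder F (D := D) x)),
        (∀ a ∈ I, ∀ i (j : Fin m), s ≤ (j : ℕ) → (a : Matrix (Fin m) (Fin m) D) i j = 0) →
        Module.Projective (stdOrder F (D := D) x) I from
      fun I => H m I fun a _ i j h => absurd j.2 (not_lt.2 h)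
    intro s
    induction s with
    | zero =>
      intro I hI
      have : Subsingleton I := ⟨fun a b => Subtype.ext <| Subtype.ext <| by
        ext i j
        rw [hI a a.2 i j (Nat.zero_le _), hI b b.2 i j (Nat.zero_le _)]⟩
      infer_instance
    | succ s ih =>
      intro I hI
      by_cases hs : s < m
      · refine projective_of_map_of_inf_ker (columnMap _ ⟨s, hs⟩) I ?_ (ih _ ?_)
        · refine projective_of_bounded _ K ?_
          rintro _ ⟨a, _, rfl⟩ i
          exact hK a a.2 i _
        · rintro a ⟨ha, hker⟩ i j hj
          rcases hj.eq_or_lt with h | h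
          · have := congrFun (LinearMap.mem_ker.1 hker) i
            have hjs : j = ⟨s, hs⟩ := Fin.ext h.symm
            rw [hjs]
            exact this
          · exact hI a ha i j h
      · exact ih I fun a ha i j hj => absurd j.2 (by omega)

variable (x) in
/-- The coordinates of `x` are equidistributed modulo the value group, with spacing `ε`. -/
structure IsEquidistributed (F : Type*) [Field F] [ValuativeRel F] [TopologicalSpace F]
    [IsNonarchimedeanLocalField F] (D : Type*) [DivisionRing D] [Algebra F D] (ε : ℝ) : Prop where
  pos : 0 < ε
  exists_eq : ∀ j, ∃ (l : Fin m) (d : D), d ≠ 0 ∧ valD F d + (x l - x j) = ε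
  le_of_pos : ∀ (i j : Fin m) (d : D), d ≠ 0 → 0 < valD F d + (x i - x j) →
    ε ≤ valD F d + (x i - x j)

variable {ε : ℝ}

/-- A nonzero entry `c` at `(i, j)` violating the bound has `v(c) + x i - x j = 0`, so `c⁻¹ E_ji`
lies in the order and `b = a * c⁻¹ E_ji` is an element of the radical with `E_ii * b = E_ii`. Then
`1 - E_ii` has a left inverse, which is absurd. Conversely, Gaussian elimination inverts every `1 +
y * a` inside the order. -/
theorem mem_jacobson_stdOrder (hx : IsEquidistributed x F D ε) {a : stdOrder F (D := D) x} :
    a ∈ Ring.jacobson (stdOrder F (D := D) x) ↔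
      (a : Matrix (Fin m) (Fin m) D) ∈ matBall F x ε := by
  constructor
  · intro ha i j
    rw [mem_ball]
    by_contra hcon
    push Not at hcon
    obtain ⟨h0, hlt⟩ := hcon
    set c := (a : Matrix (Fin m) (Fin m) D) i j with hc
    have hge : 0 ≤ valD F c + (x i - x j) := by
      have := (mem_ball_of_ne h0).1 (mem_stdOrder.1 a.2 i j)
      linarith
    have hle : valD F c + (x i - x j) ≤ 0 := by
      by_contra hpos
      push Not at hpos
      have := hx.le_of_pos i j _ h0 hpos
      linarith
    have hmem : Matrix.single j i c⁻¹ ∈ stdOrder F x := mem_stdOrder.2 <| single_mem_matBall <| by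
      rw [mem_ball_of_ne (inv_ne_zero h0), valD_inv F h0]
      linarith
    have hmem' : -Matrix.single i i (1 : D) ∈ stdOrder F x :=
      mem_stdOrder.2 (AddSubgroup.neg_mem _ (single_mem_matBall (by simpa using one_mem_ball)))
    have hb := Ideal.mul_mem_right (⟨_, hmem⟩ : stdOrder F (D := D) x) _ ha
    rw [← Ideal.jacobson_bot, Ideal.mem_jacobson_iff] at hb
    obtain ⟨z, hz⟩ := hb ⟨_, hmem'⟩
    have hz' := congrArg Subtype.val ((Submodule.mem_bot _).1 hz)
    simp only [Subalgebra.coe_sub, Subalgebra.coe_add, Subalgebra.coe_mul, Subalgebra.coe_one,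
      Subalgebra.coe_zero] at hz'
    have e : Matrix.single i i (1 : D) * ((a : Matrix (Fin m) (Fin m) D) * Matrix.single j i c⁻¹) = Matrix.single i i 1 := by
      ext p q
      by_cases hp : p = i
      · subst hp
        rw [Matrix.single_mul_apply_same, one_mul]
        by_cases hq : q = p
        · subst hq
          rw [Matrix.mul_single_apply_same, ← hc, mul_inv_cancel₀ h0, Matrix.single_apply_same]
        · rw [Matrix.mul_single_apply_of_ne _ _ _ _ _ hq,
            Matrix.single_apply_of_col_ne _ _ (Ne.symm hq)]
      · rw [Matrix.single_mul_apply_of_ne _ _ _ _ _ hp,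
          Matrix.single_apply_of_row_ne (Ne.symm hp)]
    rw [mul_neg, neg_mul, mul_assoc, e] at hz'
    have h1 := congrArg (· * Matrix.single i i (1 : D)) (sub_eq_zero.1 hz')
    simp only [add_mul, neg_mul, mul_assoc, Matrix.single_mul_single_same, mul_one, one_mul,
      neg_add_cancel] at h1
    have := congrFun (congrFun h1 i) i
    simp at this
  · intro ha
    rw [← Ideal.jacobson_bot, Ideal.mem_jacobson_iff]
    intro y
    have hya : ((y * a : stdOrder F (D := D) x) : Matrix (Fin m) (Fin m) D) ∈ matBall F x ε := by
      have := mul_mem_matBall (mem_stdOrder.1 y.2) ha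
      rwa [zero_add] at this
    obtain ⟨g, hg, hge⟩ := exists_mem_moyPrasadStd_eq_one_add hx.pos hya
    have hinv := AddSubgroup.add_mem _ (matBall_mono hx.pos.le
      (sub_one_mem_matBall_of_mem_moyPrasadStd hx.pos.le (inv_mem hg))) one_mem_matBall
    rw [sub_add_cancel] at hinv
    refine ⟨⟨_, mem_stdOrder.2 hinv⟩, (Submodule.mem_bot _).2 (Subtype.ext ?_)⟩
    change ((g⁻¹ : GLD D m) : Matrix (Fin m) (Fin m) D) * y * a + (g⁻¹ : GLD D m) - 1 = 0
    have h2 : (y : Matrix (Fin m) (Fin m) D) * a = g - 1 := by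
      rw [hge, add_sub_cancel_left]; rfl
    rw [mul_assoc, h2, mul_sub, Units.inv_mul, mul_one]
    abel

/-- Equidistribution supplies, for each column `j`, some `d E_lj` of relative valuation exactly `ε`,
so that `c E_ij = (c d⁻¹ E_il) * (d E_lj)` splits off one factor from the radical with no loss of
depth. -/
theorem mem_jacobson_pow_stdOrder (hx : IsEquidistributed x F D ε) (k : ℕ)
    {a : stdOrder F (D := D) x} :
    a ∈ Ring.jacobson (stdOrder F (D := D) x) ^ k ↔
      (a : Matrix (Fin m) (Fin m) D) ∈ matBall F x (k * ε) := by
  induction k generalizing a with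
  | zero =>
    rw [Submodule.pow_zero, Ideal.one_eq_top]
    simpa using mem_stdOrder.1 a.2
  | succ k ih =>
    rw [Submodule.pow_succ]
    have key : ((k + 1 : ℕ) : ℝ) * ε = k * ε + ε := by push_cast; ring
    constructor
    · intro ha
      induction ha using Submodule.mul_induction_on' with
      | mem_mul_mem p hp q hq =>
        rw [key]
        exact mul_mem_matBall (ih.1 hp) ((mem_jacobson_stdOrder hx).1 hq)
      | add p _ q _ hp hq => exact AddSubgroup.add_mem _ hp hq
    · intro ha
      have hs : ∀ i j, Matrix.single i j ((a : Matrix (Fin m) (Fin m) D) i j) ∈ stdOrder F x :=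
        fun i j => mem_stdOrder.2 <| matBall_mono (x := x) (by have := hx.pos; positivity)
          (single_mem_matBall (ha i j))
      have e : a = ∑ i, ∑ j, ⟨_, hs i j⟩ := Subtype.ext <| by
        conv_lhs => rw [Matrix.matrix_eq_sum_single (a : Matrix (Fin m) (Fin m) D)]
        simp
      rw [e]
      refine Ideal.sum_mem _ fun i _ => Ideal.sum_mem _ fun j _ => ?_
      obtain ⟨l, d, hd, hl⟩ := hx.exists_eq j
      have h1 : Matrix.single l j d ∈ matBall F x ε := single_mem_matBall (.inr (by linarith))
      have h2 : Matrix.single i l ((a : Matrix (Fin m) (Fin m) D) i j * d⁻¹) ∈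
          matBall F x (k * ε) := single_mem_matBall <| by
        have := mul_mem_ball (ha i j)
          (.inr (valD_inv F hd).ge : d⁻¹ ∈ ball F (-valD F d))
        refine ball_mono ?_ this
        rw [key]
        linarith
      have hk : 0 ≤ k * ε := by have := hx.pos; positivity
      have h3 := Submodule.mul_mem_mul
        (ih.2 h2 : (⟨_, mem_stdOrder.2 (matBall_mono hk h2)⟩ : stdOrder F (D := D) x) ∈ _)
        ((mem_jacobson_stdOrder hx).2 h1 :
          (⟨_, mem_stdOrder.2 (matBall_mono hx.pos.le h1)⟩ : stdOrder F (D := D) x) ∈ _)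
      convert h3 using 1
      refine Subtype.ext ?_
      change _ = Matrix.single i l _ * Matrix.single l j d
      rw [Matrix.single_mul_single_same, inv_mul_cancel_right₀ hd]

theorem mem_maximalIdeal_integer_iff {t : 𝒪[F]} : t ∈ 𝓂[F] ↔ (t : F) ∈ ballF 1 := by
  rw [IsLocalRing.mem_maximalIdeal, mem_nonunits_iff, mem_ballF]
  by_cases ht : t = 0
  · simp [ht]
  have ht' : (t : F) ≠ 0 := by simpa using ht
  have h0 := (mem_integer_iff.1 t.2).resolve_left ht'
  simp only [ht', false_or]
  constructor
  · intro h
    by_contra hlt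
    have h1 : (t : F)⁻¹ ∈ 𝒪[F] := mem_integer_iff.2 (.inr (by rw [ordF_inv]; omega))
    exact h (IsUnit.of_mul_eq_one ⟨_, h1⟩ (Subtype.ext (mul_inv_cancel₀ ht')))
  · rintro h ⟨u, rfl⟩
    have h1 : ((u : 𝒪[F]) : F) * ((u⁻¹ : 𝒪[F]ˣ) : 𝒪[F]) = 1 := by
      rw [← Subring.coe_mul, Units.mul_inv]; rfl
    have h2 : (((u⁻¹ : 𝒪[F]ˣ) : 𝒪[F]) : F) ≠ 0 := by
      intro h2; rw [h2, mul_zero] at h1; exact zero_ne_one h1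
    have h3 := congrArg (ordF F) h1
    rw [ordF_mul ht' h2, ordF_one] at h3
    have h4 := (mem_integer_iff.1 ((u⁻¹ : 𝒪[F]ˣ) : 𝒪[F]).2).resolve_left h2
    omega

theorem isRamificationIndex_stdOrder (hx : IsEquidistributed x F D ε) {e : ℕ} (he : e * ε = 1) :
    IsRamificationIndex F (stdOrder F (D := D) x) e := by
  apply le_antisymm
  · rw [Ideal.map_le_iff_le_comap]
    intro t ht
    rw [Ideal.mem_comap, mem_jacobson_pow_stdOrder hx, he]
    change algebraMap 𝒪[F] (Matrix (Fin m) (Fin m) D) t ∈ _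
    rw [Algebra.algebraMap_eq_smul_one]
    intro i j
    have := smul_mem_ball (mem_maximalIdeal_integer_iff.1 ht)
      (one_mem_matBall (F := F) (D := D) (x := x) i j)
    rw [Matrix.smul_apply, integer_smul_def]
    convert this using 2
    push_cast; ring
  · intro a ha
    rw [mem_jacobson_pow_stdOrder hx, he] at ha
    obtain ⟨t, ht, ht1⟩ := exists_ordF_eq F 1
    have htO : t ∈ 𝒪[F] := mem_integer_iff.2 (.inr (by omega))
    have hb : t⁻¹ • (a : Matrix (Fin m) (Fin m) D) ∈ stdOrder F x := mem_stdOrder.2 fun i j => by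
      have := smul_mem_ball (mem_ballF.2 (.inr (ordF_inv t).ge)) (ha i j)
      rw [Matrix.smul_apply]
      convert this using 2
      rw [ht1]; push_cast; ring
    have e : a = ⟨_, hb⟩ * algebraMap 𝒪[F] (stdOrder F (D := D) x) ⟨t, htO⟩ := by
      refine Subtype.ext ?_
      change (a : Matrix (Fin m) (Fin m) D) =
        t⁻¹ • (a : Matrix (Fin m) (Fin m) D) * algebraMap 𝒪[F] (Matrix (Fin m) (Fin m) D) ⟨t, htO⟩
      rw [Algebra.algebraMap_eq_smul_one, mul_smul_comm, mul_one, integer_smul_def, smul_smul,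
        mul_inv_cancel₀ ht, one_smul]
    rw [e]
    exact Ideal.mul_mem_left _ _ (Ideal.mem_map_of_mem _ (mem_maximalIdeal_integer_iff.2
      (mem_ballF.2 (.inr ht1.ge))))

end StandardOrder

end InnerFormSL

namespace InnerFormSL

/-! ### Conjugation of orders by `GL_m(D)` -/

section Transport

theorem map_mem_jacobson_pow {R S : Type*} [Ring R] [Ring S] (f : R ≃+* S) (k : ℕ) {a : R}
    (ha : a ∈ Ring.jacobson R ^ k) : f a ∈ Ring.jacobson S ^ k := by
  induction k generalizing a with
  | zero => rw [Submodule.pow_zero, Ideal.one_eq_top]; trivial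
  | succ k ih =>
    rw [Submodule.pow_succ] at *
    induction ha using Submodule.mul_induction_on' with
    | mem_mul_mem p hp q hq =>
      rw [map_mul]
      refine Submodule.mul_mem_mul (ih hp) ?_
      rw [← Ideal.jacobson_bot, Ideal.mem_jacobson_iff] at hq ⊢
      intro y
      obtain ⟨z, hz⟩ := hq (f.symm y)
      refine ⟨f z, (Submodule.mem_bot _).2 ?_⟩
      have := congrArg f ((Submodule.mem_bot _).1 hz)
      simpa using this
    | add p _ q _ hp hq => rw [map_add]; exact Ideal.add_mem _ hp hq

variable {F : Type*} [Field F] [ValuativeRel F]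
variable {D : Type*} [DivisionRing D] [Algebra F D] {m : ℕ}

variable (F) in
/-- Conjugation by `g` on `M_m(D)`. -/
def conjMatrix (g : GLD D m) : Matrix (Fin m) (Fin m) D ≃ₐ[F] Matrix (Fin m) (Fin m) D where
  toFun b := g * b * (g⁻¹ : GLD D m)
  invFun b := (g⁻¹ : GLD D m) * b * g
  left_inv b := by simp [mul_assoc]
  right_inv b := by simp [mul_assoc]
  map_mul' a b := by simp [mul_assoc]
  map_add' a b := by rw [mul_add, add_mul]
  commutes' t := by
    rw [Algebra.algebraMap_eq_smul_one, mul_smul_comm, smul_mul_assoc, mul_one, Units.mul_inv]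

/-- The conjugate of an order. -/
def conjOrder (g : GLD D m) (A : Subalgebra 𝒪[F] (Matrix (Fin m) (Fin m) D)) :
    Subalgebra 𝒪[F] (Matrix (Fin m) (Fin m) D) :=
  A.map ((conjMatrix F g).restrictScalars 𝒪[F]).toAlgHom

/-- The isomorphism of an order with its conjugate. -/
def conjOrderEquiv (g : GLD D m) (A : Subalgebra 𝒪[F] (Matrix (Fin m) (Fin m) D)) :
    A ≃ₐ[𝒪[F]] conjOrder g A :=
  ((conjMatrix F g).restrictScalars 𝒪[F]).subalgebraMap A

theorem coe_conjOrderEquiv (g : GLD D m) (A : Subalgebra 𝒪[F] (Matrix (Fin m) (Fin m) D))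
    (a : A) : (conjOrderEquiv g A a : Matrix (Fin m) (Fin m) D) =
      g * (a : Matrix (Fin m) (Fin m) D) * (g⁻¹ : GLD D m) := rfl

theorem isHereditaryOrder_conjOrder (g : GLD D m)
    {A : Subalgebra 𝒪[F] (Matrix (Fin m) (Fin m) D)} (hA : IsHereditaryOrder F A) :
    IsHereditaryOrder F (conjOrder g A) where
  fg := by
    rw [conjOrder, Subalgebra.map_toSubmodule]
    exact hA.fg.map _
  span_eq_top := by
    have h : (conjOrder g A : Set (Matrix (Fin m) (Fin m) D)) =
        (conjMatrix F g).toLinearMap '' A := rfl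
    rw [h, Submodule.span_image, hA.span_eq_top, Submodule.map_top, LinearMap.range_eq_top]
    exact (conjMatrix F g).surjective
  projective I := by
    let e := conjOrderEquiv g A
    let I₀ : Ideal A := I.comap e.toRingEquiv
    have := hA.projective I₀
    have : RingHomInvPair (e.toRingEquiv : A →+* conjOrder g A)
        (e.toRingEquiv.symm : conjOrder g A →+* A) := RingHomInvPair.of_ringEquiv _
    have : RingHomInvPair (e.toRingEquiv.symm : conjOrder g A →+* A)
        (e.toRingEquiv : A →+* conjOrder g A) := RingHomInvPair.symm _ _
    let e₂ : I₀ ≃ₛₗ[(e.toRingEquiv : A →+* conjOrder g A)] I :=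
      { toFun a := ⟨e a, a.2⟩
        invFun a := ⟨e.symm a, by
          change e (e.symm a) ∈ I
          rw [e.apply_symm_apply]; exact a.2⟩
        left_inv a := Subtype.ext (e.symm_apply_apply _)
        right_inv a := Subtype.ext (e.apply_symm_apply _)
        map_add' a b := Subtype.ext (map_add e _ _)
        map_smul' a b := Subtype.ext (map_mul e _ _) }
    exact Module.Projective.of_equiv e₂

theorem isRamificationIndex_conjOrder (g : GLD D m)
    {A : Subalgebra 𝒪[F] (Matrix (Fin m) (Fin m) D)} {n : ℕ} (hA : IsRamificationIndex F A n) :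
    IsRamificationIndex F (conjOrder g A) n := by
  let e := conjOrderEquiv g A
  have h : algebraMap 𝒪[F] (conjOrder g A) =
      (e.toRingEquiv : A →+* conjOrder g A).comp (algebraMap 𝒪[F] A) :=
    RingHom.ext fun t => (e.commutes t).symm
  rw [IsRamificationIndex, h, ← Ideal.map_map, hA]
  apply le_antisymm
  · rw [Ideal.map_le_iff_le_comap]
    exact fun a ha => map_mem_jacobson_pow e.toRingEquiv n ha
  · intro a ha
    have := map_mem_jacobson_pow e.toRingEquiv.symm n ha
    have h2 := Ideal.mem_map_of_mem (e.toRingEquiv : A →+* conjOrder g A) this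
    simpa using h2

theorem exists_of_mem_unitFiltration_conjOrder {g : GLD D m}
    {A : Subalgebra 𝒪[F] (Matrix (Fin m) (Fin m) D)} {j : ℕ} {h : GLD D m}
    (hh : h ∈ unitFiltration F (conjOrder g A) (j + 1)) :
    g⁻¹ * h * g ∈ unitFiltration F A (j + 1) := by
  obtain ⟨a, ha, hha⟩ := hh
  refine ⟨(conjOrderEquiv g A).symm a,
    map_mem_jacobson_pow (conjOrderEquiv g A).toRingEquiv.symm _ ha, ?_⟩
  have h1 : (a : Matrix (Fin m) (Fin m) D) = g *
      ((conjOrderEquiv g A).symm a : Matrix (Fin m) (Fin m) D) * (g⁻¹ : GLD D m) := by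
    rw [← coe_conjOrderEquiv, AlgEquiv.apply_symm_apply]
  rw [Units.val_mul, Units.val_mul, hha, h1, mul_add, add_mul, mul_one, Units.inv_mul]
  simp only [mul_assoc, Units.inv_mul_cancel_left, Units.inv_mul, mul_one]

end Transport

/-! ### From points of the building to hereditary orders -/

section FromBuilding

variable {F : Type*} [Field F] [ValuativeRel F] [TopologicalSpace F]
  [IsNonarchimedeanLocalField F]
variable {D : Type*} [DivisionRing D] [Algebra F D] [FiniteDimensional F D] {m : ℕ}

theorem exists_lt_matBall_of_forall_lt (x : Fin m → ℝ) (r : ℝ)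
    {b : Matrix (Fin m) (Fin m) D}
    (hb : ∀ i j, b i j ≠ 0 → r < valD F (b i j) + (x i - x j)) :
    ∃ s, r < s ∧ b ∈ matBall F x s := by
  classical
  by_cases hm : Nonempty (Fin m × Fin m)
  · obtain ⟨p, hp⟩ := Finite.exists_min fun p : Fin m × Fin m =>
      if b p.1 p.2 = 0 then r + 1 else valD F (b p.1 p.2) + (x p.1 - x p.2)
    refine ⟨if b p.1 p.2 = 0 then r + 1 else valD F (b p.1 p.2) + (x p.1 - x p.2), ?_,
      fun i j => ?_⟩
    · split_ifs with h
      · linarith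
      · exact hb _ _ h
    · rw [mem_ball]
      by_cases h : b i j = 0
      · exact .inl h
      · right
        have := hp (i, j)
        rw [if_neg (show b (i, j).1 (i, j).2 ≠ 0 from h)] at this
        simp only at this ⊢
        linarith
  · exact ⟨r + 1, by linarith, fun i j => absurd ⟨(i, j)⟩ hm⟩

/-- For a point `y = g • x` of the building and `r ≥ 0` there is a hereditary order `A` with
`U^{p+1}(A) ⊆ P_{y,r+}`, `p / e(A) ≤ r` and `e(A)` bounded independently of `y` and `r`. -/
theorem exists_hereditaryOrder_of_point (hm : 0 < m) {d : ℕ} (hd : 0 < d)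
    (hdv : ∀ a : D, a ≠ 0 → ∃ k : ℤ, valD F a = k / d)
    (hϖ : ∃ ϖ : D, ϖ ≠ 0 ∧ valD F ϖ = 1 / d) (g : GLD D m) (x : Fin m → ℝ) {r : ℝ} (hr : 0 ≤ r) :
    ∃ (A : Subalgebra 𝒪[F] (Matrix (Fin m) (Fin m) D)) (q p : ℕ), 0 < q ∧ q ≤ m ∧
      IsHereditaryOrder F A ∧ IsRamificationIndex F A (q * d) ∧
      unitFiltration F A (p + 1) ⊆ moyPrasadPlus F D g x r ∧
      (p : ℝ) / ((q * d : ℕ) : ℝ) ≤ r := by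
  have hd' : (0 : ℝ) < d := by exact_mod_cast hd
  have : Nonempty (Fin m) := ⟨⟨0, hm⟩⟩
  -- Scaling by `d` turns the value group `(1/d)ℤ` into `ℤ`; dividing the integers `y` by `q * d`
  -- undoes the scaling and makes `1 / (q * d)` the spacing.
  obtain ⟨q, p, y, hq, hqm, hres, hlt, hpr⟩ := exists_equidistributed_point
    (fun i => d * x i) (R := d * r) (by positivity)
  rw [Fintype.card_fin] at hqm
  have hq' : (0 : ℝ) < q := by exact_mod_cast hq
  set ε : ℝ := 1 / (q * d) with hε
  let z : Fin m → ℝ := fun i => y i / (q * d)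
  have hval : ∀ (a : D) (k : ℤ), valD F a = k / d → ∀ i j,
      valD F a + (z i - z j) = ((q * k + y i - y j : ℤ) : ℝ) * ε := fun a k hk i j => by
    simp only [z, hk, hε]
    push_cast
    field_simp
    ring
  have hεpos : 0 < ε := by positivity
  have hz : IsEquidistributed z F D ε :=
    { pos := hεpos
      exists_eq := fun j => by
        obtain ⟨l, k, hlk⟩ := hres (y j + 1)
        obtain ⟨ϖ, hϖ0, hϖv⟩ := hϖ
        refine ⟨l, ϖ ^ k, zpow_ne_zero _ hϖ0, ?_⟩
        rw [hval _ k (by rw [valD_zpow F hϖ0, hϖv]; ring)]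
        have : (q * k + y l - y j : ℤ) = 1 := by linarith
        rw [this]; simp
      le_of_pos := fun i j a ha hpos => by
        obtain ⟨k, hk⟩ := hdv a ha
        rw [hval a k hk] at *
        have h1 := (pos_iff_pos_of_mul_pos hpos).2 hεpos
        have h2 : (1 : ℝ) ≤ ((q * k + y i - y j : ℤ) : ℝ) := by
          exact_mod_cast (by exact_mod_cast h1 : 0 < (q * k + y i - y j : ℤ))
        nlinarith }
  refine ⟨conjOrder g (stdOrder F z), q, p, hq, hqm,
    isHereditaryOrder_conjOrder g isHereditaryOrder_stdOrder,
    isRamificationIndex_conjOrder g (isRamificationIndex_stdOrder hz ?_), ?_, ?_⟩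
  · rw [hε]; push_cast; field_simp
  · intro h hh
    obtain ⟨a, ha, hha⟩ := exists_of_mem_unitFiltration_conjOrder hh
    rw [mem_jacobson_pow_stdOrder hz] at ha
    obtain ⟨s, hrs, hs⟩ := exists_lt_matBall_of_forall_lt (F := F) x r
      (b := (a : Matrix (Fin m) (Fin m) D)) fun i j hij => by
        have h1 := (mem_ball_of_ne hij).1 (ha i j)
        obtain ⟨k, hk⟩ := hdv _ hij
        have h2 := hval _ k hk i j
        have h3 : ((p + 1 : ℕ) : ℝ) * ε ≤ ((q * k + y i - y j : ℤ) : ℝ) * ε := by linarith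
        have h4 := le_of_mul_le_mul_right h3 hεpos
        -- The exponent `p + 1` yields the strict inequality `p < q * k + y i - y j` required by
        -- `hlt`.
        have h5 : ((p + 1 : ℕ) : ℤ) ≤ q * k + y i - y j := by exact_mod_cast h4
        have h6 := hlt i j k (by push_cast at h5; omega)
        rw [hk]
        have h7 : d * r < d * (k / d + (x i - x j)) := by
          rw [mul_add, mul_div_cancel₀ _ hd'.ne']; linarith
        exact lt_of_mul_lt_mul_left h7 hd'.le
    refine Set.mem_iUnion₂.2 ⟨s, hrs, g⁻¹ * h * g, ?_, ?_⟩
    · refine mem_moyPrasadStd_of_sub_one_mem_matBall (hr.trans_lt hrs) ?_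
      rw [hha, add_sub_cancel_left]
      exact hs
    · simp [mul_assoc]
  · push_cast
    rw [div_le_iff₀ (by positivity)]
    linarith

end FromBuilding

end InnerFormSL

namespace InnerFormSL

/-! ### Smoothness: some Moy-Prasad group fixes a nonzero vector -/

section Smooth

variable {F : Type*} [Field F] [ValuativeRel F] [TopologicalSpace F]
  [IsNonarchimedeanLocalField F]
variable {D : Type*} [DivisionRing D] [Algebra F D] [FiniteDimensional F D]
  [TopologicalSpace D] [IsModuleTopology F D] {m : ℕ}

variable (F) in
theorem exists_ball_subset_nhds (a : D) {s : Set D} (hs : s ∈ nhds a) :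
    ∃ k : ℕ, ∀ b, b - a ∈ ball F k → b ∈ s := by
  set β := Module.finBasis F D
  obtain ⟨C, hC⟩ := exists_repr_mem_ballF F β
  have : ContinuousAdd D := IsModuleTopology.toContinuousAdd F D
  have : ContinuousSMul F D := IsModuleTopology.toContinuousSMul F D
  have hcont : Continuous fun c : Fin (Module.finrank F D) → F => a + ∑ i, c i • β i := by
    fun_prop
  have h0 : (fun c : Fin (Module.finrank F D) → F => a + ∑ i, c i • β i) ⁻¹' s ∈ nhds 0 :=
    hcont.continuousAt.preimage_mem_nhds (by simpa using hs)
  rw [nhds_pi, Filter.mem_pi'] at h0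
  obtain ⟨I, t, ht, hts⟩ := h0
  choose κ hκ using fun i => exists_ballF_subset (ht i)
  obtain ⟨M, hM⟩ := (Set.finite_range fun i => κ i + C).bddAbove
  refine ⟨M.toNat, fun b hb => ?_⟩
  have hmem := hts (show (fun i => β.repr (b - a) i) ∈ _ from fun i _ => hκ i (by
    refine ballF_mono ?_ (hC M.toNat (b - a) (by exact_mod_cast hb) i)
    have := hM ⟨i, rfl⟩
    simp only at this
    omega))
  have e : a + ∑ i, β.repr (b - a) i • β i = b := by rw [β.sum_repr]; abel
  simpa only [Set.mem_preimage, e] using hmem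

theorem exists_pi_ball_subset_nhds {ι : Type*} [Finite ι] {M : Type*} [AddCommGroup M]
    [TopologicalSpace M] (P : ℕ → M → Prop) (hP : ∀ {k l : ℕ}, k ≤ l → ∀ b, P l b → P k b)
    (h : ∀ (a : M) {s : Set M}, s ∈ nhds a → ∃ k : ℕ, ∀ b, P k (b - a) → b ∈ s)
    (a : ι → M) {s : Set (ι → M)} (hs : s ∈ nhds a) :
    ∃ k : ℕ, ∀ b : ι → M, (∀ i, P k (b i - a i)) → b ∈ s := by
  rw [nhds_pi, Filter.mem_pi'] at hs
  obtain ⟨I, t, ht, hts⟩ := hs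
  choose κ hκ using fun i => h _ (ht i)
  obtain ⟨M, hM⟩ := (Set.finite_range κ).bddAbove
  exact ⟨M, fun b hb => hts fun i _ => hκ i _ (hP (hM ⟨i, rfl⟩) _ (hb i))⟩

variable (F) in
theorem exists_matBall_subset_nhds (a : Matrix (Fin m) (Fin m) D)
    {s : Set (Matrix (Fin m) (Fin m) D)} (hs : s ∈ nhds a) :
    ∃ k : ℕ, ∀ b, b - a ∈ matBall F (0 : Fin m → ℝ) k → b ∈ s := by
  have hmono : ∀ {k l : ℕ}, k ≤ l → ∀ b : D, b ∈ ball F (l : ℝ) → b ∈ ball F (k : ℝ) :=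
    fun h b hb => ball_mono (by exact_mod_cast h) hb
  obtain ⟨k, hk⟩ := exists_pi_ball_subset_nhds
    (fun k (w : Fin m → D) => ∀ j, w j ∈ ball F (k : ℝ))
    (fun h b hb j => hmono h _ (hb j))
    (exists_pi_ball_subset_nhds (fun k (c : D) => c ∈ ball F (k : ℝ)) hmono
      (exists_ball_subset_nhds F)) a hs
  refine ⟨k, fun b hb => hk b fun i j => ?_⟩
  have := hb i j
  simpa using this

theorem moyPrasadSet_nonempty {V : Type*} [AddCommGroup V] [Module ℂ V] [Nontrivial V]
    (π : Representation ℂ (derivedGL F D m) V) (hπ : IsSmooth π) :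
    (moyPrasadSet F π).Nonempty := by
  obtain ⟨v, hv⟩ := exists_ne (0 : V)
  obtain ⟨U, hU, hUe⟩ := isOpen_induced_iff.1 (hπ v)
  have h1 : U ∈ nhds (1 : GLD D m) := hU.mem_nhds (by
    have : (1 : derivedGL F D m) ∈ Subtype.val ⁻¹' U := by rw [hUe]; simp
    exact this)
  -- The topology on units is induced by `g ↦ (g, g⁻¹)`, so both `g` and `g⁻¹` must be close to `1`;
  -- this is available because `P_{x,s}` is a group.
  rw [Units.isEmbedding_embedProduct.isInducing.nhds_eq_comap, Filter.mem_comap] at h1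
  obtain ⟨O, hO, hOU⟩ := h1
  rw [map_one, Prod.one_eq_mk, nhds_prod_eq, Filter.mem_prod_iff] at hO
  obtain ⟨O₁, hO₁, O₂, hO₂, hO⟩ := hO
  have hO₂' : MulOpposite.op ⁻¹' O₂ ∈ nhds (1 : Matrix (Fin m) (Fin m) D) :=
    MulOpposite.continuous_op.continuousAt.preimage_mem_nhds hO₂
  obtain ⟨k₁, hk₁⟩ := exists_matBall_subset_nhds F _ hO₁
  obtain ⟨k₂, hk₂⟩ := exists_matBall_subset_nhds F _ hO₂'
  set k : ℝ := max k₁ k₂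
  have hk0 : 0 ≤ k := le_max_of_le_left (by positivity)
  refine ⟨k, hk0, 1, 0, v, hv, fun h hh => ?_⟩
  suffices hmem : (h : GLD D m) ∈ U by
    have : h ∈ Subtype.val ⁻¹' U := hmem
    rw [hUe] at this
    exact this
  obtain ⟨s, hs, g, hg, hgh⟩ := Set.mem_iUnion₂.1 hh
  have hgh' : g = (h : GLD D m) := by simpa using hgh
  rw [← hgh']
  refine hOU (hO ⟨hk₁ _ ?_, hk₂ _ ?_⟩)
  · exact matBall_mono ((le_max_left _ _).trans hs.le)
      (sub_one_mem_matBall_of_mem_moyPrasadStd (hk0.trans hs.le) hg)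
  · exact matBall_mono ((le_max_right _ _).trans hs.le)
      (sub_one_mem_matBall_of_mem_moyPrasadStd (hk0.trans hs.le) (inv_mem hg))

end Smooth

end InnerFormSL

namespace InnerFormSL

open Matrix.Module

/-! ### Modules whose proper submodules lie in the radical -/

section Hollow

variable {R M : Type*} [Ring R] [AddCommGroup M] [Module R M]

theorem isSemisimpleModule_quotient_jacobson_smul [IsSemisimpleRing (R ⧸ Ring.jacobson R)] :
    IsSemisimpleModule R (M ⧸ (Ring.jacobson R • ⊤ : Submodule R M)) := by
  have h : Module.IsTorsionBySet R (M ⧸ (Ring.jacobson R • ⊤ : Submodule R M))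
      (Ring.jacobson R) := by
    rw [Module.isTorsionBySet_quotient_iff]
    exact fun m i hi ↦ Submodule.smul_mem_smul hi trivial
  let _ := h.module
  exact (h.semilinearMap.isSemisimpleModule_iff_of_bijective Function.bijective_id).2
    inferInstance

/-- If a module has no two proper submodules spanning it and `R / J` is semisimple, then `J • M`
contains all proper submodules. -/
theorem le_jacobson_smul_top_of_ne_top [IsSemisimpleRing (R ⧸ Ring.jacobson R)]
    (hM : ∀ N N' : Submodule R M, N ⊔ N' = ⊤ → N = ⊤ ∨ N' = ⊤) {N : Submodule R M}
    (hN : N ≠ ⊤) : N ≤ Ring.jacobson R • ⊤ := by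
  have := isSemisimpleModule_quotient_jacobson_smul (R := R) (M := M)
  set q := (Ring.jacobson R • ⊤ : Submodule R M).mkQ
  -- A complement of the image of `N` pulls back to a submodule which together with `N` spans `M`.
  -- As `N` is proper, the pullback is everything, so the image of `N` is zero.
  obtain ⟨C, hC⟩ := exists_isCompl (N.map q)
  have h1 : N ⊔ C.comap q = ⊤ := by
    rw [eq_top_iff]
    intro x _
    obtain ⟨_, ⟨y, hy, rfl⟩, c, hc, hx⟩ := Submodule.mem_sup.1
      (hC.sup_eq_top ▸ Submodule.mem_top : q x ∈ N.map q ⊔ C)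
    rw [← add_sub_cancel y x]
    refine Submodule.add_mem_sup hy ?_
    rw [Submodule.mem_comap, map_sub, ← hx, add_sub_cancel_left]
    exact hc
  have h2 := (hM _ _ h1).resolve_left hN
  have h3 : C = ⊤ := by
    rw [eq_top_iff]
    intro y _
    obtain ⟨x, rfl⟩ := Submodule.mkQ_surjective _ y
    have : x ∈ C.comap q := by rw [h2]; exact Submodule.mem_top
    exact this
  have h4 : N.map q = ⊥ := by
    have := hC.inf_eq_bot
    rwa [h3, inf_top_eq] at this
  intro x hx
  have h5 : q x ∈ N.map q := Submodule.mem_map_of_mem hx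
  rw [h4, Submodule.mem_bot] at h5
  exact (Submodule.Quotient.mk_eq_zero _).1 h5

end Hollow

/-! ### Lattices of a hereditary order in the column space -/

section Bounds

variable {F : Type*} [Field F] [ValuativeRel F] [TopologicalSpace F]
  [IsNonarchimedeanLocalField F]
variable {D : Type*} [DivisionRing D] [Algebra F D] [FiniteDimensional F D] {m : ℕ}
variable {A : Subalgebra 𝒪[F] (Matrix (Fin m) (Fin m) D)}

theorem integer_smul_mem_ball {t : 𝒪[F]} {a : D} {s : ℝ} (ha : a ∈ ball F s) :
    t • a ∈ ball F s := by
  have := smul_mem_ball (mem_ballF_zero.2 t.2) ha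
  simpa [integer_smul_def] using this

theorem IsHereditaryOrder.exists_bound (hA : IsHereditaryOrder F A) :
    ∃ K : ℕ, ∀ a ∈ A, ∀ i j, a i j ∈ ball F (-K : ℝ) := by
  obtain ⟨S, hS⟩ := hA.fg
  obtain ⟨k, hk⟩ := exists_forall_mem_ball (F := F) fun p : S × Fin m × Fin m =>
    (p.1 : Matrix (Fin m) (Fin m) D) p.2.1 p.2.2
  refine ⟨(-k).toNat, fun a ha => ?_⟩
  have hk' : (-((-k).toNat : ℝ)) ≤ k := by
    have : -((-k).toNat : ℤ) ≤ k := by omega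
    exact_mod_cast this
  have ha' : a ∈ Submodule.span 𝒪[F] (S : Set (Matrix (Fin m) (Fin m) D)) := hS ▸ ha
  induction ha' using Submodule.span_induction with
  | mem a h => exact fun i j => ball_mono hk' (hk (⟨a, h⟩, i, j))
  | zero => exact fun i j => AddSubgroup.zero_mem _
  | add a b h h' iha ihb =>
    rw [hS] at h h'
    exact fun i j => AddSubgroup.add_mem _ (iha h i j) (ihb h' i j)
  | smul t a h iha =>
    rw [hS] at h
    exact fun i j => integer_smul_mem_ball (iha h i j)

theorem smul_mem_order {t : F} (ht : t ∈ 𝒪[F]) {b : Matrix (Fin m) (Fin m) D} (hb : b ∈ A) :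
    t • b ∈ A := A.smul_mem hb (⟨t, ht⟩ : 𝒪[F])

theorem exists_smul_mem_of_mem_span {b : Matrix (Fin m) (Fin m) D}
    (hb : b ∈ Submodule.span F (A : Set (Matrix (Fin m) (Fin m) D))) :
    ∃ t : F, t ≠ 0 ∧ t ∈ 𝒪[F] ∧ t • b ∈ A := by
  induction hb using Submodule.span_induction with
  | mem b h => exact ⟨1, one_ne_zero, one_mem _, by simpa using h⟩
  | zero => exact ⟨1, one_ne_zero, one_mem _, by simp⟩
  | add a b _ _ iha ihb =>
    obtain ⟨t, ht, htO, hta⟩ := iha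
    obtain ⟨u, hu, huO, hub⟩ := ihb
    refine ⟨t * u, mul_ne_zero ht hu, mul_mem htO huO, ?_⟩
    rw [smul_add]
    refine add_mem ?_ ?_
    · rw [mul_comm, mul_smul]; exact smul_mem_order huO hta
    · rw [mul_smul]; exact smul_mem_order htO hub
  | smul c b _ ih =>
    obtain ⟨t, ht, htO, htb⟩ := ih
    by_cases hc : c = 0
    · exact ⟨1, one_ne_zero, one_mem _, by simp [hc]⟩
    obtain ⟨u, hu, huv⟩ := exists_ordF_eq F (max 0 (-ordF F c))
    refine ⟨u * t, mul_ne_zero hu ht, mul_mem (mem_integer_iff.2 (.inr (by omega))) htO, ?_⟩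
    have : (u * t) • c • b = (u * c) • (t • b) := by
      rw [smul_smul, smul_smul]; congr 1; ring
    rw [this]
    refine smul_mem_order (mem_integer_iff.2 (.inr ?_)) htb
    rw [ordF_mul hu hc]; omega

theorem IsHereditaryOrder.exists_absorbs (hA : IsHereditaryOrder F A) :
    ∃ k : ℤ, ∀ b : Matrix (Fin m) (Fin m) D, (∀ i j, b i j ∈ ball F k) → b ∈ A := by
  set β := Module.finBasis F D
  obtain ⟨C, hC⟩ := exists_repr_mem_ballF F β
  have h1 : ∀ p : Fin m × Fin m × Fin (Module.finrank F D), ∃ t : F, t ≠ 0 ∧ t ∈ 𝒪[F] ∧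
      t • Matrix.single p.1 p.2.1 (β p.2.2) ∈ A := fun p =>
    exists_smul_mem_of_mem_span (hA.span_eq_top ▸ Submodule.mem_top)
  choose t ht htO hmem using h1
  obtain ⟨N, hN⟩ := (Set.finite_range fun p => ordF F (t p)).bddAbove
  refine ⟨N + C, fun b hb => ?_⟩
  rw [Matrix.matrix_eq_sum_single b]
  refine sum_mem fun i _ => sum_mem fun j _ => ?_
  rw [← β.sum_repr (b i j), ← Matrix.singleAddMonoidHom_apply, map_sum]
  refine sum_mem fun l _ => ?_
  have h2 := hC (N + C) _ (hb i j) l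
  rw [add_sub_cancel_right] at h2
  have h3 := mul_mem_ballF (mem_ballF.2 (.inr (ordF_inv (t (i, j, l))).ge)) h2
  have h4 : β.repr (b i j) l = ((t (i, j, l))⁻¹ * β.repr (b i j) l) * t (i, j, l) := by
    have := ht (i, j, l)
    field_simp
  rw [h4, mul_smul, Matrix.singleAddMonoidHom_apply, ← Matrix.smul_single,
    ← Matrix.smul_single]
  refine smul_mem_order (mem_ballF_zero.1 (ballF_mono ?_ h3)) (hmem (i, j, l))
  have := hN ⟨(i, j, l), rfl⟩
  simp only at this
  omega

theorem IsHereditaryOrder.exists_smul_mem (hA : IsHereditaryOrder F A)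
    (b : Matrix (Fin m) (Fin m) D) : ∃ t : F, t ≠ 0 ∧ t ∈ 𝒪[F] ∧ t • b ∈ A :=
  exists_smul_mem_of_mem_span (hA.span_eq_top ▸ Submodule.mem_top)

/-- The matrix with `w` as its column `i` and zeros elsewhere. -/
def columnMatrix (i : Fin m) (w : Fin m → D) : Matrix (Fin m) (Fin m) D :=
  Matrix.of fun j l => if l = i then w j else 0

theorem columnMatrix_apply (i : Fin m) (w : Fin m → D) (j l : Fin m) :
    columnMatrix i w j l = if l = i then w j else 0 := rfl

theorem columnMatrix_smul (i : Fin m) (w u : Fin m → D) (j : Fin m) :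
    (columnMatrix i w • u) j = w j * u i := by
  rw [Matrix.Module.smul_apply, Finset.sum_eq_single i (by intro l _ hl; simp [columnMatrix_apply, hl])
    (by simp)]
  simp [columnMatrix_apply]

variable (A) in
/-- Right multiplication by `d` on column vectors. -/
def rightMul (d : D) : (Fin m → D) →ₗ[A] (Fin m → D) where
  toFun w i := w i * d
  map_add' w u := by ext i; exact add_mul _ _ _
  map_smul' a w := by
    ext i
    change (∑ j, (a : Matrix (Fin m) (Fin m) D) i j • w j) * d = ∑ j, _ • (w j * d)
    rw [Finset.sum_mul]
    exact Finset.sum_congr rfl fun j _ => mul_assoc _ _ _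

theorem rightMul_apply (d : D) (w : Fin m → D) (i : Fin m) : rightMul A d w i = w i * d := rfl

theorem rightMul_rightMul (d d' : D) (w : Fin m → D) :
    rightMul A d' (rightMul A d w) = rightMul A (d * d') w := by
  ext i; exact mul_assoc _ _ _

theorem map_rightMul_map_rightMul (d d' : D) (N : Submodule A (Fin m → D)) :
    (N.map (rightMul A d)).map (rightMul A d') = N.map (rightMul A (d * d')) := by
  rw [← Submodule.map_comp]
  congr 1
  ext1 w
  exact rightMul_rightMul d d' w

theorem map_rightMul_one (N : Submodule A (Fin m → D)) : N.map (rightMul A 1) = N := by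
  have : rightMul A (1 : D) = LinearMap.id := by ext w i; simp [rightMul_apply]
  rw [this, Submodule.map_id]

/-- A submodule of the column space with entries bounded below in valuation. -/
def IsBoundedSubmodule (N : Submodule A (Fin m → D)) : Prop :=
  ∃ k : ℤ, ∀ w ∈ N, ∀ i, w i ∈ ball F k

theorem IsHereditaryOrder.projective_of_isBounded (hA : IsHereditaryOrder F A) (hm : 0 < m)
    {N : Submodule A (Fin m → D)} (hN : IsBoundedSubmodule N) : Module.Projective A N := by
  obtain ⟨k, hk⟩ := hN
  obtain ⟨l, hl⟩ := hA.exists_absorbs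
  -- This scaling makes every vector of `t • N`, placed in a single column, a matrix in `A`. So `N`
  -- is isomorphic to a left ideal of `A`, which is projective.
  obtain ⟨t, ht, htk⟩ := exists_ordF_eq F (l - k)
  let i₀ : Fin m := ⟨0, hm⟩
  have hmem : ∀ w ∈ N, columnMatrix i₀ (t • w) ∈ A := fun w hw => hl _ fun i j => by
    rw [columnMatrix_apply]
    split_ifs
    · have := smul_mem_ball (mem_ballF.2 (.inr htk.ge)) (hk w hw i)
      push_cast at this
      rwa [sub_add_cancel] at this
    · exact AddSubgroup.zero_mem _
  let f : N →ₗ[A] A :=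
    { toFun w := ⟨_, hmem w w.2⟩
      map_add' w u := Subtype.ext <| by
        ext j l
        change (if l = i₀ then t • ((w : Fin m → D) j + (u : Fin m → D) j) else 0) =
          (if l = i₀ then t • (w : Fin m → D) j else 0) +
          (if l = i₀ then t • (u : Fin m → D) j else 0)
        split_ifs
        · rw [smul_add]
        · rw [add_zero]
      map_smul' a w := Subtype.ext <| by
        ext j l
        change (if l = i₀ then t • (∑ r, (a : Matrix (Fin m) (Fin m) D) j r • (w : Fin m → D) r)
          else 0) = ∑ r, _ * (if l = i₀ then t • (w : Fin m → D) r else 0)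
        split_ifs
        · rw [Finset.smul_sum]
          exact Finset.sum_congr rfl fun r _ => (mul_smul_comm _ _ _).symm
        · simp }
  have hf : Function.Injective f := fun w u h => by
    refine Subtype.ext (funext fun j => ?_)
    have h1 := congrFun (congrFun (congrArg Subtype.val h) j) i₀
    change (if i₀ = i₀ then t • (w : Fin m → D) j else 0) =
      (if i₀ = i₀ then t • (u : Fin m → D) j else 0) at h1
    rw [if_pos rfl, if_pos rfl] at h1
    exact smul_right_injective D ht h1
  have := hA.projective (LinearMap.range f)
  exact Module.Projective.of_equiv (LinearEquiv.ofInjective f hf).symm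

/-- Endomorphisms of a lattice in the column space are right multiplications. -/
theorem IsHereditaryOrder.exists_eq_rightMul (hA : IsHereditaryOrder F A)
    {L : Submodule A (Fin m → D)} (f : L →ₗ[A] (Fin m → D)) :
    ∃ d : D, ∀ w : L, f w = rightMul A d w := by
  by_cases hL : ∀ w : L, w = 0
  · exact ⟨0, fun w => by rw [hL w]; simp⟩
  push Not at hL
  obtain ⟨w₀, hw₀⟩ := hL
  have : (w₀ : Fin m → D) ≠ 0 := by simpa using hw₀
  obtain ⟨i₀, hi₀⟩ := Function.ne_iff.1 this
  have hc : (w₀ : Fin m → D) i₀ ≠ 0 := hi₀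
  set c := (w₀ : Fin m → D) i₀
  refine ⟨c⁻¹ * f w₀ i₀, fun w => ?_⟩
  -- The matrix `b` carries `w₀` to `w` and any `u` to `w * (c⁻¹ * u i₀)`. Linearity of `f` for a
  -- multiple `t • b ∈ A` then expresses `f w` through `f w₀`.
  set b := columnMatrix i₀ (rightMul A c⁻¹ w)
  obtain ⟨t, ht, htO, hb⟩ := hA.exists_smul_mem b
  have hbw : ∀ u : Fin m → D, (⟨t • b, hb⟩ : A) • u =
      (⟨t, htO⟩ : 𝒪[F]) • (fun j => (w : Fin m → D) j * (c⁻¹ * u i₀)) := fun u => by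
    change (t • b) • u = t • _
    rw [smul_assoc]
    congr 1
    ext j
    rw [columnMatrix_smul, rightMul_apply, mul_assoc]
  refine smul_right_injective (Fin m → D) ht ?_
  change (⟨t, htO⟩ : 𝒪[F]) • f w = (⟨t, htO⟩ : 𝒪[F]) • rightMul A (c⁻¹ * f w₀ i₀) w
  rw [← LinearMap.map_smul_of_tower]
  refine Eq.trans ?_ (hbw (f w₀))
  rw [← f.map_smul]
  congr 1
  refine Subtype.ext (Eq.trans ?_ (hbw w₀).symm)
  change (⟨t, htO⟩ : 𝒪[F]) • (w : Fin m → D) = _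
  congr 1
  ext j
  rw [inv_mul_cancel₀ hc, mul_one]

/-- A projective lattice in the column space which is stable under the maximal order of `D` is not
the sum of two proper submodules. -/
theorem IsHereditaryOrder.eq_top_or_eq_top (hA : IsHereditaryOrder F A)
    {L : Submodule A (Fin m → D)} (hL : Module.Projective A L)
    (hstab : ∀ d ∈ ball F (D := D) 0, ∀ w ∈ L, rightMul A d w ∈ L) (N N' : Submodule A L)
    (hNN : N ⊔ N' = ⊤) : N = ⊤ ∨ N' = ⊤ := by
  -- By projectivity the sum map splits, and the components of the section are right multiplications
  -- by `d` and `d'` with `d + d' = 1`. One of these has valuation at most `0`; since `L` is stable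
  -- under its inverse, `L` lies in the corresponding summand.
  let p : N × N' →ₗ[A] L := LinearMap.coprod N.subtype N'.subtype
  have hp : LinearMap.range p = ⊤ := by
    rw [LinearMap.range_coprod, Submodule.range_subtype, Submodule.range_subtype, hNN]
  obtain ⟨σ, hσ⟩ := p.exists_rightInverse_of_surjective hp
  have hsum : ∀ w, ((σ w).1 : L) + ((σ w).2 : L) = w := fun w => LinearMap.congr_fun hσ w
  by_cases hbot : ∀ w : L, w = 0
  · left
    rw [eq_top_iff]
    intro w _
    rw [hbot w]; exact zero_mem _
  push Not at hbot
  obtain ⟨w₀, hw₀⟩ := hbot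
  obtain ⟨d, hd⟩ := hA.exists_eq_rightMul
    (L.subtype ∘ₗ N.subtype ∘ₗ LinearMap.fst A N N' ∘ₗ σ)
  obtain ⟨d', hd'⟩ := hA.exists_eq_rightMul
    (L.subtype ∘ₗ N'.subtype ∘ₗ LinearMap.snd A N N' ∘ₗ σ)
  have hdd : d + d' = 1 := by
    have h1 : (w₀ : Fin m → D) ≠ 0 := by simpa using hw₀
    obtain ⟨i, hi⟩ := Function.ne_iff.1 h1
    have h2 := congrFun (congrArg Subtype.val (hsum w₀)) i
    have h3 := congrFun (hd w₀) i
    have h4 := congrFun (hd' w₀) i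
    simp only [LinearMap.comp_apply, rightMul_apply, Submodule.subtype_apply] at h3 h4
    change (((σ w₀).1 : L) : Fin m → D) i + (((σ w₀).2 : L) : Fin m → D) i = _ at h2
    change (((σ w₀).1 : L) : Fin m → D) i = _ at h3
    change (((σ w₀).2 : L) : Fin m → D) i = _ at h4
    rw [h3, h4, ← mul_add] at h2
    exact mul_left_cancel₀ hi (by rw [h2, mul_one])
  have key : ∀ (N : Submodule A L) (d : D) (hd0 : d ≠ 0) (hdv : valD F d ≤ 0)
      (f : L → N), (∀ w, ((f w : L) : Fin m → D) = rightMul A d w) → N = ⊤ := by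
    intro N d hd0 hdv f hf
    rw [eq_top_iff]
    intro w _
    have hmem := hstab d⁻¹ (.inr (by rw [valD_inv F hd0]; linarith)) w w.2
    have : w = f ⟨_, hmem⟩ := Subtype.ext <| by
      rw [hf, rightMul_rightMul, inv_mul_cancel₀ hd0]
      ext i; simp [rightMul_apply]
    rw [this]
    exact Submodule.coe_mem _
  by_cases h1 : d ≠ 0 ∧ valD F d ≤ 0
  · exact .inl (key N d h1.1 h1.2 (fun w => (σ w).1) hd)
  by_cases h2 : d' ≠ 0 ∧ valD F d' ≤ 0
  · exact .inr (key N' d' h2.1 h2.2 (fun w => (σ w).2) hd')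
  exfalso
  have hpos : ∀ d : D, ¬(d ≠ 0 ∧ valD F d ≤ 0) → ∃ s, 0 < s ∧ d ∈ ball F s := fun d h => by
    by_cases h0 : d = 0
    · exact ⟨1, one_pos, .inl h0⟩
    · exact ⟨valD F d, by by_contra hle; exact h ⟨h0, not_lt.1 hle⟩, .inr le_rfl⟩
  obtain ⟨s, hs, hds⟩ := hpos d h1
  obtain ⟨s', hs', hds'⟩ := hpos d' h2
  have := AddSubgroup.add_mem _ (ball_mono (min_le_left s s') hds)
    (ball_mono (min_le_right s s') hds')
  rw [hdd, mem_ball_of_ne one_ne_zero, valD_one] at this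
  exact absurd this (not_le.2 (lt_min hs hs'))

end Bounds

end InnerFormSL

/-! ### The lattice chain of a hereditary order -/

namespace InnerFormSL

open Matrix.Module

theorem finite_quotient_of_map_mem {R B : Type*} [CommRing R] [Ring B] [Algebra R B]
    [Module.Finite R B] (I : Ideal R) [Finite (R ⧸ I)] (J : Ideal B)
    (h : ∀ t ∈ I, algebraMap R B t ∈ J) (hJ : J.IsTwoSided := by infer_instance) :
    Finite (B ⧸ J) := by
  have hfin : Module.Finite R (B ⧸ J) := inferInstance
  have htors : Module.IsTorsionBySet R (B ⧸ J) (I : Set R) := by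
    rintro a ⟨t, ht⟩
    obtain ⟨a, rfl⟩ := Submodule.mkQ_surjective _ a
    change t • (Submodule.mkQ J).restrictScalars R a = 0
    rw [← map_smul]
    refine (Submodule.Quotient.mk_eq_zero _).2 ?_
    rw [Algebra.smul_def]
    exact J.mul_mem_right _ (h t ht)
  let _ := htors.module
  have : IsScalarTower R (R ⧸ I) (B ⧸ J) := htors.isScalarTower
  have : Module.Finite (R ⧸ I) (B ⧸ J) := Module.Finite.of_restrictScalars_finite R _ _
  exact Module.finite_of_finite (R ⧸ I)

theorem pow_succ_smul {R M : Type*} [Ring R] [AddCommGroup M] [Module R M] (J : Ideal R) (k : ℕ)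
    (N : Submodule R M) : J ^ (k + 1) • N = J • J ^ k • N := by
  rcases k with _ | k
  · rw [zero_add, Submodule.pow_one, Submodule.pow_zero, Ideal.one_eq_top, Submodule.top_smul]
  · rw [Submodule.pow_succ' J (Nat.succ_ne_zero k), Submodule.mul_smul]

section Chain

variable {F : Type*} [Field F] [ValuativeRel F] [TopologicalSpace F]
  [IsNonarchimedeanLocalField F]
variable {D : Type*} [DivisionRing D] [Algebra F D] [FiniteDimensional F D] {m : ℕ}
variable {A : Subalgebra 𝒪[F] (Matrix (Fin m) (Fin m) D)} {e : ℕ} {ϖ : F}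

theorem ne_zero_of_ordF_eq_one (hϖ : ordF F ϖ = 1) : ϖ ≠ 0 := by
  rintro rfl
  simp [ordF] at hϖ

theorem mem_map_maximalIdeal_iff (hϖ : ordF F ϖ = 1) {a : A} :
    a ∈ Ideal.map (algebraMap 𝒪[F] A) 𝓂[F] ↔
      ∃ b : A, (a : Matrix (Fin m) (Fin m) D) = ϖ • (b : Matrix (Fin m) (Fin m) D) := by
  have hϖ0 := ne_zero_of_ordF_eq_one hϖ
  have hϖO : ϖ ∈ 𝒪[F] := mem_integer_iff.2 (.inr (by omega))
  constructor
  · intro ha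
    induction ha using Submodule.span_induction with
    | mem a h =>
      obtain ⟨t, ht, rfl⟩ := h
      have ht1 := mem_maximalIdeal_integer_iff.1 ht
      have htO : ϖ⁻¹ * t ∈ 𝒪[F] := by
        rw [← mem_ballF_zero]
        have := mul_mem_ballF (mem_ballF.2 (.inr (ordF_inv ϖ).ge)) ht1
        rwa [hϖ, neg_add_cancel] at this
      refine ⟨algebraMap 𝒪[F] A ⟨_, htO⟩, ?_⟩
      change algebraMap 𝒪[F] (Matrix (Fin m) (Fin m) D) t =
        ϖ • algebraMap 𝒪[F] (Matrix (Fin m) (Fin m) D) ⟨_, htO⟩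
      rw [Algebra.algebraMap_eq_smul_one, Algebra.algebraMap_eq_smul_one, integer_smul_def,
        integer_smul_def, smul_smul, mul_inv_cancel_left₀ hϖ0]
    | zero => exact ⟨0, by simp⟩
    | add a b _ _ iha ihb =>
      obtain ⟨a', ha'⟩ := iha
      obtain ⟨b', hb'⟩ := ihb
      exact ⟨a' + b', by rw [Subalgebra.coe_add, ha', hb', Subalgebra.coe_add, smul_add]⟩
    | smul c a _ ih =>
      obtain ⟨a', ha'⟩ := ih
      exact ⟨c * a', by
        rw [smul_eq_mul, Subalgebra.coe_mul, ha', Subalgebra.coe_mul, mul_smul_comm]⟩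
  · rintro ⟨b, hb⟩
    have : a = b * algebraMap 𝒪[F] A ⟨ϖ, hϖO⟩ := Subtype.ext <| by
      rw [hb]
      change _ = (b : Matrix (Fin m) (Fin m) D) *
        algebraMap 𝒪[F] (Matrix (Fin m) (Fin m) D) ⟨ϖ, hϖO⟩
      rw [Algebra.algebraMap_eq_smul_one, mul_smul_comm, mul_one, integer_smul_def]
    rw [this]
    exact Ideal.mul_mem_left _ _ (Ideal.mem_map_of_mem _ (mem_maximalIdeal_integer_iff.2
      (mem_ballF.2 (.inr hϖ.ge))))

theorem rightMul_algebraMap (c : F) (w : Fin m → D) :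
    rightMul A (algebraMap F D c) w = c • w := by
  ext i
  rw [rightMul_apply, Pi.smul_apply, Algebra.smul_def, Algebra.commutes]

theorem IsRamificationIndex.jacobson_pow_smul (he : IsRamificationIndex F A e)
    (hϖ : ordF F ϖ = 1) (N : Submodule A (Fin m → D)) :
    Ring.jacobson A ^ e • N = N.map (rightMul A (algebraMap F D ϖ)) := by
  rw [← he]
  apply le_antisymm
  · rw [Submodule.smul_le]
    intro a ha w hw
    obtain ⟨b, hb⟩ := (mem_map_maximalIdeal_iff hϖ).1 ha
    refine ⟨b • w, N.smul_mem b hw, ?_⟩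
    rw [rightMul_algebraMap]
    change ϖ • ((b : Matrix (Fin m) (Fin m) D) • w) = (a : Matrix (Fin m) (Fin m) D) • w
    rw [hb, smul_assoc]
  · rintro _ ⟨w, hw, rfl⟩
    rw [rightMul_algebraMap]
    have hϖO : ϖ ∈ 𝒪[F] := mem_integer_iff.2 (.inr (by omega))
    have h1 : algebraMap 𝒪[F] A ⟨ϖ, hϖO⟩ ∈ Ideal.map (algebraMap 𝒪[F] A) 𝓂[F] :=
      Ideal.mem_map_of_mem _ (mem_maximalIdeal_integer_iff.2 (mem_ballF.2 (.inr hϖ.ge)))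
    have h2 := Submodule.smul_mem_smul h1 hw
    rw [algebraMap_smul] at h2
    exact h2

/-- For `e = 0` the ideal `𝔭_F A` would be all of `A`, so `A` would contain every `ϖ⁻¹ ^ n`, against
boundedness. -/
theorem IsRamificationIndex.pos (he : IsRamificationIndex F A e) (hA : IsHereditaryOrder F A)
    (hm : 0 < m) : 0 < e := by
  by_contra h
  obtain rfl : e = 0 := by omega
  rw [IsRamificationIndex, Submodule.pow_zero, Ideal.one_eq_top] at he
  obtain ⟨ϖ, hϖ0, hϖ⟩ := exists_ordF_eq F 1
  obtain ⟨K, hK⟩ := hA.exists_bound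
  have h1 : ∀ n : ℕ, (ϖ⁻¹ ^ n) • (1 : Matrix (Fin m) (Fin m) D) ∈ A := fun n => by
    induction n with
    | zero => rw [pow_zero, one_smul]; exact one_mem A
    | succ n ih =>
      obtain ⟨b, hb⟩ := (mem_map_maximalIdeal_iff hϖ (a := (⟨_, ih⟩ : A))).1
        (he ▸ Submodule.mem_top)
      have : (ϖ⁻¹ ^ (n + 1)) • (1 : Matrix (Fin m) (Fin m) D) = b := by
        simp only at hb
        rw [pow_succ', mul_smul, hb, smul_smul, inv_mul_cancel₀ hϖ0, one_smul]
      rw [this]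
      exact b.2
  have h2 := hK _ (h1 (K + 1)) ⟨0, hm⟩ ⟨0, hm⟩
  have h3 : ϖ⁻¹ ^ (K + 1) ≠ 0 := pow_ne_zero _ (inv_ne_zero hϖ0)
  rw [Matrix.smul_apply, Matrix.one_apply_eq, mem_ball_of_ne (smul_ne_zero h3 one_ne_zero),
    valD_smul h3 one_ne_zero, valD_one, ordF_pow, ordF_inv, hϖ] at h2
  push_cast at h2
  linarith

/-- As `e > 0`, the radical contains `𝔭_F A`, so the quotient is finite over the finite residue
field of `F`. It is therefore an artinian ring with zero radical. -/
theorem IsHereditaryOrder.isSemisimpleRing_quotient (hA : IsHereditaryOrder F A) (hm : 0 < m)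
    (he : IsRamificationIndex F A e) : IsSemisimpleRing (A ⧸ Ring.jacobson A) := by
  have hfin : Module.Finite 𝒪[F] A := ⟨(Submodule.fg_top _).2 hA.fg⟩
  have : Finite (𝒪[F] ⧸ 𝓂[F]) := inferInstanceAs (Finite 𝓀[F])
  have : Finite (A ⧸ Ring.jacobson A) := finite_quotient_of_map_mem 𝓂[F] _ fun t ht =>
    Ideal.pow_le_self (he.pos hA hm).ne' (he ▸ Ideal.mem_map_of_mem _ ht)
  exact IsArtinianRing.isSemisimpleRing_iff_jacobson.2 (Ring.jacobson_quotient_jacobson A)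

variable (A) in
/-- The lattice `A 𝔬_D^m`. -/
def baseLattice : Submodule A (Fin m → D) := Submodule.span A {w | ∀ i, w i ∈ ball F 0}

theorem map_rightMul_baseLattice_le {d : D} (hd : d ∈ ball F (D := D) 0) :
    (baseLattice A).map (rightMul A d) ≤ baseLattice A := by
  rw [baseLattice, Submodule.map_span, Submodule.span_le]
  rintro _ ⟨w, hw, rfl⟩
  exact Submodule.subset_span fun i => by
    rw [rightMul_apply]; simpa using mul_mem_ball (hw i) hd

theorem mem_ball_of_mem_baseLattice {K : ℕ} (hK : ∀ a ∈ A, ∀ i j, a i j ∈ ball F (-K : ℝ))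
    {w : Fin m → D} (hw : w ∈ baseLattice A) (i : Fin m) : w i ∈ ball F (-K : ℝ) := by
  suffices H : ∀ a : A, ∀ i, (a • w) i ∈ ball F (-K : ℝ) by simpa using H 1 i
  induction hw using Submodule.span_induction with
  | mem w h =>
    intro a i
    refine AddSubgroup.sum_mem _ fun j _ => ?_
    simpa using mul_mem_ball (hK a a.2 i j) (h j)
  | zero => intro a i; rw [smul_zero]; exact AddSubgroup.zero_mem _
  | add w u _ _ hw hu =>
    intro a i
    rw [smul_add]
    exact AddSubgroup.add_mem _ (hw a i) (hu a i)
  | smul b w _ hw => intro a i; rw [smul_smul]; exact hw _ i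

variable (A e ϖ) in
/-- The chain of all lattices of `A` in the column space: `J • chain n = chain (n + 1)` and
`chain (n + e) = ϖ chain n`. -/
def chain (n : ℤ) : Submodule A (Fin m → D) :=
  (Ring.jacobson A ^ (n % e).toNat • baseLattice A).map
    (rightMul A (algebraMap F D ϖ ^ (n / e)))

theorem chain_add_mul (hpos : 0 < e) (hϖ : ordF F ϖ = 1) (n k : ℤ) :
    chain A e ϖ (n + k * e) = (chain A e ϖ n).map (rightMul A (algebraMap F D ϖ ^ k)) := by
  have hne : (e : ℤ) ≠ 0 := by omega
  have h0 : algebraMap F D ϖ ≠ 0 := by simpa using ne_zero_of_ordF_eq_one hϖ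
  rw [chain, chain, map_rightMul_map_rightMul, ← zpow_add₀ h0, Int.add_mul_emod_self_right,
    Int.add_mul_ediv_right _ _ hne]

theorem chain_zero : chain A e ϖ 0 = baseLattice A := by
  simp only [chain, Int.zero_emod, Int.zero_ediv, Int.toNat_zero, zpow_zero, map_rightMul_one]
  rw [Submodule.pow_zero, Ideal.one_eq_top, Submodule.top_smul]

theorem jacobson_smul_chain (he : IsRamificationIndex F A e) (hpos : 0 < e)
    (hϖ : ordF F ϖ = 1) (n : ℤ) : Ring.jacobson A • chain A e ϖ n = chain A e ϖ (n + 1) := by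
  have hne : (0 : ℤ) < e := by omega
  have h0 : algebraMap F D ϖ ≠ 0 := by simpa using ne_zero_of_ordF_eq_one hϖ
  have hlt := Int.emod_lt_of_pos n hne
  have hge := Int.emod_nonneg n hne.ne'
  have hdiv := Int.emod_add_mul_ediv n e
  have hsucc : Ring.jacobson A • chain A e ϖ n =
      (Ring.jacobson A ^ ((n % e).toNat + 1) • baseLattice A).map
        (rightMul A (algebraMap F D ϖ ^ (n / e))) := by
    rw [chain, ← Submodule.map_smul'', pow_succ_smul]
  rw [hsucc]
  by_cases h : n % e + 1 < e
  · have h1 : (n + 1) % e = n % e + 1 := by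
      have : n + 1 = (n % e + 1) + (n / e) * e := by linarith
      rw [this, Int.add_mul_emod_self_right, Int.emod_eq_of_lt (by omega) h]
    have h2 : (n + 1) / e = n / e := by
      have : n + 1 = (n % e + 1) + (n / e) * e := by linarith
      conv_lhs => rw [this]
      rw [Int.add_mul_ediv_right _ _ hne.ne', Int.ediv_eq_zero_of_lt (by omega) h, zero_add]
    rw [chain, h1, h2]
    congr 3
    omega
  -- Wrap-around at the end of a period: `J ^ e` acts on lattices as multiplication by `ϖ`.
  · have h3 : n + 1 = 0 + (n / e + 1) * e := by linarith
    have h4 : (n % e).toNat + 1 = e := by omega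
    rw [h3, chain_add_mul hpos hϖ, chain_zero, h4, he.jacobson_pow_smul hϖ,
      map_rightMul_map_rightMul, zpow_add₀ h0, zpow_one,
      ← zpow_one_add₀ h0, ← zpow_add_one₀ h0, add_comm]

theorem jacobson_pow_smul_chain (he : IsRamificationIndex F A e) (hpos : 0 < e)
    (hϖ : ordF F ϖ = 1) (n : ℤ) (k : ℕ) :
    Ring.jacobson A ^ k • chain A e ϖ n = chain A e ϖ (n + k) := by
  induction k generalizing n with
  | zero => rw [Submodule.pow_zero, Ideal.one_eq_top, Submodule.top_smul]; simp
  | succ k ih =>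
    rw [Submodule.pow_succ, Submodule.mul_smul, jacobson_smul_chain he hpos hϖ, ih]
    congr 1
    push_cast
    ring

theorem chain_antitone (he : IsRamificationIndex F A e) (hpos : 0 < e)
    (hϖ : ordF F ϖ = 1) : Antitone (chain A e ϖ) := fun a b h => by
  obtain ⟨k, rfl⟩ := Int.le.dest h
  rw [← jacobson_pow_smul_chain he hpos hϖ]
  exact Submodule.smul_le_right

theorem map_rightMul_chain_le {d : D} (hd : d ∈ ball F (D := D) 0) (n : ℤ) :
    (chain A e ϖ n).map (rightMul A d) ≤ chain A e ϖ n := by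
  rw [chain, map_rightMul_map_rightMul]
  have hc : algebraMap F D ϖ ^ (n / e) * d = d * algebraMap F D ϖ ^ (n / e) := by
    rw [← map_zpow₀]; exact Algebra.commutes _ _
  rw [hc, ← map_rightMul_map_rightMul, Submodule.map_smul'']
  exact Submodule.map_mono (Submodule.smul_mono le_rfl (map_rightMul_baseLattice_le hd))

theorem valD_algebraMap_zpow (hϖ : ordF F ϖ = 1) (z : ℤ) :
    valD F (algebraMap F D ϖ ^ z) = z := by
  rw [← map_zpow₀, valD_algebraMap, ordF_zpow, hϖ, mul_one]

theorem mem_ball_of_mem_chain (hpos : 0 < e) (hϖ : ordF F ϖ = 1) {K : ℕ}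
    (hK : ∀ a ∈ A, ∀ i j, a i j ∈ ball F (-K : ℝ)) {n : ℤ} {w : Fin m → D}
    (hw : w ∈ chain A e ϖ n) (i : Fin m) : w i ∈ ball F ((n : ℝ) / e - (K + 1)) := by
  obtain ⟨u, hu, rfl⟩ := hw
  have h1 := mem_ball_of_mem_baseLattice hK (Submodule.smul_le_right hu) i
  rw [rightMul_apply]
  refine ball_mono ?_ (mul_mem_ball h1 (.inr (valD_algebraMap_zpow hϖ (n / e)).ge))
  have he' : (0 : ℝ) < e := by exact_mod_cast hpos
  have h2 : n < e * (n / e + 1) := by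
    have := Int.emod_lt_of_pos n (by omega : (0 : ℤ) < e)
    have := Int.emod_add_mul_ediv n e
    linarith
  have h3 : (n : ℝ) / e < ((n / e : ℤ) : ℝ) + 1 := by
    rw [div_lt_iff₀ he']
    have : (n : ℝ) < ((e * (n / e + 1) : ℤ) : ℝ) := by exact_mod_cast h2
    push_cast at this ⊢
    linarith
  linarith

theorem chain_isBounded (hA : IsHereditaryOrder F A) (hpos : 0 < e) (hϖ : ordF F ϖ = 1)
    (n : ℤ) : IsBoundedSubmodule (chain A e ϖ n) := by
  obtain ⟨K, hK⟩ := hA.exists_bound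
  refine ⟨⌊(n : ℝ) / e - (K + 1)⌋, fun w hw i => ball_mono (Int.floor_le _)
    (mem_ball_of_mem_chain hpos hϖ hK hw i)⟩

theorem mem_chain_of_forall_mem_ball (hpos : 0 < e) (hϖ : ordF F ϖ = 1) {k : ℤ} {w : Fin m → D}
    (hw : ∀ i, w i ∈ ball F (k : ℝ)) : w ∈ chain A e ϖ (k * e) := by
  have h0 : algebraMap F D ϖ ≠ 0 := by simpa using ne_zero_of_ordF_eq_one hϖ
  have := chain_add_mul (A := A) hpos hϖ 0 k
  rw [zero_add] at this
  rw [this, chain_zero]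
  refine ⟨rightMul A (algebraMap F D ϖ ^ (-k)) w, Submodule.subset_span fun i => ?_, ?_⟩
  · rw [rightMul_apply]
    have := mul_mem_ball (hw i) (.inr (valD_algebraMap_zpow (D := D) hϖ (-k)).ge)
    push_cast at this
    rwa [add_neg_cancel] at this
  · rw [rightMul_rightMul, ← zpow_add₀ h0, neg_add_cancel, zpow_zero]
    ext i
    simp [rightMul_apply]

theorem exists_mem_chain (hpos : 0 < e) (hϖ : ordF F ϖ = 1) (w : Fin m → D) :
    ∃ n, w ∈ chain A e ϖ n := by
  obtain ⟨k, hk⟩ := exists_forall_mem_ball (F := F) w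
  exact ⟨_, mem_chain_of_forall_mem_ball hpos hϖ hk⟩

theorem exists_notMem_chain (hA : IsHereditaryOrder F A) (hpos : 0 < e)
    (hϖ : ordF F ϖ = 1) {w : Fin m → D} (hw : w ≠ 0) : ∃ n, w ∉ chain A e ϖ n := by
  obtain ⟨K, hK⟩ := hA.exists_bound
  obtain ⟨i, hi⟩ := Function.ne_iff.1 hw
  refine ⟨(⌈valD F (w i)⌉ + K + 2) * e, fun h => ?_⟩
  have h1 := mem_ball_of_mem_chain hpos hϖ hK h i
  have he' : (e : ℝ) ≠ 0 := by exact_mod_cast hpos.ne'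
  rw [mem_ball_of_ne hi] at h1
  push_cast at h1
  rw [mul_div_cancel_right₀ _ he'] at h1
  have := Int.le_ceil (valD F (w i))
  linarith

theorem chain_projective (hA : IsHereditaryOrder F A) (hm : 0 < m) (hpos : 0 < e)
    (hϖ : ordF F ϖ = 1) (n : ℤ) : Module.Projective A (chain A e ϖ n) :=
  hA.projective_of_isBounded hm (chain_isBounded hA hpos hϖ n)

/-- Members of the chain are projective and stable under the maximal order of `D`, hence not sums of
two proper submodules. As `A / J` is semisimple, `J` times such a member contains all its proper
submodules. -/
theorem le_chain_succ (hA : IsHereditaryOrder F A) (hm : 0 < m)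
    (he : IsRamificationIndex F A e) (hpos : 0 < e) (hϖ : ordF F ϖ = 1) {n : ℤ}
    {N : Submodule A (Fin m → D)} (hN : N ≤ chain A e ϖ n) (hne : N ≠ chain A e ϖ n) :
    N ≤ chain A e ϖ (n + 1) := by
  have := hA.isSemisimpleRing_quotient hm he
  have h1 : N.comap (chain A e ϖ n).subtype ≠ ⊤ := fun h => hne <| le_antisymm hN fun w hw => by
    have : (⟨w, hw⟩ : chain A e ϖ n) ∈ N.comap (chain A e ϖ n).subtype := by
      rw [h]; exact Submodule.mem_top
    exact this
  have hM := hA.eq_top_or_eq_top (chain_projective hA hm hpos hϖ n)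
    fun d hd w hw => map_rightMul_chain_le hd n ⟨w, hw, rfl⟩
  have h2 := le_jacobson_smul_top_of_ne_top (R := A) (M := chain A e ϖ n) hM h1
  intro w hw
  have h3 := h2 (show (⟨w, hN hw⟩ : chain A e ϖ n) ∈ _ from hw)
  rw [Submodule.mem_smul_top_iff, jacobson_smul_chain he hpos hϖ] at h3
  exact h3

/-- Every lattice of a hereditary order in the column space is a member of the chain. -/
theorem exists_eq_chain (hA : IsHereditaryOrder F A) (hm : 0 < m)
    (he : IsRamificationIndex F A e) (hpos : 0 < e) (hϖ : ordF F ϖ = 1)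
    {N : Submodule A (Fin m → D)} (hN : IsBoundedSubmodule N) (hne : N ≠ ⊥) :
    ∃ n, N = chain A e ϖ n := by
  obtain ⟨k, hk⟩ := hN
  obtain ⟨w, hw, hw0⟩ := Submodule.exists_mem_ne_zero_of_ne_bot hne
  obtain ⟨b, hb⟩ := exists_notMem_chain hA hpos hϖ hw0
  -- The deepest member containing `N`: one exists because `N` is bounded and contains a nonzero
  -- vector, which must leave the chain. If `N` were proper in it, `le_chain_succ` would go one step
  -- deeper.
  obtain ⟨n, hn, hmax⟩ := Int.exists_greatest_of_bdd (P := fun n => N ≤ chain A e ϖ n)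
    ⟨b, fun n hn => by
      by_contra hlt
      exact hb (chain_antitone he hpos hϖ (by omega) (hn hw))⟩
    ⟨k * e, fun u hu => mem_chain_of_forall_mem_ball hpos hϖ (hk u hu)⟩
  refine ⟨n, ?_⟩
  by_contra h
  have := hmax _ (le_chain_succ hA hm he hpos hϖ hn h)
  omega

theorem chain_ne_bot (hm : 0 < m) (he : IsRamificationIndex F A e) (hpos : 0 < e)
    (hϖ : ordF F ϖ = 1) (n : ℤ) : chain A e ϖ n ≠ ⊥ := by
  intro h
  have h0 : algebraMap F D ϖ ≠ 0 := by simpa using ne_zero_of_ordF_eq_one hϖ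
  have h1 : (fun _ => algebraMap F D ϖ ^ |n| : Fin m → D) ∈ chain A e ϖ (|n| * e) :=
    mem_chain_of_forall_mem_ball hpos hϖ fun _ => .inr (valD_algebraMap_zpow hϖ _).ge
  have hn : n ≤ |n| * e := (le_abs_self n).trans
    (le_mul_of_one_le_right (abs_nonneg n) (by exact_mod_cast hpos))
  have h2 := chain_antitone he hpos hϖ hn h1
  rw [h, Submodule.mem_bot] at h2
  exact zpow_ne_zero _ h0 (congrFun h2 ⟨0, hm⟩)

end Chain

end InnerFormSL

namespace InnerFormSL

open Matrix.Module

/-! ### Shifts of the chain by scalars and by matrices -/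

section ChainShift

variable {F : Type*} [Field F] [ValuativeRel F] [TopologicalSpace F]
  [IsNonarchimedeanLocalField F]
variable {D : Type*} [DivisionRing D] [Algebra F D] [FiniteDimensional F D] {m : ℕ}
variable {A : Subalgebra 𝒪[F] (Matrix (Fin m) (Fin m) D)} {e : ℕ} {ϖ : F}

/-- If two consecutive members coincided, `J` would fix that member and the chain would be constant
from there on, although no nonzero vector lies in all members. -/
theorem chain_strictAnti (hA : IsHereditaryOrder F A) (hm : 0 < m)
    (he : IsRamificationIndex F A e) (hpos : 0 < e) (hϖ : ordF F ϖ = 1) :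
    StrictAnti (chain A e ϖ) := by
  have hanti := chain_antitone he hpos hϖ
  refine strictAnti_int_of_succ_lt fun n => lt_of_le_of_ne (hanti (by omega)) fun h => ?_
  have hJ : Ring.jacobson A • chain A e ϖ n = chain A e ϖ n := by
    rw [jacobson_smul_chain he hpos hϖ, h]
  have hk : ∀ k : ℕ, chain A e ϖ (n + k) = chain A e ϖ n := fun k => by
    induction k with
    | zero => simp
    | succ k ih => rw [Nat.cast_succ, ← add_assoc, ← jacobson_smul_chain he hpos hϖ, ih, hJ]
  obtain ⟨w, hw, hw0⟩ := Submodule.exists_mem_ne_zero_of_ne_bot (chain_ne_bot hm he hpos hϖ n)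
  obtain ⟨l, hl⟩ := exists_notMem_chain hA hpos hϖ hw0
  refine hl (hanti (show l ≤ n + (l - n).toNat by omega) ?_)
  rwa [hk]

theorem rightMul_injective {d : D} (hd : d ≠ 0) : Function.Injective (rightMul A d) :=
  fun w u h => by
    ext i
    have := congrFun h i
    rw [rightMul_apply, rightMul_apply] at this
    exact mul_right_cancel₀ hd this

theorem exists_map_rightMul_chain (hA : IsHereditaryOrder F A) (hm : 0 < m)
    (he : IsRamificationIndex F A e) (hpos : 0 < e) (hϖ : ordF F ϖ = 1) {d : D} (hd : d ≠ 0) :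
    ∃ c : ℤ, ∀ n, (chain A e ϖ n).map (rightMul A d) = chain A e ϖ (n + c) := by
  have hb : IsBoundedSubmodule ((chain A e ϖ 0).map (rightMul A d)) := by
    obtain ⟨k, hk⟩ := chain_isBounded hA hpos hϖ 0
    refine ⟨⌊k + valD F d⌋, ?_⟩
    rintro _ ⟨w, hw, rfl⟩ i
    exact ball_mono (Int.floor_le _) (mul_mem_ball (hk w hw i) (.inr le_rfl))
  have hne : (chain A e ϖ 0).map (rightMul A d) ≠ ⊥ := by
    obtain ⟨w, hw, hw0⟩ := Submodule.exists_mem_ne_zero_of_ne_bot (chain_ne_bot hm he hpos hϖ 0)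
    exact (Submodule.ne_bot_iff _).2 ⟨_, ⟨w, hw, rfl⟩,
      (map_ne_zero_iff _ (rightMul_injective hd)).2 hw0⟩
  obtain ⟨c, hc⟩ := exists_eq_chain hA hm he hpos hϖ hb hne
  rw [chain_zero] at hc
  refine ⟨c, fun n => ?_⟩
  have hcomm : algebraMap F D ϖ ^ (n / e) * d = d * algebraMap F D ϖ ^ (n / e) := by
    rw [← map_zpow₀]; exact Algebra.commutes _ _
  rw [chain, map_rightMul_map_rightMul, hcomm, ← map_rightMul_map_rightMul, Submodule.map_smul'',
    hc, jacobson_pow_smul_chain he hpos hϖ, ← chain_add_mul hpos hϖ]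
  congr 1
  have h1 := Int.emod_nonneg n (by omega : (e : ℤ) ≠ 0)
  have h2 := Int.emod_add_mul_ediv n e
  rw [Int.toNat_of_nonneg h1]
  linarith

theorem map_rightMul_chain_pow {d : D} {c : ℤ}
    (h : ∀ n, (chain A e ϖ n).map (rightMul A d) = chain A e ϖ (n + c)) (k : ℕ) (n : ℤ) :
    (chain A e ϖ n).map (rightMul A (d ^ k)) = chain A e ϖ (n + k * c) := by
  induction k with
  | zero => rw [pow_zero, map_rightMul_one]; simp
  | succ k ih =>
    rw [pow_succ, ← map_rightMul_map_rightMul, ih, h]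
    congr 1
    push_cast
    ring

/-- Right multiplication by `d` shifts the chain by `e * v(d)`. -/
theorem map_rightMul_chain (hA : IsHereditaryOrder F A) (hm : 0 < m)
    (he : IsRamificationIndex F A e) (hpos : 0 < e) (hϖ : ordF F ϖ = 1) {d : D} (hd : d ≠ 0) :
    ∃ c : ℤ, (c : ℝ) = e * valD F d ∧
      ∀ n, (chain A e ϖ n).map (rightMul A d) = chain A e ϖ (n + c) := by
  have hanti := chain_strictAnti hA hm he hpos hϖ
  obtain ⟨c, hc⟩ := exists_map_rightMul_chain hA hm he hpos hϖ hd
  refine ⟨c, ?_, hc⟩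
  have h0 : algebraMap F D ϖ ≠ 0 := by simpa using ne_zero_of_ordF_eq_one hϖ
  obtain ⟨q, hq, hv, -⟩ := exists_valueGroup F D
  obtain ⟨k, hk⟩ := hv d hd
  have hq' : (q : ℝ) ≠ 0 := by exact_mod_cast hq.ne'
  have key : ∀ u : D, u ≠ 0 → valD F u = 0 → ∀ b : ℤ,
      (∀ n, (chain A e ϖ n).map (rightMul A u) = chain A e ϖ (n + b)) → 0 ≤ b := by
    intro u hu huv b hb
    have h1 := map_rightMul_chain_le (A := A) (e := e) (ϖ := ϖ) (.inr huv.ge) 0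
    rw [hb, hanti.le_iff_ge, zero_add] at h1
    exact h1
  have h1 : ∀ n, (chain A e ϖ n).map (rightMul A (d ^ q * algebraMap F D ϖ ^ (-k))) =
      chain A e ϖ (n + (q * c - k * e)) := fun n => by
    rw [← map_rightMul_map_rightMul, map_rightMul_chain_pow hc, ← chain_add_mul hpos hϖ]
    congr 1
    ring
  -- As `v(d) = k / q`, this is a unit of the maximal order. Both `u` and `u⁻¹` shift the chain by a
  -- nonnegative amount, so the shift `q * c - k * e` vanishes.
  set u := d ^ q * algebraMap F D ϖ ^ (-k)
  have hu0 : u ≠ 0 := mul_ne_zero (pow_ne_zero _ hd) (zpow_ne_zero _ h0)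
  have huv : valD F u = 0 := by
    rw [valD_mul F (pow_ne_zero _ hd) (zpow_ne_zero _ h0), valD_pow F hd,
      valD_algebraMap_zpow hϖ, hk]
    push_cast
    field_simp
    ring
  have h2 := key u hu0 huv _ h1
  have h3 : ∀ n, (chain A e ϖ n).map (rightMul A u⁻¹) =
      chain A e ϖ (n + -(q * c - k * e)) := fun n => by
    conv_lhs => rw [show n = (n + -(q * c - k * e)) + (q * c - k * e) by ring, ← h1]
    rw [map_rightMul_map_rightMul, mul_inv_cancel₀ hu0, map_rightMul_one]
  have h4 := key _ (inv_ne_zero hu0) (by rw [valD_inv F hu0, huv, neg_zero]) _ h3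
  have h5 : (q : ℤ) * c = k * e := by omega
  have h6 : (q : ℝ) * c = k * e := by exact_mod_cast h5
  rw [hk]
  field_simp
  linarith

theorem exists_mem_jacobson_pow_of_mem_smul {R W : Type*} [Ring R] [AddCommGroup W] [Module R W]
    {M : Submodule R R} {N : Submodule R W} (σ : N →ₗ[R] M) {k : ℕ} {x : W}
    (hx : x ∈ Ring.jacobson R ^ k • N) :
    ∃ hx : x ∈ N, (σ ⟨x, hx⟩ : R) ∈ Ring.jacobson R ^ k := by
  induction hx using Submodule.smul_induction_on' with
  | smul r hr y hy =>
    refine ⟨N.smul_mem r hy, ?_⟩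
    have : (⟨r • y, N.smul_mem r hy⟩ : N) = r • ⟨y, hy⟩ := rfl
    rw [this, map_smul]
    exact Ideal.mul_mem_right _ _ hr
  | add x _ y _ hx hy =>
    obtain ⟨hxN, hx⟩ := hx
    obtain ⟨hyN, hy⟩ := hy
    refine ⟨N.add_mem hxN hyN, ?_⟩
    have : (⟨x + y, N.add_mem hxN hyN⟩ : N) = ⟨x, hxN⟩ + ⟨y, hyN⟩ := rfl
    rw [this, map_add]
    exact add_mem hx hy

/-- Since `b` need not lie in `A`, the `A`-linearity of `σ` applies only to a multiple `t • b ∈ A`;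
the scalar `t` is cancelled afterwards. -/
theorem IsHereditaryOrder.exists_eq_mul_of_smul_mem (hA : IsHereditaryOrder F A)
    (M : Submodule A A) (N : Submodule A (Fin m → D)) (σ : N →ₗ[A] M) {k : ℕ}
    {b : Matrix (Fin m) (Fin m) D} (w : N)
    (h : b • (w : Fin m → D) ∈ Ring.jacobson A ^ k • N) :
    ∃ a : A, a ∈ Ring.jacobson A ^ k ∧ (a : Matrix (Fin m) (Fin m) D) =
      b * ((σ w : A) : Matrix (Fin m) (Fin m) D) := by
  obtain ⟨hx, hx'⟩ := exists_mem_jacobson_pow_of_mem_smul σ h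
  refine ⟨_, hx', ?_⟩
  obtain ⟨t, ht, htO, htb⟩ := hA.exists_smul_mem b
  refine smul_right_injective (Matrix (Fin m) (Fin m) D) ht ?_
  have h4 : (⟨t, htO⟩ : 𝒪[F]) • (⟨b • (w : Fin m → D), hx⟩ : N) = (⟨t • b, htb⟩ : A) • w := by
    refine Subtype.ext ?_
    change t • b • (w : Fin m → D) = (t • b) • (w : Fin m → D)
    rw [smul_assoc]
  have h5 := congrArg σ h4
  rw [LinearMap.map_smul_of_tower, map_smul] at h5
  have h6 := congrArg (fun x : M => ((x : A) : Matrix (Fin m) (Fin m) D)) h5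
  change t • ((σ ⟨b • (w : Fin m → D), hx⟩ : A) : Matrix (Fin m) (Fin m) D) =
    (t • b) * ((σ w : A) : Matrix (Fin m) (Fin m) D) at h6
  rw [smul_mul_assoc] at h6
  exact h6

/-- A matrix shifting the chain by `k` lies in the `k`-th power of the Jacobson radical. -/
theorem exists_mem_jacobson_pow_of_smul_mem_chain (hA : IsHereditaryOrder F A) (hm : 0 < m)
    (he : IsRamificationIndex F A e) (hpos : 0 < e) (hϖ : ordF F ϖ = 1) {k : ℕ}
    {b : Matrix (Fin m) (Fin m) D}
    (hb : ∀ n, ∀ w ∈ chain A e ϖ n, b • w ∈ chain A e ϖ (n + k)) :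
    ∃ a : A, a ∈ Ring.jacobson A ^ k ∧ (a : Matrix (Fin m) (Fin m) D) = b := by
  -- Induction on columns, to be applied to `a = 1`. The module `N` of possible last columns is zero
  -- or a chain member, and in the latter case `b` maps it into `J ^ k • N`. A section `σ` of the
  -- column map lifts this to `b * σ w ∈ J ^ k`, and `a - σ w` has one column fewer.
  suffices H : ∀ s ≤ m, ∀ a : A, (∀ i (j : Fin m), s ≤ (j : ℕ) → (a : Matrix (Fin m) (Fin m) D) i j = 0) →
      ∃ a' : A, a' ∈ Ring.jacobson A ^ k ∧
        (a' : Matrix (Fin m) (Fin m) D) = b * (a : Matrix (Fin m) (Fin m) D) by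
    obtain ⟨a, ha, h⟩ := H m le_rfl 1 fun i j hj => absurd hj (by omega)
    exact ⟨a, ha, by simpa using h⟩
  intro s
  induction s with
  | zero =>
    intro _ a ha
    refine ⟨0, zero_mem _, ?_⟩
    have : (a : Matrix (Fin m) (Fin m) D) = 0 := by
      ext i j; exact ha i j (by omega)
    rw [this, mul_zero]; rfl
  | succ s ih =>
    intro hs a ha
    let j₀ : Fin m := ⟨s, hs⟩
    let M : Submodule A A :=
      { carrier := {a | ∀ i (j : Fin m), s + 1 ≤ (j : ℕ) → (a : Matrix (Fin m) (Fin m) D) i j = 0}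
        zero_mem' := fun i j _ => rfl
        add_mem' := fun {a b} ha hb i j hj => by
          rw [Subalgebra.coe_add, Matrix.add_apply, ha i j hj, hb i j hj, add_zero]
        smul_mem' := fun c a ha i j hj => by
          rw [smul_eq_mul, Subalgebra.coe_mul, Matrix.mul_apply]
          exact Finset.sum_eq_zero fun l _ => by rw [ha l j hj, mul_zero] }
    let N := M.map (columnMap A j₀)
    have hNb : IsBoundedSubmodule N := by
      obtain ⟨K, hK⟩ := hA.exists_bound
      refine ⟨-K, ?_⟩
      rintro _ ⟨c, hc, rfl⟩ i
      push_cast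
      exact hK c c.2 i j₀
    have hproj := hA.projective_of_isBounded hm hNb
    let f : M →ₗ[A] N := (columnMap A j₀).submoduleMap M
    obtain ⟨σ, hσ⟩ := f.exists_rightInverse_of_surjective
      (LinearMap.range_eq_top.2 ((columnMap A j₀).submoduleMap_surjective M))
    have hσ' : ∀ w : N, f (σ w) = w := fun w => LinearMap.congr_fun hσ w
    let w := f ⟨a, ha⟩
    have h1 : ∃ a' : A, a' ∈ Ring.jacobson A ^ k ∧ (a' : Matrix (Fin m) (Fin m) D) =
        b * ((σ w : A) : Matrix (Fin m) (Fin m) D) := by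
      by_cases hN : N = ⊥
      · have : w = 0 := Subtype.ext ((Submodule.mem_bot A).1 (hN ▸ w.2))
        refine ⟨0, zero_mem _, ?_⟩
        rw [this, map_zero]
        simp
      obtain ⟨n, hn⟩ := exists_eq_chain hA hm he hpos hϖ hNb hN
      have h2 := hb n w (hn ▸ w.2)
      rw [← jacobson_pow_smul_chain he hpos hϖ, ← hn] at h2
      exact hA.exists_eq_mul_of_smul_mem M N σ w h2
    obtain ⟨a₁, ha₁, hba₁⟩ := h1
    obtain ⟨a₂, ha₂, hba₂⟩ := ih (by omega) (a - σ w) fun i j hj => by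
      rcases hj.eq_or_lt with h | h
      · have hj₀ : j = j₀ := Fin.ext h.symm
        rw [hj₀]
        have h7 := congrFun (congrArg Subtype.val (hσ' w)) i
        change ((σ w : A) : Matrix (Fin m) (Fin m) D) i j₀ =
          (a : Matrix (Fin m) (Fin m) D) i j₀ at h7
        change (a : Matrix (Fin m) (Fin m) D) i j₀ -
          ((σ w : A) : Matrix (Fin m) (Fin m) D) i j₀ = 0
        rw [h7, sub_self]
      · exact M.sub_mem ha (σ w).2 i j h
    refine ⟨a₁ + a₂, add_mem ha₁ ha₂, ?_⟩
    rw [Subalgebra.coe_add, hba₁, hba₂, Subalgebra.coe_sub, mul_sub, add_sub_cancel]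

end ChainShift

end InnerFormSL

namespace InnerFormSL

open Matrix.Module

/-! ### Splitting the norm of the chain by a basis -/

section Splitting

variable {F : Type*} [Field F] [ValuativeRel F] [TopologicalSpace F]
  [IsNonarchimedeanLocalField F]
variable {D : Type*} [DivisionRing D] [Algebra F D] [FiniteDimensional F D] {m : ℕ}
variable {A : Subalgebra 𝒪[F] (Matrix (Fin m) (Fin m) D)} {e : ℕ} {ϖ : F}

variable (A e ϖ) in
/-- The ball of radius `s` for the norm on the column space attached to the chain of `A`. -/
def chainBall (s : ℝ) : Submodule A (Fin m → D) := chain A e ϖ ⌈e * s⌉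

theorem chainBall_div (hpos : 0 < e) (n : ℤ) :
    chainBall A e ϖ ((n : ℝ) / e) = chain A e ϖ n := by
  have : (e : ℝ) ≠ 0 := by exact_mod_cast hpos.ne'
  rw [chainBall, mul_div_cancel₀ _ this, Int.ceil_intCast]

theorem rightMul_mem_chainBall (hA : IsHereditaryOrder F A) (hm : 0 < m)
    (he : IsRamificationIndex F A e) (hpos : 0 < e) (hϖ : ordF F ϖ = 1) {w : Fin m → D} {s t : ℝ}
    {d : D} (hw : w ∈ chainBall A e ϖ s) (hd : d ∈ ball F t) :
    rightMul A d w ∈ chainBall A e ϖ (s + t) := by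
  by_cases h0 : d = 0
  · have : rightMul A d w = 0 := by ext i; simp [rightMul_apply, h0]
    rw [this]; exact zero_mem _
  rw [mem_ball_of_ne h0] at hd
  obtain ⟨c, hc, h⟩ := map_rightMul_chain hA hm he hpos hϖ h0
  have h1 : rightMul A d w ∈ chain A e ϖ (⌈e * s⌉ + c) := h _ ▸ ⟨w, hw, rfl⟩
  refine chain_antitone he hpos hϖ ?_ h1
  rw [← Int.ceil_add_intCast, hc]
  refine Int.ceil_mono ?_
  rw [← mul_add]
  gcongr

/-- Among the vectors with last nonzero coordinate `1` at the place `i`, one is deepest in the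
chain. -/
theorem exists_deepest (hA : IsHereditaryOrder F A) (hpos : 0 < e) (hϖ : ordF F ϖ = 1)
    (i : Fin m) : ∃ (w : Fin m → D) (n : ℤ), w i = 1 ∧ (∀ j, i < j → w j = 0) ∧
      w ∈ chain A e ϖ n ∧
      ∀ (w' : Fin m → D) (n' : ℤ), w' i = 1 → (∀ j, i < j → w' j = 0) → w' ∈ chain A e ϖ n' →
        n' ≤ n := by
  obtain ⟨K, hK⟩ := hA.exists_bound
  obtain ⟨n, ⟨w, h1, h2, h3⟩, hn⟩ := Int.exists_greatest_of_bdd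
    (P := fun n => ∃ w : Fin m → D, w i = 1 ∧ (∀ j, i < j → w j = 0) ∧ w ∈ chain A e ϖ n)
    ⟨e * (K + 1), fun n ⟨w, h1, _, h3⟩ => by
      have h4 := mem_ball_of_mem_chain hpos hϖ hK h3 i
      have he' : (0 : ℝ) < e := by exact_mod_cast hpos
      rw [h1, mem_ball_of_ne one_ne_zero, valD_one, sub_nonpos, div_le_iff₀ he'] at h4
      have : (n : ℝ) ≤ ((e * (K + 1) : ℤ) : ℝ) := by push_cast; linarith
      exact_mod_cast this⟩
    (by
      obtain ⟨n, hn⟩ := exists_mem_chain (A := A) hpos hϖ (Pi.single i 1)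
      exact ⟨n, _, Pi.single_eq_same _ _, fun j hj => Pi.single_eq_of_ne hj.ne' _, hn⟩)
  exact ⟨w, n, h1, h2, h3, fun w' n' h1' h2' h3' => hn n' ⟨w', h1', h2', h3'⟩⟩

/-- An ultrametric triangular reduction: the columns of `g` are the deepest vectors `w i` with last
nonzero coordinate `1` at `i`, and `x i` is their depth. If a combination lies in a ball, dividing
by its last nonzero coefficient `u i` gives a competitor of `w i`, so maximality bounds `v(u i)`;
that term is subtracted and the argument repeated. -/
theorem exists_splitting_matrix (hA : IsHereditaryOrder F A) (hm : 0 < m)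
    (he : IsRamificationIndex F A e) (hpos : 0 < e) (hϖ : ordF F ϖ = 1) :
    ∃ (g : Matrix (Fin m) (Fin m) D) (x : Fin m → ℝ), ∀ (s : ℝ) (u : Fin m → D),
      g • u ∈ chainBall A e ϖ s ↔ ∀ i, u i ∈ ball F (s - x i) := by
  have he' : (0 : ℝ) < e := by exact_mod_cast hpos
  choose w n hw1 hw0 hwn hmax using exists_deepest (A := A) (D := D) hA hpos hϖ
  have hsum : ∀ u : Fin m → D, (Matrix.of fun j i => w i j : Matrix (Fin m) (Fin m) D) • u =
      ∑ i, rightMul A (u i) (w i) := fun u => by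
    ext j
    rw [Finset.sum_apply]
    rfl
  have hmem : ∀ i (s : ℝ) (d : D), d ∈ ball F (s - n i / e) →
      rightMul A d (w i) ∈ chainBall A e ϖ s := fun i s d hd => by
    have h1 : w i ∈ chainBall A e ϖ ((n i : ℝ) / e) := by rw [chainBall_div hpos]; exact hwn i
    have h2 := rightMul_mem_chainBall hA hm he hpos hϖ h1 hd
    rwa [add_sub_cancel] at h2
  refine ⟨Matrix.of fun j i => w i j, fun i => n i / e, fun s u => ?_⟩
  rw [hsum]
  constructor
  · suffices H : ∀ t ≤ m, ∀ u : Fin m → D, (∀ i : Fin m, t ≤ (i : ℕ) → u i = 0) →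
        ∑ i, rightMul A (u i) (w i) ∈ chainBall A e ϖ s → ∀ i, u i ∈ ball F (s - n i / e) from
      H m le_rfl u fun i hi => absurd hi (by omega)
    intro t
    induction t with
    | zero => intro _ u hu _ i; rw [hu i (by omega)]; exact AddSubgroup.zero_mem _
    | succ t ih =>
      intro ht u hu hs
      let i₀ : Fin m := ⟨t, ht⟩
      have h1 : u i₀ ∈ ball F (s - n i₀ / e) := by
        by_cases h0 : u i₀ = 0
        · rw [h0]; exact AddSubgroup.zero_mem _
        have h2 := rightMul_mem_chainBall hA hm he hpos hϖ hs
          (.inr le_rfl : (u i₀)⁻¹ ∈ ball F (valD F (u i₀)⁻¹))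
        have h3 : ∀ j, i₀ ≤ j → rightMul A (u i₀)⁻¹ (∑ i, rightMul A (u i) (w i)) j = w i₀ j :=
          fun j hj => by
            rw [rightMul_apply, Finset.sum_apply, Finset.sum_eq_single i₀, rightMul_apply,
              mul_assoc, mul_inv_cancel₀ h0, mul_one]
            · intro i _ hi
              rw [rightMul_apply]
              rcases lt_or_gt_of_ne hi with h | h
              · rw [hw0 i j (h.trans_le hj), zero_mul]
              · rw [hu i (by have : t < (i : ℕ) := h; omega), mul_zero]
            · simp
        have h4 := hmax i₀ _ _ ((h3 _ le_rfl).trans (hw1 i₀))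
          (fun j hj => (h3 j hj.le).trans (hw0 i₀ j hj)) h2
        have h5 := (Int.le_ceil _).trans (Int.cast_le (R := ℝ).2 h4)
        rw [valD_inv F h0] at h5
        rw [mem_ball_of_ne h0, sub_le_comm, le_div_iff₀ he']
        linarith
      have h6 : ∑ i, rightMul A (Function.update u i₀ 0 i) (w i) =
          ∑ i, rightMul A (u i) (w i) - rightMul A (u i₀) (w i₀) := by
        rw [← Finset.add_sum_erase _ _ (Finset.mem_univ i₀),
          ← Finset.add_sum_erase _ (fun i => rightMul A (u i) (w i)) (Finset.mem_univ i₀),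
          add_sub_cancel_left, Function.update_self]
        have h7 : rightMul A (0 : D) (w i₀) = 0 := by ext i; simp [rightMul_apply]
        rw [h7, zero_add]
        exact Finset.sum_congr rfl fun i hi => by
          rw [Function.update_of_ne (Finset.ne_of_mem_erase hi)]
      have h8 := ih (by omega) (Function.update u i₀ 0) (fun i hi => by
          by_cases hii : i = i₀
          · rw [hii, Function.update_self]
          · rw [Function.update_of_ne hii]
            refine hu i ?_
            have : (i : ℕ) ≠ t := fun h => hii (Fin.ext h)
            omega)
        (h6 ▸ Submodule.sub_mem _ hs (hmem _ _ _ h1))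
      intro i
      by_cases hii : i = i₀
      · rw [hii]; exact h1
      · have := h8 i
        rwa [Function.update_of_ne hii] at this
  · exact fun h => Submodule.sum_mem _ fun i _ => hmem i s _ (h i)

theorem exists_unit_of_injective_smul (F : Type*) [Field F] {D : Type*} [DivisionRing D]
    [Algebra F D] [FiniteDimensional F D] {m : ℕ} {g : Matrix (Fin m) (Fin m) D}
    (hg : ∀ u : Fin m → D, g • u = 0 → u = 0) : ∃ g' : GLD D m, (g' : Matrix _ _ D) = g := by
  have hinj : Function.Injective (g * · : Matrix (Fin m) (Fin m) D → _) := fun a b h => by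
    ext i j
    have h1 : g * (a - b) = 0 := by rw [mul_sub]; exact sub_eq_zero.2 h
    have h2 := hg (fun l => (a - b) l j) (funext fun l => congrFun (congrFun h1 l) j)
    exact sub_eq_zero.1 (congrFun h2 i)
  have hsurj := LinearMap.surjective_of_injective
    (f := LinearMap.mulLeft F g) hinj
  obtain ⟨h, hh⟩ := hsurj 1
  have hh' : g * h = 1 := hh
  refine ⟨⟨g, h, hh', hinj ?_⟩, rfl⟩
  change g * (h * g) = g * 1
  rw [← mul_assoc, hh', one_mul, mul_one]

/-- The norm attached to a hereditary order is split by a basis. -/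
theorem exists_splitting (hA : IsHereditaryOrder F A) (hm : 0 < m)
    (he : IsRamificationIndex F A e) (hpos : 0 < e) (hϖ : ordF F ϖ = 1) :
    ∃ (g : GLD D m) (x : Fin m → ℝ), ∀ (s : ℝ) (u : Fin m → D),
      (g : Matrix (Fin m) (Fin m) D) • u ∈ chainBall A e ϖ s ↔ ∀ i, u i ∈ ball F (s - x i) := by
  obtain ⟨g, x, h⟩ := exists_splitting_matrix hA hm he hpos hϖ
  obtain ⟨g', rfl⟩ := exists_unit_of_injective_smul F (g := g) fun u hu => by
    ext i
    by_contra h0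
    have h1 := (h (valD F (u i) + x i + 1) u).1 (hu ▸ zero_mem _) i
    rw [mem_ball_of_ne h0] at h1
    linarith
  exact ⟨g', x, h⟩

theorem IsHereditaryOrder.exists_moyPrasadPlus_subset (hA : IsHereditaryOrder F A) (hm : 0 < m)
    (he : IsRamificationIndex F A e) (j : ℕ) : ∃ (g : GLD D m) (x : Fin m → ℝ),
      moyPrasadPlus F D g x ((j : ℝ) / e) ⊆ unitFiltration F A (j + 1) := by
  obtain ⟨ϖ, -, hϖ⟩ := exists_ordF_eq F 1
  have hpos := he.pos hA hm
  have he' : (0 : ℝ) < e := by exact_mod_cast hpos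
  obtain ⟨g, x, h⟩ := exists_splitting hA hm he hpos hϖ
  refine ⟨g, x, fun γ hγ => ?_⟩
  obtain ⟨s, hs, p, hp, hpγ⟩ := Set.mem_iUnion₂.1 hγ
  have hs0 : 0 ≤ s := le_trans (by positivity) hs.le
  have hp' := sub_one_mem_matBall_of_mem_moyPrasadStd hs0 hp
  set a := (p : Matrix (Fin m) (Fin m) D) - 1 with ha
  obtain ⟨b, hb, hba⟩ := exists_mem_jacobson_pow_of_smul_mem_chain hA hm he hpos hϖ (k := j + 1)
    (b := (g : Matrix (Fin m) (Fin m) D) * a * ((g⁻¹ : GLD D m) : Matrix (Fin m) (Fin m) D))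
    fun n w hw => by
      have h1 : w = (g : Matrix (Fin m) (Fin m) D) •
          ((g⁻¹ : GLD D m) : Matrix (Fin m) (Fin m) D) • w := by
        rw [smul_smul, Units.mul_inv, one_smul]
      set u := ((g⁻¹ : GLD D m) : Matrix (Fin m) (Fin m) D) • w with hu
      rw [← chainBall_div hpos, h1, h] at hw
      have h2 : (g : Matrix (Fin m) (Fin m) D) • a • u ∈ chainBall A e ϖ (s + n / e) := by
        rw [h]
        refine fun i => AddSubgroup.sum_mem _ fun l _ => ?_
        have := mul_mem_ball (hp' i l) (hw l)
        rw [smul_eq_mul]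
        convert this using 2
        ring
      rw [mul_smul, mul_smul, ← hu]
      refine chain_antitone he hpos hϖ ?_ h2
      rw [div_lt_iff₀ he'] at hs
      rw [mul_add, mul_div_cancel₀ _ he'.ne', Int.ceil_add_intCast, add_comm]
      -- The strict inequality `s > j / e` rounds up to a shift by at least `j + 1`.
      have : (j : ℤ) < ⌈e * s⌉ := by
        rw [Int.lt_ceil]; push_cast; linarith
      push_cast
      omega
  refine ⟨b, hb, ?_⟩
  rw [hba, ha, mul_sub, sub_mul, mul_one, Units.mul_inv, add_sub_cancel, ← hpγ]
  rfl

end Splitting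

/-! ### Comparison of the two sets and existence of the minima -/

section Depth

variable {F : Type*} [Field F] [ValuativeRel F] [TopologicalSpace F]
  [IsNonarchimedeanLocalField F]
variable {D : Type*} [DivisionRing D] [Algebra F D] [FiniteDimensional F D] {m : ℕ}
variable {V : Type*} [AddCommGroup V] [Module ℂ V]

theorem HasFixedVector.mono {G : Type*} [Group G] {H : Subgroup G} {π : Representation ℂ H V}
    {K K' : Set G} (h : HasFixedVector π K) (hK : K' ⊆ K) : HasFixedVector π K' :=
  let ⟨v, hv, hfix⟩ := h
  ⟨v, hv, fun g hg => hfix g (hK hg)⟩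

theorem levelSet_subset_moyPrasadSet (hm : 0 < m) (π : Representation ℂ (derivedGL F D m) V) :
    levelSet F π ⊆ moyPrasadSet F π := by
  rintro _ ⟨A, e, j, hA, he, hfix, rfl⟩
  obtain ⟨g, x, h⟩ := hA.exists_moyPrasadPlus_subset hm he j
  exact ⟨by positivity, g, x, hfix.mono h⟩

/-- Every element of `moyPrasadSet` is bounded below by an element of `levelSet` with bounded
denominator. -/
theorem exists_mem_levelSet_le (hm : 0 < m) (π : Representation ℂ (derivedGL F D m) V) :
    ∃ N : ℕ, 0 < N ∧ ∀ r ∈ moyPrasadSet F π, ∃ k : ℕ, (k : ℝ) / N ∈ levelSet F π ∧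
      (k : ℝ) / N ≤ r := by
  obtain ⟨d, hd, hdv, hϖ⟩ := exists_valueGroup F D
  -- A common multiple of all the ramification indices `q * d` with `q ≤ m`.
  refine ⟨m.factorial * d, Nat.mul_pos m.factorial_pos hd, ?_⟩
  rintro r ⟨hr, g, x, hfix⟩
  obtain ⟨A, q, p, hq, hqm, hA, he, hsub, hle⟩ :=
    exists_hereditaryOrder_of_point hm hd hdv hϖ g x hr
  obtain ⟨c, hc⟩ := Nat.dvd_factorial hq hqm
  have hc0 : 0 < c := Nat.pos_of_ne_zero fun h => m.factorial_ne_zero (by rw [hc, h, mul_zero])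
  have hq' : (q : ℝ) ≠ 0 := by exact_mod_cast hq.ne'
  have hc' : (c : ℝ) ≠ 0 := by exact_mod_cast hc0.ne'
  have hd' : (d : ℝ) ≠ 0 := by exact_mod_cast hd.ne'
  have heq : ((p * c : ℕ) : ℝ) / ((m.factorial * d : ℕ) : ℝ) = (p : ℝ) / ((q * d : ℕ) : ℝ) := by
    rw [hc]; push_cast; field_simp
  refine ⟨p * c, ?_, heq ▸ hle⟩
  rw [heq]
  exact ⟨A, q * d, p, hA, he, hfix.mono hsub, rfl⟩

theorem exists_isLeast_moyPrasadSet_levelSet [TopologicalSpace D] [IsModuleTopology F D]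
    [Nontrivial V] (hm : 0 < m) (π : Representation ℂ (derivedGL F D m) V) (hπ : IsSmooth π) :
    ∃ r, IsLeast (moyPrasadSet F π) r ∧ IsLeast (levelSet F π) r := by
  obtain ⟨N, hN, h⟩ := exists_mem_levelSet_le hm π
  obtain ⟨r, hr⟩ := moyPrasadSet_nonempty π hπ
  obtain ⟨k, hk, -⟩ := h r hr
  classical
  -- With the common denominator `N`, well-ordering of the numerators produces the minimum, although
  -- `levelSet` itself is not shown to be discrete.
  have hex : ∃ k : ℕ, (k : ℝ) / N ∈ levelSet F π := ⟨k, hk⟩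
  have hmem := Nat.find_spec hex
  have hsub := levelSet_subset_moyPrasadSet hm π
  have hlow : (Nat.find hex : ℝ) / N ∈ lowerBounds (moyPrasadSet F π) := fun r hr => by
    obtain ⟨k, hk, hkr⟩ := h r hr
    refine le_trans ?_ hkr
    have : (Nat.find hex : ℝ) ≤ k := by exact_mod_cast Nat.find_min' hex hk
    gcongr
  exact ⟨_, ⟨hsub hmem, hlow⟩, hmem, fun s hs => hlow (hsub hs)⟩

end Depth

end InnerFormSL

end

theorem mainTheorem11
    (F : Type*) [Field F] [ValuativeRel F] [TopologicalSpace F] [IsNonarchimedeanLocalField F]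
    (D : Type*) [DivisionRing D] [Algebra F D] [FiniteDimensional F D] [Algebra.IsCentral F D]
    [TopologicalSpace D] [IsModuleTopology F D]
    (m : ℕ) (hm : 0 < m)
    (V : Type*) [AddCommGroup V] [Module ℂ V]
    (π : Representation ℂ (InnerFormSL.derivedGL F D m) V)
    (hsmooth : InnerFormSL.IsSmooth π) (hirr : π.IsIrreducible) :
    IsLeast (InnerFormSL.moyPrasadSet F π) (InnerFormSL.moyPrasadDepth F π) ∧
      IsLeast (InnerFormSL.levelSet F π) (InnerFormSL.normalizedLevel F π) ∧
      InnerFormSL.moyPrasadDepth F π = InnerFormSL.normalizedLevel F π := by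
  have hV : Nontrivial V := by
    have : IsSimpleModule _ π.asModule := π.irreducible_iff_isSimpleModule_asModule.1 hirr
    exact IsSimpleModule.nontrivial (MonoidAlgebra ℂ (InnerFormSL.derivedGL F D m)) π.asModule
  obtain ⟨r, hM, hL⟩ := InnerFormSL.exists_isLeast_moyPrasadSet_levelSet hm π hsmooth
  have hM' : InnerFormSL.moyPrasadDepth F π = r := hM.csInf_eq
  have hL' : InnerFormSL.normalizedLevel F π = r := hL.csInf_eq
  exact ⟨hM'.symm ▸ hM, hL'.symm ▸ hL, hM'.trans hL'.symm⟩
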